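/- **Bases and upgrades.** A *base hierarchy* is a nonempty set $B\subseteq\mathbb N\setminus\{0,1\}$ such that $b\mid S_B(b)$ for every $b\in B$, where $S_B(n)$ is the least element of $B$ greater than $n$, or $\infty$ if there is none (every positive integer divides and is less than $\infty$). Let $B_n$ denote the largest $b\in B$ with $b\le n$, or $\min B$ if $n<\min B$. For $b\ge 2$ and $m>0$ the $b$-decomposition of $m$ is $m=b^ea+r$ with $0<a<b$, $r<b^e$. Call $n$ *$B$-critical* if $B_n\mid n$. For base hierarchies $B,C$ with $\min B\le\min C$ the upgrade ${\uparrow}n={\uparrow}_B^Cn\in\mathbb N\cup\{\infty\}$ is defined recursively: ${\uparrow}n=n$ if $n<\min B$. If $n\ge \min B$, let $b=B_n$, and for any $c$ put $\Delta_b^c(m)={\uparrow}m$ for $m<b$ and $\Delta_b^c(m)=c^{\Delta_b^c(e)}\cdot{\uparrow}a+\Delta_b^c(r)$ for $m=b^ea+r\ge b$ in $b$-decomposition; then ${\uparrow}n=\Delta_b^c(n)$ for the least $c\in C$ with ${\uparrow}(n-1)<\Delta_b^c(n)<S_C(c)$, and ${\uparrow}n=\infty$ if there is no such $c$. **Ouroboros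 successor.** For $i\geq 1$ let $B_{+i}=\bigcup_n B_{+i}^n$, where $B_{+i}^n=\{\min B+1\}$ for $n\le\min B$, and for $n>\min B$, with $c=\max B_{+i}^{n-1}$ and $\Delta$ computed relative to $B$ and $B_{+i}^{n-1}$: (1) if $n$ is not $B$-critical, $B_{+i}^n=B_{+i}^{n-1}$; (2) if $n\in B$, then $B_{+i}^n=B_{+i}^{n-1}\cup\{ca\}$, where $a$ is minimal with $\Delta_b^c(n-1)<ca$, $b=B_{n-1}$; (3) if $n\notin B$ is $B$-critical, then $B_{+i}^n=B_{+i}^{n-1}\cup\{d_1,\dots,d_i\}$, where $d_0=c$ and $d_{j+1}=\Delta_b^{d_j}(n)$, $b=B_n$. **The function $\vartheta$.** Let $\Omega$ be the first uncountable ordinal and $\varepsilon_{\Omega+1}$ the least $\varepsilon>\Omega$ with $\omega^\varepsilon=\varepsilon$. Every $\xi>0$ has a unique $\Omega$-normal form $\xi=\Omega^\alpha\beta+\gamma$ with $0<\beta<\Omega$, $\gamma<\Omega^\alpha$. For $\xi<\varepsilon_{\Omega+1}$ put $0^*=0$ and $\xi^*=\max\{\beta,\alpha^*,\gamma^*\}$,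 and $$\vartheta(\xi)=\min\{\omega^\theta>\xi^*:\ \forall\zeta<\xi\ (\zeta^*<\omega^\theta\Rightarrow\vartheta(\zeta)<\omega^\theta)\}.$$ **Ordinal interpretation.** For a base hierarchy $B$ define $o_B:\mathbb N\to\Omega$ recursively. For $b\in B$ let $O(n)=o_B(n)$ for $n<b$, and $O(n)=\Omega^{O(e)}o_B(a)+O(r)$ for $n=b^ea+r\ge b$ in $b$-decomposition. Put $o_B(n)=n$ if $n<\min B$, and $o_B(\min B)=\vartheta(1)=\omega$. For $n>\min B$ let $b=B_n$. * If $n=b$ and $d$ is the predecessor of $b$ in $B$, then $o_B(n)=o_B(b-d)\cdot2$. * If $n=ba+r$ with $0<r<b$, then $o_B(n)=o_B(ba)+o_B(r)$. * If $n\notin B$ and $n=b^2u+bv$ with $v<b$, let $O(b^2u)=\Omega\cdot\alpha$, let $\beta$ be the least ordinal with $o_B(b)<\vartheta(\alpha+\beta)$, and let $\tilde v=v-2$ if $u=0$ and $2\le v<\min B$, $\tilde v=v$ otherwise. Then $o_B(n)=\vartheta(\alpha+\beta+\omega^{o_B(\tilde v)})$, where the term $\omega^{o_B(\tilde v)}$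 is omitted if $\tilde v=0$. **Fundamental sequences.** For $\xi<\varepsilon_{\Omega+1}$ define $\tau(\xi)$ by: $\tau(0)=0$; $\tau(\zeta+1)=1$; $\tau(\Omega^\alpha\beta+\gamma)=\tau(\gamma)$ if $\gamma>0$; $\tau(\Omega^\alpha\beta)=\beta$ for $\beta$ a limit; $\tau(\Omega^\alpha(\beta+1))=\tau(\alpha)$ for $\alpha$ a limit; $\tau(\Omega^{\alpha+1}(\beta+1))=\Omega$. For $\theta<\Omega$ define $\xi[\theta]$ by: $0[\theta]=1[\theta]=0$; $(\Omega^\alpha\beta+\gamma)[\theta]=\Omega^\alpha\beta+\gamma[\theta]$ if $0<\gamma<\Omega^\alpha$; $(\Omega^\alpha\beta)[\theta]=\Omega^\alpha\theta$ for $\beta$ a limit; $(\Omega^\alpha(\beta+1))[\theta]=\Omega^\alpha\beta+\Omega^\alpha[\theta]$ if $\beta>0$; $\Omega^\alpha[\theta]=\Omega^{\alpha[\theta]}$ for $\alpha$ a limit; $\Omega^{\alpha+1}[\theta]=\Omega^\alpha\theta$. Let $\mathrm{Fix}$ be the set of $\xi<\varepsilon_{\Omega+1}$ with $(\xi[1])^*<\xi^*=\tau(\xi)=\vartheta(\gamma)$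 for some $\gamma>\xi$, and $\mathrm{Jump}=\mathrm{Fix}\cup\mathrm{Succ}\cup\{0\}$. Put $\vartheta^*(\xi)=\vartheta(\zeta)$ if $\xi=\zeta+1$, $\vartheta^*(\xi)=\tau(\xi)$ if $\xi\in\mathrm{Fix}$, and $\vartheta^*(\xi)=0$ otherwise. For $\xi=\Omega\alpha+\beta$ with $\beta<\Omega$ put $\check\xi=\Omega\alpha$ if $\vartheta^*(\xi)>0$, and $\check\xi=\xi$ otherwise. Buchholz's fundamental sequences $\xi[\![n]\!]$, $n<\omega$, for $\xi$ below the Bachmann–Howard ordinal $\sup\{\vartheta(\Omega),\vartheta(\Omega^\Omega),\dots\}$ are given by: $0[\![n]\!]=0$; $(\omega^\alpha+\beta)[\![n]\!]=\omega^\alpha+\beta[\![n]\!]$ if $0<\beta<\omega^{\alpha+1}$; and for $\xi=\vartheta(\zeta)$ with $\tau=\tau(\check\zeta)$: * if $\zeta\in\Omega\cap\mathrm{Jump}$, then $\xi[\![n]\!]=\vartheta^*(\zeta)\cdot n$; otherwise * if $0<\tau<\Omega$, then $\xi[\![n]\!]=\vartheta\big(\check\zeta[\tau[\![n]\!]]+\vartheta^*(\zeta)\big)$;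 * if $\tau=\Omega$, then $\xi[\![0]\!]=\vartheta^*(\zeta)$ and $\xi[\![n+1]\!]=\vartheta\big(\check\zeta[\xi[\![n]\!]]\big)$. **Proposition.** Let $B$ be a base hierarchy, let $0<i<\min B-1$, and let $C=B_{+(i+1)}$. Then for every $n>0$ the upgrade ${\uparrow}_B^Cn$ is a finite positive integer, and $$o_C({\uparrow}_B^Cn-1)\ \ge\ o_B(n)[\![i]\!].$$ -/

import Mathlib

open Ordinal Order
open scoped Classical

namespace Ouroboros

noncomputable section

/-! ## Base hierarchies and the upgrade operator -/

/-- `B_n`: the largest `b ∈ B` with `b ≤ n`, and `min B` if `n < min B`. -/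
def baseOf (B : Set ℕ) (n : ℕ) : ℕ :=
  if sInf B ≤ n then sSup {b | b ∈ B ∧ b ≤ n} else sInf B

/-- `S_B(n)`: the least `b ∈ B` with `b > n`, and `⊤` if there is none. -/
def nextBase (B : Set ℕ) (n : ℕ) : ℕ∞ :=
  sInf {x : ℕ∞ | ∃ b ∈ B, n < b ∧ x = (b : ℕ∞)}

/-- A nonempty set of naturals `≥ 2` such that `b` divides `S_B(b)` for all `b ∈ B`
(every positive integer divides `⊤`). -/
structure IsBaseHierarchy (B : Set ℕ) : Prop where
  two_le : ∀ b ∈ B, 2 ≤ b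
  nonempty : B.Nonempty
  dvd_next : ∀ b ∈ B, ∀ s : ℕ, nextBase B b = (s : ℕ∞) → b ∣ s

/-- Base change from `b` to `c` where the `b`-coefficients are changed by `up`:
`m ↦ up m` for `m < b`, and `b ^ e * a + r ↦ c ^ (e changed) * up a + (r changed)` for
`m = b ^ e * a + r ≥ b` in `b`-decomposition. The values `up x` matter for `x < b` only.
(The first test only makes the recursion well founded; bases are always `≥ 2`.) -/
def baseChangeWith (up : ℕ → ℕ∞) (b c : ℕ) (m : ℕ) : ℕ∞ :=
  if _hb : b < 2 then 0
  else if _hm : m < b then up m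
  else
    (c : ℕ∞) ^ baseChangeWith up b c (Nat.log b m) * up (m / b ^ Nat.log b m)
      + baseChangeWith up b c (m % b ^ Nat.log b m)
termination_by m
decreasing_by
  · exact Nat.log_lt_self b (by omega)
  · exact (Nat.mod_lt _ (Nat.pow_pos (by omega))).trans_le (Nat.pow_log_le_self b (by omega))

/-- The upgrade `↑n` of `n` from `B` to `C`: `n` itself if `n < min B`, and otherwise the value at
`n` of the base change from `b = B_n` to the least `c ∈ C` with
`↑(n - 1) < (base change of n to c) < S_C(c)`, or `⊤` if there is no such `c`. -/
def upgrade (B C : Set ℕ) (n : ℕ) : ℕ∞ :=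
  let up : ℕ → ℕ∞ := fun m => if _h : m < n then upgrade B C m else 0
  let witnesses : Set ℕ := {c | c ∈ C ∧ up (n - 1) < baseChangeWith up (baseOf B n) c n ∧
    baseChangeWith up (baseOf B n) c n < nextBase C c}
  if n < sInf B then (n : ℕ∞)
  else if witnesses.Nonempty then baseChangeWith up (baseOf B n) (sInf witnesses) n
  else ⊤
termination_by n

/-- The base change from `b` to `c` relative to the upgrade operator from `B` to `C`. -/
def baseChange (B C : Set ℕ) (b c m : ℕ) : ℕ∞ :=
  baseChangeWith (upgrade B C) b c m

/-! ## The ouroboros successor -/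

/-- `d_0 = c` and `d_{j+1}` is the base change of `n` from `B_n` to `d_j`, computed with the
coefficients upgraded from `B` to `C`. -/
def chain (B C : Set ℕ) (n c : ℕ) : ℕ → ℕ
  | 0 => c
  | j + 1 => (baseChange B C (baseOf B n) (chain B C n c j) n).toNat

/-- The `n`-th stage of the construction of the ouroboros successor with parameter `i`. -/
def stage (B : Set ℕ) (i : ℕ) : ℕ → Set ℕ
  | 0 => {sInf B + 1}
  | k + 1 =>
    if k + 1 ≤ sInf B then {sInf B + 1}
    else if k + 1 ∈ B then
      stage B i k ∪ {sSup (stage B i k) *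
        sInf {a : ℕ | baseChange B (stage B i k) (baseOf B k) (sSup (stage B i k)) k
          < ((sSup (stage B i k) * a : ℕ) : ℕ∞)}}
    else if baseOf B (k + 1) ∣ k + 1 then
      stage B i k ∪ {d | ∃ j, 1 ≤ j ∧ j ≤ i ∧
        d = chain B (stage B i k) (k + 1) (sSup (stage B i k)) j}
    else stage B i k

/-- The ouroboros successor `B_{+i}`. -/
def ouroboros (B : Set ℕ) (i : ℕ) : Set ℕ := ⋃ n, stage B i n

/-! ## The collapsing function `ϑ` -/

/-- `Ω`, the first uncountable ordinal. -/
abbrev Om : Ordinal.{0} := ω_ 1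

/-- `ε_{Ω+1}`, the least `ε > Ω` with `ω ^ ε = ε`. -/
def epsOm : Ordinal.{0} := sInf {e | Om < e ∧ ω ^ e = e}

/-- The exponent `α` of the `Ω`-normal form `ξ = Ω ^ α * β + γ` of `ξ ≠ 0`. -/
def nfExp (ξ : Ordinal.{0}) : Ordinal.{0} := log Om ξ

/-- The coefficient `β` (with `0 < β < Ω`) of the `Ω`-normal form of `ξ ≠ 0`. -/
def nfCoeff (ξ : Ordinal.{0}) : Ordinal.{0} := ξ / Om ^ nfExp ξ

/-- The remainder `γ < Ω ^ α` of the `Ω`-normal form of `ξ ≠ 0`. -/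
def nfRem (ξ : Ordinal.{0}) : Ordinal.{0} := ξ % Om ^ nfExp ξ

theorem nfRem_lt {ξ : Ordinal.{0}} (h : ξ ≠ 0) : nfRem ξ < ξ :=
  mod_opow_log_lt_self Om h

/-- The maximal coefficient `ξ*` of `ξ < ε_{Ω+1}`. In this and the next definitions, the test
`nfExp ξ < ξ` always succeeds for `0 < ξ < ε_{Ω+1}`. -/
def maxCoeff (ξ : Ordinal.{0}) : Ordinal.{0} :=
  if _h0 : ξ = 0 then 0
  else max (nfCoeff ξ)
    (max (if _h : nfExp ξ < ξ then maxCoeff (nfExp ξ) else 0) (maxCoeff (nfRem ξ)))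
termination_by ξ
decreasing_by
  · assumption
  · exact nfRem_lt _h0

/-- `ϑ(ξ)` is the least `ω ^ θ > ξ*` such that `ϑ(ζ) < ω ^ θ` for all `ζ < ξ` with
`ζ* < ω ^ θ`. -/
def theta (ξ : Ordinal.{0}) : Ordinal.{0} :=
  sInf {x | (∃ θ : Ordinal.{0}, x = ω ^ θ) ∧ maxCoeff ξ < x ∧
    ∀ ζ, ∀ _h : ζ < ξ, maxCoeff ζ < x → theta ζ < x}
termination_by ξ

/-! ## The ordinal interpretation of the natural numbers -/

/-- `O_f^b(n)`: it is `f n` for `n < b`, and `Ω ^ O(e) * f a + O(r)` for `n = b ^ e * a + r ≥ b`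
in `b`-decomposition. (The first test only makes the recursion well founded.) -/
def bigO (f : ℕ → Ordinal.{0}) (b : ℕ) (n : ℕ) : Ordinal.{0} :=
  if _hb : b < 2 then 0
  else if _hn : n < b then f n
  else
    Om ^ bigO f b (Nat.log b n) * f (n / b ^ Nat.log b n) + bigO f b (n % b ^ Nat.log b n)
termination_by n
decreasing_by
  · exact Nat.log_lt_self b (by omega)
  · exact (Nat.mod_lt _ (Nat.pow_pos (by omega))).trans_le (Nat.pow_log_le_self b (by omega))

/-- `α` with `O_f^b(b² u) = Ω * α`, where `n = b² u + b v + w` and `v, w < b`. -/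
def alphaWith (f : ℕ → Ordinal.{0}) (b n : ℕ) : Ordinal.{0} :=
  bigO f b (b ^ 2 * (n / b ^ 2)) / Om

/-- The least `β` with `f b < ϑ(α + β)`. -/
def betaWith (f : ℕ → Ordinal.{0}) (b n : ℕ) : Ordinal.{0} :=
  sInf {β | f b < theta (alphaWith f b n + β)}

/-- For `n = b² u + b v + w`: the number `v - 2` if `u = 0` and `2 ≤ v < min B` (where `q` is
`min B`), and `v` otherwise. -/
def tildeV (q b n : ℕ) : ℕ :=
  if n / b ^ 2 = 0 ∧ 2 ≤ n / b % b ∧ n / b % b < q then n / b % b - 2 else n / b % b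

/-- `ζ = α + β + ω ^ f(ṽ)`, where the last term is omitted if `ṽ = 0`. -/
def zetaWith (f : ℕ → Ordinal.{0}) (q b n : ℕ) : Ordinal.{0} :=
  alphaWith f b n + betaWith f b n + (if tildeV q b n = 0 then 0 else ω ^ f (tildeV q b n))

/-- The ordinal interpretation `o_B(n)`. Within the recursion `f` is `o_B` below `n`. -/
def ordInterp (B : Set ℕ) (n : ℕ) : Ordinal.{0} :=
  let f : ℕ → Ordinal.{0} := fun m => if _h : m < n then ordInterp B m else 0
  let b := baseOf B n
  if n < sInf B then (n : Ordinal.{0})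
  else if n = sInf B then theta 1
  else if n ∈ B then f (n - sSup {d | d ∈ B ∧ d < n}) * 2
  else if ¬ b ∣ n then f (b * (n / b)) + f (n % b)
  else theta (zetaWith f (sInf B) b n)
termination_by n

/-! ## Fundamental sequences -/

/-- The cofinality `τ(ξ)` of `ξ < ε_{Ω+1}`. -/
def cofin (ξ : Ordinal.{0}) : Ordinal.{0} :=
  if _h0 : ξ = 0 then 0
  else if ∃ ζ, ξ = ζ + 1 then 1
  else if nfRem ξ ≠ 0 then cofin (nfRem ξ)
  else if IsSuccLimit (nfCoeff ξ) then nfCoeff ξ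
  else if IsSuccLimit (nfExp ξ) then
    (if _h : nfExp ξ < ξ then cofin (nfExp ξ) else 0)
  else Om
termination_by ξ
decreasing_by
  · exact nfRem_lt _h0
  · assumption

/-- The fundamental sequence `ξ[θ]` of `ξ < ε_{Ω+1}`, indexed by `θ < Ω`. The last three cases
are `Ω ^ α * (β + 1)` with `β > 0`, then `Ω ^ α` with `α` a limit, then `Ω ^ (α + 1)`. -/
def fsOm (ξ θ : Ordinal.{0}) : Ordinal.{0} :=
  if _h0 : ξ = 0 then 0
  else if ξ = 1 then 0
  else if nfRem ξ ≠ 0 then Om ^ nfExp ξ * nfCoeff ξ + fsOm (nfRem ξ) θ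
  else if IsSuccLimit (nfCoeff ξ) then Om ^ nfExp ξ * θ
  else if _h : Om ^ nfExp ξ < ξ then
    Om ^ nfExp ξ * Ordinal.pred (nfCoeff ξ) + fsOm (Om ^ nfExp ξ) θ
  else if IsSuccLimit (nfExp ξ) then
    (if _h' : nfExp ξ < ξ then Om ^ fsOm (nfExp ξ) θ else 0)
  else Om ^ Ordinal.pred (nfExp ξ) * θ
termination_by ξ
decreasing_by
  · exact nfRem_lt _h0
  · assumption
  · assumption

/-- The set `Fix`: `(ξ[1])* < ξ* = τ(ξ) = ϑ(γ)` for some `γ > ξ`. -/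
def IsFix (ξ : Ordinal.{0}) : Prop :=
  ξ < epsOm ∧ maxCoeff (fsOm ξ 1) < maxCoeff ξ ∧ maxCoeff ξ = cofin ξ ∧
    ∃ γ, ξ < γ ∧ γ < epsOm ∧ cofin ξ = theta γ

/-- The set `Jump`: `Fix`, the successors, and `0`. -/
def IsJump (ξ : Ordinal.{0}) : Prop :=
  IsFix ξ ∨ (∃ ζ, ξ = ζ + 1) ∨ ξ = 0

/-- `ϑ*(ξ)`. -/
def thetaStar (ξ : Ordinal.{0}) : Ordinal.{0} :=
  if ∃ ζ, ξ = ζ + 1 then theta (Ordinal.pred ξ)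
  else if IsFix ξ then cofin ξ
  else 0

/-- `ξ` with its countable part removed if `ϑ*(ξ) > 0`, and `ξ` itself otherwise. -/
def checkOrd (ξ : Ordinal.{0}) : Ordinal.{0} :=
  if 0 < thetaStar ξ then Om * (ξ / Om) else ξ

/-- The `ζ < ε_{Ω+1}` with `ϑ(ζ) = ξ`. -/
def thetaInv (ξ : Ordinal.{0}) : Ordinal.{0} := sInf {ζ | ζ < epsOm ∧ theta ζ = ξ}

/-- Buchholz's fundamental sequence `ξ[n]` of an ordinal `ξ` below the Bachmann-Howard ordinal.
If `ξ = ω ^ α + β` with `0 < β < ω ^ (α + 1)`, then `ξ[n] = ω ^ α + β[n]`. Otherwise `ξ ≠ 0` is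
`ϑ(ζ)`, and the cases are `ζ ∈ Ω ∩ Jump`, then `τ = Ω`, then `0 < τ < Ω`, for `τ` the cofinality of
`checkOrd ζ`; here `τ ≤ ζ* < ϑ(ζ) = ξ`, so that the test `τ < ξ` always succeeds. -/
def fsTheta (ξ : Ordinal.{0}) (n : ℕ) : Ordinal.{0} :=
  if _h0 : ξ = 0 then 0
  else if ω ^ log ω ξ < ξ then ω ^ log ω ξ + fsTheta (ξ - ω ^ log ω ξ) n
  else if thetaInv ξ < Om ∧ IsJump (thetaInv ξ) then thetaStar (thetaInv ξ) * n
  else if cofin (checkOrd (thetaInv ξ)) = Om then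
    Nat.rec (thetaStar (thetaInv ξ)) (fun _ x => theta (fsOm (checkOrd (thetaInv ξ)) x)) n
  else if _h : cofin (checkOrd (thetaInv ξ)) < ξ then
    theta (fsOm (checkOrd (thetaInv ξ)) (fsTheta (cofin (checkOrd (thetaInv ξ))) n)
      + thetaStar (thetaInv ξ))
  else 0
termination_by ξ
decreasing_by
  · exact sub_omega0_opow_log_lt _h0
  · assumption

end

end Ouroboros

namespace Ouroboros

noncomputable section

/-! ## The ordinals `Ω` and `ε_{Ω+1}` -/

/-! Write q = min B, so that q ≥ i + 2 ≥ 3, and let U be the upgrade from B to C. The construction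
of C by stages shows that U is finite and strictly increasing (`exists_ouro`). The proof rests on
two facts.

The first is that upgrading preserves the interpretation: o_C(U n) = o_B(n) (`ordInterp_U`). As o_C
is strictly increasing, o_C(U n - 1) lies below o_B(n), and the question is how far below. If q does
not divide n, then o_B(n) is a successor, U n = U(n - 1) + 1, and both sides of the claim equal
o_B(n - 1).

The second is the strict inequality o_B(n)[i] < o_C(U n - 1) for multiples n of q (`fsTheta_lt`). On
sums, fundamental sequences act on the last summand, so the heart is a critical n outside B, with
base b. There C receives the chain d_0, d_1, …, d_{i+1} with d_{j+1} = Δ_b^{d_j}(n); the base of U n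
is d_{i+1}, and U n is the next term d_{i+2}. It therefore suffices that o_B(n)[i] ≤ o_C(d_{i+1} -
d_i), because d_{i+1} - d_i < d_{i+1} - 1 < U n. In base d_j the number d_{j+1} has the upgraded
digits of n, and subtracting d_j borrows one unit from them. Hence o_C(d_{j+1} - d_j) is a value of
ϑ whose argument is slightly smaller than that for n, but which must exceed o_C(d_j): one link of
the chain pays for one step of the fundamental sequence. The exception is n = 2b, where each link
merely doubles. There are three cases, with n = b²u + bv:

n = 2b: each link doubles the value, and o_B(n)[i] is the ω-power in o_B(b) times i
(`fsTheta_le_of_eq_two`).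

ṽ > 0: each link raises the countable part β by at least t + 1, where t is the tail term left after
borrowing; i links and the final tail t dominate ω^{o(ṽ)}[i] (`fsTheta_le_of_tilde_pos`).

v = 0: if the cofinality is Ω, each link absorbs one iteration x ↦ ϑ(A[x]); if it is countable, it
equals o_B(a) for a digit a, and induction applies to a (`fsTheta_le_of_eq_zero`). Here
`fsOm_bigO_le` compares A[x] with the interpretation of Δ(n) - 1. By `checkOrd_minBeta`, the minimal
β is exactly a countable part that Buchholz's definition discards, and by `thetaStar_minBeta_le` the
starting value ϑ* is at most o_B(b).

For the first fact at a critical n, only β could change, since o_C(d_{i+1}) replaces o_B(b) in its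
definition. If ṽ = 0, all d_j still have values below o_B(n), so β stays the same; otherwise its
increase is absorbed by ω^{o(ṽ)}. -/

theorem omega0_lt_Om : ω < Om := omega0_lt_omega_one

theorem Om_pos : 0 < Om := omega0_pos.trans omega0_lt_Om

theorem one_lt_Om : 1 < Om := one_lt_omega0.trans omega0_lt_Om

theorem Om_eq_ord : Om = (Cardinal.aleph 1).ord := (Cardinal.ord_aleph 1).symm

theorem opow_lt_Om {a b : Ordinal.{0}} (ha : a < Om) (hb : b < Om) : a ^ b < Om := by
  rw [Om_eq_ord] at *
  exact Ordinal.isPrincipal_opow_ord (Cardinal.aleph0_le_aleph 1) ha hb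

theorem add_lt_Om {a b : Ordinal.{0}} (ha : a < Om) (hb : b < Om) : a + b < Om := by
  rw [Om_eq_ord] at *
  exact Ordinal.isPrincipal_add_ord (Cardinal.aleph0_le_aleph 1) ha hb

theorem natCast_lt_Om (n : ℕ) : (n : Ordinal.{0}) < Om := (natCast_lt_omega0 n).trans omega0_lt_Om

theorem isSuccLimit_Om : IsSuccLimit Om := by
  rw [Om_eq_ord]
  exact Cardinal.isSuccLimit_ord (Cardinal.aleph0_le_aleph 1)

theorem omega0_opow_Om : ω ^ Om = Om := by
  apply le_antisymm _ (right_le_opow _ one_lt_omega0)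
  rw [opow_le_of_isSuccLimit omega0_ne_zero isSuccLimit_Om]
  intro b hb
  exact (opow_lt_Om omega0_lt_Om hb).le

theorem Om_opow (ξ : Ordinal.{0}) : Om ^ ξ = ω ^ (Om * ξ) := by
  rw [opow_mul, omega0_opow_Om]

theorem countable_Iio_of_lt_Om {x : Ordinal.{0}} (hx : x < Om) : (Set.Iio x).Countable := by
  rw [← Cardinal.le_aleph0_iff_set_countable, Cardinal.mk_Iio_ordinal]
  rw [Om_eq_ord, Cardinal.lt_ord, ← Cardinal.succ_aleph0, Order.lt_succ_iff] at hx
  rw [Cardinal.lift_le_aleph0]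
  exact hx

theorem epsOm_spec : Om < epsOm ∧ ω ^ epsOm = epsOm := by
  apply csInf_mem (s := {e | Om < e ∧ ω ^ e = e})
  exact ⟨epsilon (Om + 1), (lt_add_one Om).trans_le (right_le_veblen _ _), omega0_opow_epsilon _⟩

theorem Om_lt_epsOm : Om < epsOm := epsOm_spec.1

theorem omega0_opow_epsOm : ω ^ epsOm = epsOm := epsOm_spec.2

theorem lt_epsOm_of_lt_Om {x : Ordinal.{0}} (hx : x < Om) : x < epsOm := hx.trans Om_lt_epsOm

theorem epsOm_pos : 0 < epsOm := lt_epsOm_of_lt_Om Om_pos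

theorem add_lt_epsOm {a b : Ordinal.{0}} (ha : a < epsOm) (hb : b < epsOm) : a + b < epsOm := by
  rw [← omega0_opow_epsOm] at *
  exact isPrincipal_add_omega0_opow _ ha hb

theorem mul_lt_epsOm {a b : Ordinal.{0}} (ha : a < epsOm) (hb : b < epsOm) : a * b < epsOm := by
  obtain ⟨e, he⟩ : ∃ e, e = epsOm := ⟨_, rfl⟩
  have h : ω ^ ω ^ e = epsOm := by rw [he, omega0_opow_epsOm, omega0_opow_epsOm]
  rw [← h] at ha hb ⊢
  exact isPrincipal_mul_omega0_opow_opow _ ha hb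

theorem Om_opow_lt_epsOm {a : Ordinal.{0}} (ha : a < epsOm) : Om ^ a < epsOm := by
  rw [Om_opow, ← omega0_opow_epsOm]
  exact (opow_lt_opow_iff_right one_lt_omega0).2 (mul_lt_epsOm Om_lt_epsOm ha)

/-- Otherwise ω^ξ = ξ with ξ > Ω, against the leastness of `epsOm`. This is what makes the tests
`nfExp ξ < ξ` in the definitions succeed. -/
theorem lt_Om_opow_self {ξ : Ordinal.{0}} (h : ξ < epsOm) : ξ < Om ^ ξ := by
  by_contra! hle
  have h1 : ω ^ ξ ≤ Om ^ ξ := opow_le_opow_left _ omega0_lt_Om.le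
  have h2 : ω ^ ξ = ξ := le_antisymm (h1.trans hle) (right_le_opow _ one_lt_omega0)
  have h0 : 1 < ξ := by
    rcases lt_or_ge 1 ξ with h | h
    · exact h
    · rcases Order.le_one_iff.1 h with rfl | rfl
      · simp at hle
      · simp only [opow_one] at hle; exact absurd hle (not_le.2 one_lt_Om)
  have h3 : Om < ξ := (left_lt_opow one_lt_Om h0).trans_le hle
  exact absurd (csInf_le' (s := {e | Om < e ∧ ω ^ e = e}) ⟨h3, h2⟩) (not_le.2 h)

/-! ## `Ω`-normal forms -/

theorem nf_eq (ξ : Ordinal.{0}) : Om ^ nfExp ξ * nfCoeff ξ + nfRem ξ = ξ := div_add_mod _ _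

theorem nfCoeff_ne_zero {ξ : Ordinal.{0}} (h : ξ ≠ 0) : nfCoeff ξ ≠ 0 :=
  (div_opow_log_pos Om h).ne'

theorem nfCoeff_lt (ξ : Ordinal.{0}) : nfCoeff ξ < Om := div_opow_log_lt ξ one_lt_Om

theorem nfRem_lt_opow (ξ : Ordinal.{0}) : nfRem ξ < Om ^ nfExp ξ :=
  mod_lt _ (opow_ne_zero _ Om_pos.ne')

theorem nfExp_lt {ξ : Ordinal.{0}} (h0 : ξ ≠ 0) (h : ξ < epsOm) : nfExp ξ < ξ := by
  refine (log_le_self Om ξ).lt_of_ne fun he => ?_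
  have h1 := opow_log_le_self Om h0
  rw [he] at h1
  exact absurd (lt_Om_opow_self h) (not_lt.2 h1)

theorem nfExp_nf {α β γ : Ordinal.{0}} (h0 : β ≠ 0) (hβ : β < Om) (hγ : γ < Om ^ α) :
    nfExp (Om ^ α * β + γ) = α := by
  rw [nfExp, log_opow_mul_add one_lt_Om h0 hγ, log_eq_zero hβ, add_zero]

theorem nfCoeff_nf {α β γ : Ordinal.{0}} (h0 : β ≠ 0) (hβ : β < Om) (hγ : γ < Om ^ α) :
    nfCoeff (Om ^ α * β + γ) = β := by
  rw [nfCoeff, nfExp_nf h0 hβ hγ, mul_add_div _ (opow_ne_zero _ Om_pos.ne'),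
    div_eq_zero_of_lt hγ, add_zero]

theorem nfRem_nf {α β γ : Ordinal.{0}} (h0 : β ≠ 0) (hβ : β < Om) (hγ : γ < Om ^ α) :
    nfRem (Om ^ α * β + γ) = γ := by
  rw [nfRem, nfExp_nf h0 hβ hγ, mul_add_mod_self, mod_eq_of_lt hγ]

theorem opow_le_nf {α β γ : Ordinal.{0}} (h0 : β ≠ 0) : Om ^ α ≤ Om ^ α * β + γ :=
  (Ordinal.le_mul_left _ (pos_iff_ne_zero.2 h0)).trans le_self_add

theorem nf_ne_zero {α β γ : Ordinal.{0}} (h0 : β ≠ 0) : Om ^ α * β + γ ≠ 0 :=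
  ((opow_pos α Om_pos).trans_le (opow_le_nf h0)).ne'

theorem nf_lt_epsOm {α β γ : Ordinal.{0}} (hα : α < epsOm) (hβ : β < Om) (hγ : γ < epsOm) :
    Om ^ α * β + γ < epsOm :=
  add_lt_epsOm (mul_lt_epsOm (Om_opow_lt_epsOm hα) (lt_epsOm_of_lt_Om hβ)) hγ

/-- Induction along `Ω`-normal forms below `ε_{Ω+1}`. -/
theorem nfInduction {P : Ordinal.{0} → Prop} (h0 : P 0)
    (hs : ∀ α β γ : Ordinal.{0}, α < epsOm → β ≠ 0 → β < Om → γ < Om ^ α → γ < epsOm →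
      P α → P γ → P (Om ^ α * β + γ)) (ξ : Ordinal.{0}) (h : ξ < epsOm) : P ξ := by
  induction ξ using WellFoundedLT.induction with
  | ind ξ ih =>
    by_cases hξ : ξ = 0
    · rw [hξ]; exact h0
    · have h1 := nfExp_lt hξ h
      have h2 := nfRem_lt hξ
      rw [← nf_eq ξ]
      exact hs _ _ _ (h1.trans h) (nfCoeff_ne_zero hξ) (nfCoeff_lt ξ) (nfRem_lt_opow ξ)
        (h2.trans h) (ih _ h1 (h1.trans h)) (ih _ h2 (h2.trans h))

/-! ## Maximal coefficients -/

@[simp] theorem maxCoeff_zero : maxCoeff 0 = 0 := by rw [maxCoeff]; simp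

theorem maxCoeff_nf {α β γ : Ordinal.{0}} (hα : α < epsOm) (h0 : β ≠ 0) (hβ : β < Om)
    (hγ : γ < Om ^ α) :
    maxCoeff (Om ^ α * β + γ) = max β (max (maxCoeff α) (maxCoeff γ)) := by
  have h1 : α < Om ^ α * β + γ := (lt_Om_opow_self hα).trans_le (opow_le_nf h0)
  rw [maxCoeff, dif_neg (nf_ne_zero h0), nfExp_nf h0 hβ hγ, nfCoeff_nf h0 hβ hγ,
    nfRem_nf h0 hβ hγ, dif_pos h1]

theorem maxCoeff_of_lt_Om {ρ : Ordinal.{0}} (h : ρ < Om) : maxCoeff ρ = ρ := by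
  by_cases h0 : ρ = 0
  · simp [h0]
  · have := maxCoeff_nf (α := 0) (γ := 0) epsOm_pos h0 h (by simp)
    simpa using this

theorem maxCoeff_lt_Om {ξ : Ordinal.{0}} (h : ξ < epsOm) : maxCoeff ξ < Om := by
  refine nfInduction (P := fun ξ => maxCoeff ξ < Om) (by simpa using Om_pos) ?_ ξ h
  · intro α β γ hα h0 hβ hγ _ iα iγ
    rw [maxCoeff_nf hα h0 hβ hγ]
    exact max_lt hβ (max_lt iα iγ)

/-- The elements of `ε_{Ω+1}` with coefficients below `p`. -/
def CoeffBelow (p ξ : Ordinal.{0}) : Prop := ξ < epsOm ∧ maxCoeff ξ < p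

theorem coeffBelow_nf {p α β γ : Ordinal.{0}} (hα : α < epsOm) (h0 : β ≠ 0) (hβ : β < Om)
    (hγ : γ < Om ^ α) (hγ' : γ < epsOm) :
    CoeffBelow p (Om ^ α * β + γ) ↔ β < p ∧ CoeffBelow p α ∧ CoeffBelow p γ := by
  have := nf_lt_epsOm hα hβ hγ'
  simp only [CoeffBelow, maxCoeff_nf hα h0 hβ hγ, max_lt_iff]
  tauto

theorem coeffBelow_zero {p : Ordinal.{0}} (hp : 0 < p) : CoeffBelow p 0 :=
  ⟨epsOm_pos, by simpa using hp⟩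

theorem coeffBelow_of_lt_Om {p x : Ordinal.{0}} (hx : x < Om) (h : x < p) : CoeffBelow p x :=
  ⟨lt_epsOm_of_lt_Om hx, by rwa [maxCoeff_of_lt_Om hx]⟩

/-- These ordinals are generated from 0 by the map (α, β, γ) ↦ Ω^α β + γ with β < p. Each stage `T
n` of the closure is countable, because p is. -/
theorem countable_coeffBelow {p : Ordinal.{0}} (hp : p < Om) : {ξ | CoeffBelow p ξ}.Countable := by
  let T : ℕ → Set Ordinal.{0} := fun n => Nat.rec {0} (fun _ s => s ∪
    (fun t : Ordinal.{0} × Ordinal.{0} × Ordinal.{0} => Om ^ t.1 * t.2.1 + t.2.2) ''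
      (s ×ˢ (Set.Iio p ×ˢ s))) n
  have hT : ∀ n, (T n).Countable := by
    intro n
    induction n with
    | zero => exact Set.countable_singleton 0
    | succ n ih =>
      exact ih.union ((ih.prod ((countable_Iio_of_lt_Om hp).prod ih)).image _)
  have hmono : Monotone T := monotone_nat_of_le_succ fun n => Set.subset_union_left
  refine (Set.countable_iUnion hT).mono ?_
  rintro ξ ⟨h, hξ⟩
  revert hξ
  refine nfInduction (P := fun ξ => maxCoeff ξ < p → ξ ∈ ⋃ n, T n)
    (fun _ => Set.mem_iUnion.2 ⟨0, rfl⟩) ?_ ξ h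
  · intro α β γ hα h0 hβ hγ _ iα iγ hξ
    rw [maxCoeff_nf hα h0 hβ hγ] at hξ
    obtain ⟨m, hm⟩ := Set.mem_iUnion.1 (iα ((le_max_left _ _).trans_lt
      ((le_max_right _ _).trans_lt hξ)))
    obtain ⟨k, hk⟩ := Set.mem_iUnion.1 (iγ ((le_max_right _ _).trans_lt
      ((le_max_right _ _).trans_lt hξ)))
    refine Set.mem_iUnion.2 ⟨max m k + 1, Or.inr ⟨(α, β, γ), ⟨hmono (le_max_left _ _) hm,
      (le_max_left _ _).trans_lt hξ, hmono (le_max_right _ _) hk⟩, rfl⟩⟩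

/-! ## The collapsing function -/

/-- The defining property of the values that `theta ξ` minimizes. -/
def ThetaBound (ξ x : Ordinal.{0}) : Prop :=
  (∃ θ : Ordinal.{0}, x = ω ^ θ) ∧ maxCoeff ξ < x ∧ ∀ ζ < ξ, maxCoeff ζ < x → theta ζ < x

theorem theta_eq (ξ : Ordinal.{0}) : theta ξ = sInf {x | ThetaBound ξ x} := by
  rw [theta]; rfl

/-- Closing off ω times: `g` sends y to an ω-power above all ϑ(ζ) with ζ < ξ and coefficients below
y. Such ζ are countably many, so `g` stays below Ω. The supremum of the iterates from ξ* + 1 is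
countable, closed under ϑ below ξ, and additively principal, hence an ω-power. -/
theorem exists_thetaBound {ξ : Ordinal.{0}} (h : ξ < epsOm) (hth : ∀ ζ < ξ, theta ζ < Om) :
    ∃ x < Om, ThetaBound ξ x := by
  let g : Ordinal.{0} → Ordinal.{0} := fun y =>
    ω ^ max y (⨆ ζ : {ζ // CoeffBelow y ζ ∧ ζ < ξ}, theta ζ.1 + 1)
  have hg : ∀ y < Om, g y < Om := by
    intro y hy
    refine opow_lt_Om omega0_lt_Om (max_lt hy ?_)
    have : Countable {ζ // CoeffBelow y ζ ∧ ζ < ξ} :=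
      ((countable_coeffBelow hy).mono fun z hz => hz.1).to_subtype
    exact Ordinal.iSup_lt_omega_one fun ζ => isSuccLimit_Om.add_one_lt (hth _ ζ.2.2)
  have hgle : ∀ y, y ≤ g y := fun y =>
    (le_max_left _ _).trans (right_le_opow _ one_lt_omega0)
  have hgth : ∀ y ζ, CoeffBelow y ζ → ζ < ξ → theta ζ < g y := by
    intro y ζ h1 h2
    refine (lt_add_one _).trans_le (le_trans ?_ (right_le_opow _ one_lt_omega0))
    refine le_trans ?_ (le_max_right _ _)
    have : Small.{0} {ζ // CoeffBelow y ζ ∧ ζ < ξ} :=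
      small_of_injective (β := Set.Iio ξ) (f := fun ζ => ⟨ζ.1, ζ.2.2⟩)
        fun a b hab => Subtype.ext (congrArg (fun z : Set.Iio ξ => z.1) hab)
    exact Ordinal.le_iSup (fun ζ : {ζ // CoeffBelow y ζ ∧ ζ < ξ} => theta ζ.1 + 1) ⟨ζ, h1, h2⟩
  let s : ℕ → Ordinal.{0} := fun n => Nat.rec (maxCoeff ξ + 1) (fun _ y => g y) n
  have hs : ∀ n, s n < Om := by
    intro n
    induction n with
    | zero => exact isSuccLimit_Om.add_one_lt (maxCoeff_lt_Om h)
    | succ n ih => exact hg _ ih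
  have hle : ∀ n, s n ≤ ⨆ n, s n := fun n => Ordinal.le_iSup s n
  have hx0 : maxCoeff ξ < ⨆ n, s n := (lt_add_one _).trans_le (hle 0)
  refine ⟨⨆ n, s n, Ordinal.iSup_lt_omega_one hs, ?_, hx0, ?_⟩
  · have hp : IsPrincipal (· + ·) (⨆ n, s n) := by
      intro a b ha hb
      obtain ⟨m, hm⟩ := Ordinal.lt_iSup_iff.1 ha
      obtain ⟨k, hk⟩ := Ordinal.lt_iSup_iff.1 hb
      have hmono : Monotone s := monotone_nat_of_le_succ fun n => hgle (s n)
      have h1 : a < s (max m k + 1) :=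
        (hm.trans_le (hmono (le_max_left _ _))).trans_le (hgle _)
      have h2 : b < s (max m k + 1) :=
        (hk.trans_le (hmono (le_max_right _ _))).trans_le (hgle _)
      exact (isPrincipal_add_omega0_opow _ h1 h2).trans_le (hle (max m k + 1))
    rcases isPrincipal_add_iff_zero_or_omega0_opow.1 hp with h0 | ⟨θ, hθ⟩
    · exact absurd (h0 ▸ hx0) (not_lt.2 zero_le)
    · exact ⟨θ, hθ.symm⟩
  · intro ζ hζ hζx
    obtain ⟨n, hn⟩ := Ordinal.lt_iSup_iff.1 hζx
    exact (hgth (s n) ζ ⟨hζ.trans h, hn⟩ hζ).trans_le (hle (n + 1))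

theorem theta_lt_Om {ξ : Ordinal.{0}} (h : ξ < epsOm) : theta ξ < Om := by
  induction ξ using WellFoundedLT.induction with
  | ind ξ ih =>
    obtain ⟨x, hx, hb⟩ := exists_thetaBound h fun ζ hζ => ih ζ hζ (hζ.trans h)
    rw [theta_eq]
    exact (csInf_le' (s := {x | ThetaBound ξ x}) hb).trans_lt hx

theorem thetaBound_theta {ξ : Ordinal.{0}} (h : ξ < epsOm) : ThetaBound ξ (theta ξ) := by
  obtain ⟨x, -, hb⟩ := exists_thetaBound h fun ζ hζ => theta_lt_Om (hζ.trans h)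
  rw [theta_eq]
  exact csInf_mem (s := {x | ThetaBound ξ x}) ⟨x, hb⟩

theorem theta_le {ξ x : Ordinal.{0}} (h : ThetaBound ξ x) : theta ξ ≤ x := by
  rw [theta_eq]
  exact csInf_le' (s := {x | ThetaBound ξ x}) h

theorem exists_theta_eq {ξ : Ordinal.{0}} (h : ξ < epsOm) : ∃ θ : Ordinal.{0}, theta ξ = ω ^ θ :=
  (thetaBound_theta h).1

theorem maxCoeff_lt_theta {ξ : Ordinal.{0}} (h : ξ < epsOm) : maxCoeff ξ < theta ξ :=
  (thetaBound_theta h).2.1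

theorem theta_lt_theta {ζ ξ : Ordinal.{0}} (h : ξ < epsOm) (hlt : ζ < ξ)
    (hc : maxCoeff ζ < theta ξ) : theta ζ < theta ξ :=
  (thetaBound_theta h).2.2 ζ hlt hc

theorem theta_le_theta {ζ ξ : Ordinal.{0}} (h : ξ < epsOm) (hle : ζ ≤ ξ)
    (hc : maxCoeff ζ < theta ξ) : theta ζ ≤ theta ξ := by
  rcases hle.eq_or_lt with rfl | hlt
  · exact le_rfl
  · exact (theta_lt_theta h hlt hc).le

/-- If ζ < ξ had the same value, then ζ* < ϑ(ζ) = ϑ(ξ), and the closure condition for ξ would give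
ϑ(ζ) < ϑ(ξ). This makes `thetaInv` a genuine inverse. -/
theorem theta_inj {ζ ξ : Ordinal.{0}} (hζ : ζ < epsOm) (hξ : ξ < epsOm)
    (he : theta ζ = theta ξ) : ζ = ξ := by
  rcases lt_trichotomy ζ ξ with h | h | h
  · exact absurd he (theta_lt_theta hξ h (he ▸ maxCoeff_lt_theta hζ)).ne
  · exact h
  · exact absurd he.symm (theta_lt_theta hζ h (he ▸ maxCoeff_lt_theta hξ)).ne

theorem thetaInv_theta {ξ : Ordinal.{0}} (h : ξ < epsOm) : thetaInv (theta ξ) = ξ := by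
  have : {ζ | ζ < epsOm ∧ theta ζ = theta ξ} = {ξ} := by
    ext ζ
    exact ⟨fun hζ => theta_inj hζ.1 h hζ.2, fun hζ => by
      rw [Set.mem_singleton_iff.1 hζ]; exact ⟨h, rfl⟩⟩
  rw [thetaInv, this, csInf_singleton]

theorem theta_pos {ξ : Ordinal.{0}} (h : ξ < epsOm) : 0 < theta ξ :=
  (zero_le (a := maxCoeff ξ)).trans_lt (maxCoeff_lt_theta h)

theorem isPrincipal_theta {ξ : Ordinal.{0}} (h : ξ < epsOm) : IsPrincipal (· + ·) (theta ξ) := by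
  obtain ⟨θ, hθ⟩ := exists_theta_eq h
  rw [hθ]
  exact isPrincipal_add_omega0_opow θ

theorem add_lt_theta {ξ a b : Ordinal.{0}} (h : ξ < epsOm) (ha : a < theta ξ) (hb : b < theta ξ) :
    a + b < theta ξ := isPrincipal_theta h ha hb

theorem theta_lt_theta_of_lt_Om {δ δ' : Ordinal.{0}} (h : δ < δ') (h' : δ' < Om) :
    theta δ < theta δ' := by
  refine theta_lt_theta (lt_epsOm_of_lt_Om h') h ?_
  have := maxCoeff_lt_theta (lt_epsOm_of_lt_Om h')
  rw [maxCoeff_of_lt_Om h'] at this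
  rw [maxCoeff_of_lt_Om (h.trans h')]
  exact h.trans this

/-- On countable arguments ϑ is strictly increasing with ω-powers as values, so its exponents cannot
lag behind the argument. -/
theorem opow_le_theta {δ : Ordinal.{0}} (h : δ < Om) : ω ^ δ ≤ theta δ := by
  induction δ using WellFoundedLT.induction with
  | ind δ ih =>
    obtain ⟨θ, hθ⟩ := exists_theta_eq (lt_epsOm_of_lt_Om h)
    rw [hθ]
    refine opow_le_opow_right omega0_pos (le_of_forall_lt fun c hc => ?_)
    have h1 := (ih c hc (hc.trans h)).trans_lt (theta_lt_theta_of_lt_Om hc h)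
    rwa [hθ, opow_lt_opow_iff_right one_lt_omega0] at h1

/-- By induction ω^{δ+1} meets all conditions in the definition of ϑ(δ). The extra 1 in the exponent
is needed only from the first epsilon number on. -/
theorem theta_le_opow {δ : Ordinal.{0}} (h : δ < Om) : theta δ ≤ ω ^ (δ + 1) := by
  induction δ using WellFoundedLT.induction with
  | ind δ ih =>
    refine theta_le ⟨⟨_, rfl⟩, ?_, fun ζ hζ _ => ?_⟩
    · rw [maxCoeff_of_lt_Om h]
      exact (lt_add_one δ).trans_le (right_le_opow _ one_lt_omega0)
    · refine (ih ζ hζ (hζ.trans h)).trans_lt ((opow_lt_opow_iff_right one_lt_omega0).2 ?_)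
      exact (Order.add_one_le_of_lt hζ).trans_lt (lt_add_one δ)

theorem theta_of_lt_opow {θ : Ordinal.{0}} (hl : IsSuccLimit θ) (h : θ < Om) (hlt : θ < ω ^ θ) :
    theta θ = ω ^ θ := by
  refine le_antisymm (theta_le ⟨⟨_, rfl⟩, by rwa [maxCoeff_of_lt_Om h], fun ζ hζ _ => ?_⟩)
    (opow_le_theta h)
  exact (theta_le_opow (hζ.trans h)).trans_lt
    ((opow_lt_opow_iff_right one_lt_omega0).2 (hl.add_one_lt hζ))

@[simp] theorem theta_zero : theta 0 = 1 := by
  refine le_antisymm (theta_le ⟨⟨0, by simp⟩, by simp, fun ζ hζ => absurd hζ (not_lt.2 zero_le)⟩) ?_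
  exact Order.one_le_iff_pos.2 (theta_pos epsOm_pos)

@[simp] theorem theta_one : theta 1 = ω := by
  refine le_antisymm (theta_le ⟨⟨1, by simp⟩, ?_, fun ζ hζ _ => ?_⟩) ?_
  · rw [maxCoeff_of_lt_Om one_lt_Om]; exact one_lt_omega0
  · rw [Order.lt_one_iff.1 hζ, theta_zero]; exact one_lt_omega0
  · simpa using opow_le_theta one_lt_Om

end

end Ouroboros

namespace Ouroboros

noncomputable section

/-! ## Ordinals below the Bachmann-Howard ordinal -/

/-- The tower `Ω, Ω ^ Ω, …`. -/
def tower : ℕ → Ordinal.{0}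
  | 0 => Om
  | k + 1 => Om ^ tower k

theorem tower_lt_epsOm (k : ℕ) : tower k < epsOm := by
  induction k with
  | zero => exact Om_lt_epsOm
  | succ k ih => exact Om_opow_lt_epsOm ih

theorem maxCoeff_Om_opow {α : Ordinal.{0}} (h : α < epsOm) :
    maxCoeff (Om ^ α) = max 1 (maxCoeff α) := by
  have := maxCoeff_nf (γ := 0) h one_ne_zero one_lt_Om (opow_pos α Om_pos)
  simpa using this

theorem maxCoeff_tower (k : ℕ) : maxCoeff (tower k) = 1 := by
  induction k with
  | zero =>
    have := maxCoeff_Om_opow (lt_epsOm_of_lt_Om one_lt_Om)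
    rw [opow_one, maxCoeff_of_lt_Om one_lt_Om] at this
    simpa [tower] using this
  | succ k ih => rw [tower, maxCoeff_Om_opow (tower_lt_epsOm k), ih, max_self]

theorem tower_lt_succ (k : ℕ) : tower k < tower (k + 1) := lt_Om_opow_self (tower_lt_epsOm k)

theorem tower_mono : Monotone tower := monotone_nat_of_le_succ fun k => (tower_lt_succ k).le

theorem one_lt_theta_tower (k : ℕ) : 1 < theta (tower k) := by
  have := maxCoeff_lt_theta (tower_lt_epsOm k)
  rwa [maxCoeff_tower] at this

theorem exists_lt_tower {ξ : Ordinal.{0}} (h : ξ < epsOm) : ∃ k, ξ < tower k := by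
  refine nfInduction (P := fun ξ => ∃ k, ξ < tower k) ⟨0, Om_pos⟩ ?_ ξ h
  rintro α β γ _ _ hβ hγ _ ⟨k, hk⟩ -
  exact ⟨k + 1, opow_mul_add_lt_opow hβ hγ hk⟩

theorem theta_tower_mono : Monotone fun k => theta (tower k) := fun k l hkl =>
  theta_le_theta (tower_lt_epsOm l) (tower_mono hkl) (by
    rw [maxCoeff_tower]; exact one_lt_theta_tower l)

/-- `x` lies below the Bachmann-Howard ordinal. -/
def BelowBH (x : Ordinal.{0}) : Prop := ∃ k, x < theta (tower k)

theorem BelowBH.mono {x y : Ordinal.{0}} (h : BelowBH y) (hxy : x ≤ y) : BelowBH x :=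
  h.imp fun _ hk => hxy.trans_lt hk

theorem BelowBH.add {x y : Ordinal.{0}} (hx : BelowBH x) (hy : BelowBH y) : BelowBH (x + y) := by
  obtain ⟨k, hk⟩ := hx
  obtain ⟨l, hl⟩ := hy
  exact ⟨max k l, add_lt_theta (tower_lt_epsOm _) (hk.trans_le (theta_tower_mono (le_max_left _ _)))
    (hl.trans_le (theta_tower_mono (le_max_right _ _)))⟩

theorem BelowBH.lt_Om {x : Ordinal.{0}} (h : BelowBH x) : x < Om := by
  obtain ⟨k, hk⟩ := h
  exact hk.trans (theta_lt_Om (tower_lt_epsOm k))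

theorem belowBH_theta {ζ : Ordinal.{0}} (h : ζ < epsOm) (hc : BelowBH (maxCoeff ζ)) :
    BelowBH (theta ζ) := by
  obtain ⟨k, hk⟩ := hc
  obtain ⟨l, hl⟩ := exists_lt_tower h
  exact ⟨max k l, theta_lt_theta (tower_lt_epsOm _) (hl.trans_le (tower_mono (le_max_right _ _)))
    (hk.trans_le (theta_tower_mono (le_max_left _ _)))⟩

theorem belowBH_natCast (n : ℕ) : BelowBH n := by
  induction n with
  | zero => exact ⟨0, by simpa using theta_pos (tower_lt_epsOm 0)⟩
  | succ n ih =>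
    rw [Nat.cast_succ]
    exact ih.add ⟨0, one_lt_theta_tower 0⟩

theorem BelowBH.omega0_opow {x : Ordinal.{0}} (h : BelowBH x) : BelowBH (ω ^ x) := by
  refine (belowBH_theta (lt_epsOm_of_lt_Om h.lt_Om) ?_).mono (opow_le_theta h.lt_Om)
  rwa [maxCoeff_of_lt_Om h.lt_Om]

/-- Every `ω ^ θ` below the Bachmann-Howard ordinal is a value of `ϑ`. -/
theorem exists_theta_eq_opow {θ : Ordinal.{0}} (h : BelowBH (ω ^ θ)) :
    ∃ γ < epsOm, theta γ = ω ^ θ := by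
  by_cases h0 : θ = 0
  · exact ⟨0, epsOm_pos, by simp [h0]⟩
  have h1 : 1 < ω ^ θ := one_lt_opow.2 ⟨one_lt_omega0, h0⟩
  -- The least element γ of S collapses to ω^θ itself: by leastness, every ζ < γ with ζ* < ω^θ has
  -- ϑ(ζ) < ω^θ, so ω^θ is a candidate for ϑ(γ).
  let S : Set Ordinal.{0} := {γ | γ < epsOm ∧ maxCoeff γ < ω ^ θ ∧ ω ^ θ ≤ theta γ}
  have hS : S.Nonempty := by
    obtain ⟨k, hk⟩ := h
    exact ⟨tower k, tower_lt_epsOm k, by rwa [maxCoeff_tower], hk.le⟩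
  obtain ⟨hγ, hc, hle⟩ := csInf_mem hS
  refine ⟨sInf S, hγ, le_antisymm (theta_le ⟨⟨θ, rfl⟩, hc, fun ζ hζ hζc => ?_⟩) hle⟩
  by_contra! hζ'
  exact absurd (csInf_le' (s := S) ⟨hζ.trans hγ, hζc, hζ'⟩) (not_le.2 hζ)

/-! ## Multiples of `Ω` plus countable ordinals -/

/-- Reduces statements about Ω·α + ρ to induction along the normal form of α: multiplication by Ω
keeps the coefficients and turns an exponent e into 1 + e. -/
theorem Om_mul_nf (e β γ ρ : Ordinal.{0}) :
    Om * (Om ^ e * β + γ) + ρ = Om ^ (1 + e) * β + (Om * γ + ρ) := by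
  rw [mul_add, opow_add, opow_one, mul_assoc, add_assoc]

theorem Om_mul_add_lt {e γ ρ : Ordinal.{0}} (hγ : γ < Om ^ e) (hρ : ρ < Om) :
    Om * γ + ρ < Om ^ (1 + e) := by
  calc Om * γ + ρ < Om * γ + Om := by gcongr
    _ = Om * (γ + 1) := by rw [mul_add, mul_one]
    _ ≤ Om * Om ^ e := by gcongr; exact Order.add_one_le_of_lt hγ
    _ = _ := by rw [opow_add, opow_one]

theorem one_add_lt_epsOm {e : Ordinal.{0}} (h : e < epsOm) : 1 + e < epsOm :=
  add_lt_epsOm (lt_epsOm_of_lt_Om one_lt_Om) h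

theorem Om_mul_lt_epsOm {α : Ordinal.{0}} (h : α < epsOm) : Om * α < epsOm :=
  mul_lt_epsOm Om_lt_epsOm h

theorem Om_mul_add_lt_epsOm {α ρ : Ordinal.{0}} (h : α < epsOm) (hρ : ρ < Om) :
    Om * α + ρ < epsOm := add_lt_epsOm (Om_mul_lt_epsOm h) (lt_epsOm_of_lt_Om hρ)

theorem maxCoeff_Om_mul_add {α ρ : Ordinal.{0}} (h : α < epsOm) (hρ : ρ < Om) :
    maxCoeff (Om * α + ρ) = max (maxCoeff (Om * α)) ρ := by
  refine nfInduction (P := fun α => maxCoeff (Om * α + ρ) = max (maxCoeff (Om * α)) ρ) ?_ ?_ α h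
  · simp [maxCoeff_of_lt_Om hρ]
  · intro e β γ he h0 hβ hγ _ _ iγ
    have h2 := Om_mul_nf e β γ 0
    simp only [add_zero] at h2
    have h3 := Om_mul_add_lt hγ Om_pos
    simp only [add_zero] at h3
    rw [Om_mul_nf, h2, maxCoeff_nf (one_add_lt_epsOm he) h0 hβ (Om_mul_add_lt hγ hρ),
      maxCoeff_nf (one_add_lt_epsOm he) h0 hβ h3, iγ, max_assoc, max_assoc]

theorem maxCoeff_le_maxCoeff_one_add {e : Ordinal.{0}} : maxCoeff e ≤ maxCoeff (1 + e) := by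
  rcases lt_or_ge e ω with he | he
  · have h1 := he.trans omega0_lt_Om
    rw [maxCoeff_of_lt_Om h1, maxCoeff_of_lt_Om (add_lt_Om one_lt_Om h1)]
    exact le_add_self
  · rw [one_add_of_omega0_le he]

theorem maxCoeff_le_maxCoeff_Om_mul {α : Ordinal.{0}} (h : α < epsOm) :
    maxCoeff α ≤ maxCoeff (Om * α) := by
  refine nfInduction (P := fun α => maxCoeff α ≤ maxCoeff (Om * α)) (by simp) ?_ α h
  intro e β γ he h0 hβ hγ _ _ iγ
  have h2 := Om_mul_nf e β γ 0
  have h3 := Om_mul_add_lt hγ Om_pos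
  simp only [add_zero] at h2 h3
  rw [h2, maxCoeff_nf (one_add_lt_epsOm he) h0 hβ h3, maxCoeff_nf he h0 hβ hγ]
  exact max_le_max le_rfl (max_le_max maxCoeff_le_maxCoeff_one_add iγ)

/-- With a common multiple of Ω no side condition is left: the coefficients of Ω·α and the bound ρ <
ρ' are already below ϑ(Ω·α + ρ'). -/
theorem theta_add_lt_theta_add {α ρ ρ' : Ordinal.{0}} (h : α < epsOm) (hρ : ρ < ρ')
    (hρ' : ρ' < Om) : theta (Om * α + ρ) < theta (Om * α + ρ') := by
  refine theta_lt_theta (Om_mul_add_lt_epsOm h hρ') (by gcongr) ?_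
  have h1 := maxCoeff_lt_theta (Om_mul_add_lt_epsOm h hρ')
  rw [maxCoeff_Om_mul_add h hρ', max_lt_iff] at h1
  rw [maxCoeff_Om_mul_add h (hρ.trans hρ')]
  exact max_lt h1.1 (hρ.trans h1.2)

theorem theta_add_le_theta_add {α ρ ρ' : Ordinal.{0}} (h : α < epsOm) (hρ : ρ ≤ ρ')
    (hρ' : ρ' < Om) : theta (Om * α + ρ) ≤ theta (Om * α + ρ') := by
  rcases hρ.eq_or_lt with rfl | hlt
  · exact le_rfl
  · exact (theta_add_lt_theta_add h hlt hρ').le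

/-! ## Computing cofinalities and fundamental sequences -/

theorem ordinal_add_one_ne_zero (a : Ordinal.{0}) : a + 1 ≠ 0 := by simp

theorem cofin_add_one (ζ : Ordinal.{0}) : cofin (ζ + 1) = 1 := by
  rw [cofin, dif_neg (by simp), if_pos ⟨ζ, rfl⟩]

theorem not_exists_of_isSuccLimit {ξ : Ordinal.{0}} (h : IsSuccLimit ξ) : ¬∃ ζ, ξ = ζ + 1 := by
  rintro ⟨ζ, rfl⟩
  exact not_isSuccLimit_succ ζ h

theorem isSuccLimit_of_not_exists {ξ : Ordinal.{0}} (h0 : ξ ≠ 0) (h : ¬∃ ζ, ξ = ζ + 1) :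
    IsSuccLimit ξ := by
  rcases zero_or_succ_or_isSuccLimit ξ with h1 | ⟨ζ, h1⟩ | h1
  · exact absurd h1 h0
  · exact absurd ⟨ζ, h1.symm⟩ h
  · exact h1

theorem add_eq_add_one {a b : Ordinal.{0}} (hb : b ≠ 0) :
    (∃ ζ, a + b = ζ + 1) ↔ ∃ ζ, b = ζ + 1 := by
  constructor
  · intro h
    by_contra hn
    exact not_exists_of_isSuccLimit (isSuccLimit_add a (isSuccLimit_of_not_exists hb hn)) h
  · rintro ⟨ζ, rfl⟩
    exact ⟨a + ζ, by rw [add_assoc]⟩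

theorem cofin_nf {α β γ : Ordinal.{0}} (h0 : β ≠ 0) (hβ : β < Om) (hγ : γ < Om ^ α)
    (hγ0 : γ ≠ 0) : cofin (Om ^ α * β + γ) = cofin γ := by
  by_cases hs : ∃ ζ, γ = ζ + 1
  · obtain ⟨ζ, rfl⟩ := hs
    rw [← add_assoc, cofin_add_one, cofin_add_one]
  · rw [cofin, dif_neg (nf_ne_zero h0), if_neg (by rwa [add_eq_add_one hγ0]),
      nfRem_nf h0 hβ hγ, if_pos hγ0]

theorem nf_mul {α β : Ordinal.{0}} (h0 : β ≠ 0) (hβ : β < Om) :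
    Om ^ α * β ≠ 0 ∧ nfExp (Om ^ α * β) = α ∧ nfCoeff (Om ^ α * β) = β ∧
      nfRem (Om ^ α * β) = 0 := by
  have h := opow_pos α Om_pos
  have h1 := nfExp_nf h0 hβ h
  have h2 := nfCoeff_nf h0 hβ h
  have h3 := nfRem_nf h0 hβ h
  have h4 := nf_ne_zero (α := α) (γ := 0) h0
  rw [add_zero] at h1 h2 h3 h4
  exact ⟨h4, h1, h2, h3⟩

theorem cofin_mul_limit {α β : Ordinal.{0}} (hβ : β < Om) (hl : IsSuccLimit β) :
    cofin (Om ^ α * β) = β := by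
  obtain ⟨h0, h1, h2, h3⟩ := nf_mul (α := α) hl.ne_bot hβ
  have hs : ¬∃ ζ, Om ^ α * β = ζ + 1 :=
    not_exists_of_isSuccLimit (isSuccLimit_mul_right (opow_pos α Om_pos) hl)
  rw [cofin, dif_neg h0, if_neg hs, h3, if_neg (by simp), h2, if_pos hl]

theorem isSuccLimit_Om_opow {α : Ordinal.{0}} (hα : α ≠ 0) : IsSuccLimit (Om ^ α) :=
  isSuccLimit_opow_left isSuccLimit_Om hα

theorem not_exists_mul_add_one {α β : Ordinal.{0}} (hα : α ≠ 0) :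
    ¬∃ ζ, Om ^ α * (β + 1) = ζ + 1 := by
  rw [mul_add, mul_one, add_eq_add_one (opow_ne_zero _ Om_pos.ne')]
  exact not_exists_of_isSuccLimit (isSuccLimit_Om_opow hα)

theorem not_isSuccLimit_add_one (β : Ordinal.{0}) : ¬IsSuccLimit (β + 1) := not_isSuccLimit_succ β

theorem cofin_mul_add_one_limit {α β : Ordinal.{0}} (hα : α < epsOm) (hβ : β + 1 < Om)
    (hl : IsSuccLimit α) : cofin (Om ^ α * (β + 1)) = cofin α := by
  obtain ⟨h0, h1, h2, h3⟩ := nf_mul (α := α) (ordinal_add_one_ne_zero β) hβ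
  have hlt : α < Om ^ α * (β + 1) :=
    (lt_Om_opow_self hα).trans_le (Ordinal.le_mul_left _ (by simp))
  rw [cofin, dif_neg h0, if_neg (not_exists_mul_add_one hl.ne_bot), h3, if_neg (by simp), h2,
    if_neg (not_isSuccLimit_add_one β), h1, if_pos hl, dif_pos hlt]

theorem cofin_mul_add_one_succ {δ β : Ordinal.{0}} (hβ : β + 1 < Om) :
    cofin (Om ^ (δ + 1) * (β + 1)) = Om := by
  obtain ⟨h0, h1, h2, h3⟩ := nf_mul (α := δ + 1) (ordinal_add_one_ne_zero β) hβ
  rw [cofin, dif_neg h0, if_neg (not_exists_mul_add_one (by simp)), h3, if_neg (by simp), h2,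
    if_neg (not_isSuccLimit_add_one β), h1, if_neg (not_isSuccLimit_add_one δ)]

@[simp] theorem fsOm_zero (x : Ordinal.{0}) : fsOm 0 x = 0 := by rw [fsOm]; simp

@[simp] theorem fsOm_one (x : Ordinal.{0}) : fsOm 1 x = 0 := by rw [fsOm]; simp

theorem fsOm_nf {α β γ x : Ordinal.{0}} (h0 : β ≠ 0) (hβ : β < Om) (hγ : γ < Om ^ α)
    (hγ0 : γ ≠ 0) : fsOm (Om ^ α * β + γ) x = Om ^ α * β + fsOm γ x := by
  have h1 : Om ^ α * β + γ ≠ 1 := by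
    intro h
    have h2 := nfRem_nf h0 hβ hγ
    have h3 : nfRem 1 = 0 := by simp [nfRem, nfExp]
    rw [h, h3] at h2
    exact hγ0 h2.symm
  rw [fsOm, dif_neg (nf_ne_zero h0), if_neg h1, nfRem_nf h0 hβ hγ, if_pos hγ0,
    nfExp_nf h0 hβ hγ, nfCoeff_nf h0 hβ hγ]

theorem ne_one_of_nfCoeff {α β : Ordinal.{0}} (hβ : β < Om) (h0 : β ≠ 0)
    (h : α ≠ 0 ∨ β ≠ 1) : Om ^ α * β ≠ 1 := by
  obtain ⟨-, h1, h2, -⟩ := nf_mul (α := α) h0 hβ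
  intro he
  rw [he] at h1 h2
  have h3 : nfExp 1 = 0 := by simp [nfExp]
  have h4 : nfCoeff 1 = 1 := by simp [nfCoeff, h3]
  rcases h with h | h
  · exact h (h1.symm.trans h3)
  · exact h (h2.symm.trans h4)

theorem fsOm_mul_limit {α β x : Ordinal.{0}} (hβ : β < Om) (hl : IsSuccLimit β) :
    fsOm (Om ^ α * β) x = Om ^ α * x := by
  obtain ⟨h0, h1, h2, h3⟩ := nf_mul (α := α) hl.ne_bot hβ
  have h4 : β ≠ 1 := by
    rintro rfl
    exact not_isSuccLimit_add_one 0 (by simpa using hl)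
  rw [fsOm, dif_neg h0, if_neg (ne_one_of_nfCoeff hβ hl.ne_bot (Or.inr h4)), h3,
    if_neg (by simp), h2, if_pos hl, h1]

theorem fsOm_mul_add_one {α β x : Ordinal.{0}} (hβ : β + 1 < Om) :
    fsOm (Om ^ α * (β + 1)) x = Om ^ α * β + fsOm (Om ^ α) x := by
  by_cases hβ0 : β = 0
  · simp [hβ0]
  · obtain ⟨h0, h1, h2, h3⟩ := nf_mul (α := α) (ordinal_add_one_ne_zero β) hβ
    have h4 : β + 1 ≠ 1 := by
      intro h
      exact hβ0 (succ_injective (h.trans (zero_add 1).symm : succ β = succ 0))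
    have hlt : Om ^ α < Om ^ α * (β + 1) := by
      conv_lhs => rw [← mul_one (Om ^ α)]
      have h5 : 1 < β + 1 :=
        (Order.one_le_iff_pos.2 (pos_iff_ne_zero.2 hβ0)).trans_lt (lt_add_one β)
      exact mul_lt_mul_of_pos_left h5 (opow_pos α Om_pos)
    rw [fsOm, dif_neg h0, if_neg (ne_one_of_nfCoeff hβ (by simp) (Or.inr h4)), h3,
      if_neg (by simp), h2, if_neg (not_isSuccLimit_add_one β), h1, dif_pos hlt]
    congr 2
    exact pred_add_one β

theorem fsOm_opow_limit {α x : Ordinal.{0}} (hα : α < epsOm) (hl : IsSuccLimit α) :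
    fsOm (Om ^ α) x = Om ^ fsOm α x := by
  obtain ⟨h0, h1, h2, h3⟩ := nf_mul (α := α) one_ne_zero one_lt_Om
  have h5 := ne_one_of_nfCoeff one_lt_Om one_ne_zero (Or.inl hl.ne_bot)
  rw [mul_one] at h0 h1 h2 h3 h5
  have h4 : ¬IsSuccLimit (1 : Ordinal.{0}) := by simpa using not_isSuccLimit_add_one 0
  rw [fsOm, dif_neg h0, if_neg h5, h3, if_neg (by simp), h2, if_neg h4, h1,
    dif_neg (lt_irrefl _), if_pos hl, dif_pos (lt_Om_opow_self hα)]

theorem fsOm_opow_add_one {δ x : Ordinal.{0}} : fsOm (Om ^ (δ + 1)) x = Om ^ δ * x := by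
  obtain ⟨h0, h1, h2, h3⟩ := nf_mul (α := δ + 1) one_ne_zero one_lt_Om
  have h5 := ne_one_of_nfCoeff one_lt_Om one_ne_zero (Or.inl (ordinal_add_one_ne_zero δ))
  rw [mul_one] at h0 h1 h2 h3 h5
  have h4 : ¬IsSuccLimit (1 : Ordinal.{0}) := by simpa using not_isSuccLimit_add_one 0
  rw [fsOm, dif_neg h0, if_neg h5, h3, if_neg (by simp), h2, if_neg h4, h1,
    dif_neg (lt_irrefl _), if_neg (not_isSuccLimit_add_one δ), pred_add_one]

theorem fsOm_add_one {δ : Ordinal.{0}} (h : δ < epsOm) (x : Ordinal.{0}) :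
    fsOm (δ + 1) x = δ := by
  refine nfInduction (P := fun δ => fsOm (δ + 1) x = δ) (by simp) ?_ δ h
  intro α β γ hα h0 hβ hγ _ _ iγ
  by_cases hα0 : α = 0
  · subst hα0
    have h1 : γ = 0 := by simpa using hγ
    subst h1
    have := fsOm_mul_add_one (α := 0) (x := x) (isSuccLimit_Om.add_one_lt hβ)
    simpa using this
  · rw [add_assoc, fsOm_nf h0 hβ ((isSuccLimit_Om_opow hα0).add_one_lt hγ) (by simp), iγ]

theorem cofin_of_isSuccLimit {ρ : Ordinal.{0}} (h : ρ < Om) (hl : IsSuccLimit ρ) :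
    cofin ρ = ρ := by simpa using cofin_mul_limit (α := 0) h hl

theorem fsOm_of_isSuccLimit {ρ x : Ordinal.{0}} (h : ρ < Om) (hl : IsSuccLimit ρ) :
    fsOm ρ x = x := by simpa using fsOm_mul_limit (α := 0) (x := x) h hl

theorem cofin_Om_mul_add {α ρ : Ordinal.{0}} (h : α < epsOm) (hρ : ρ < Om) (h0 : ρ ≠ 0) :
    cofin (Om * α + ρ) = cofin ρ := by
  refine nfInduction (P := fun α => cofin (Om * α + ρ) = cofin ρ) (by simp) ?_ α h
  intro e β γ he hβ0 hβ hγ _ _ iγ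
  rw [Om_mul_nf, cofin_nf hβ0 hβ (Om_mul_add_lt hγ hρ) (by
    rw [← pos_iff_ne_zero]; exact (pos_iff_ne_zero.2 h0).trans_le le_add_self), iγ]

theorem fsOm_Om_mul_add {α ρ x : Ordinal.{0}} (h : α < epsOm) (hρ : ρ < Om) (h0 : ρ ≠ 0) :
    fsOm (Om * α + ρ) x = Om * α + fsOm ρ x := by
  refine nfInduction (P := fun α => fsOm (Om * α + ρ) x = Om * α + fsOm ρ x) (by simp) ?_ α h
  intro e β γ he hβ0 hβ hγ _ _ iγ
  have h2 := Om_mul_nf e β γ 0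
  rw [add_zero, add_zero] at h2
  rw [Om_mul_nf, fsOm_nf hβ0 hβ (Om_mul_add_lt hγ hρ) (by
    rw [← pos_iff_ne_zero]; exact (pos_iff_ne_zero.2 h0).trans_le le_add_self), iγ, h2, add_assoc]

/-! ## Closure properties of bounds on coefficients -/

theorem coeffBelow_opow_mul {p α β : Ordinal.{0}} (hp : 0 < p) (hα : CoeffBelow p α)
    (hβ : β < Om) (h : β < p) : CoeffBelow p (Om ^ α * β) := by
  by_cases h0 : β = 0
  · rw [h0, mul_zero]; exact coeffBelow_zero hp
  · have := (coeffBelow_nf (p := p) hα.1 h0 hβ (opow_pos α Om_pos) epsOm_pos).2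
      ⟨h, hα, coeffBelow_zero hp⟩
    rwa [add_zero] at this

/-- The leading term of `a` is kept, absorbed, or merged with a term of equal exponent. Only merging
creates a new coefficient, a sum of two coefficients below p, and p is additively principal. -/
theorem CoeffBelow.add {p a b : Ordinal.{0}} (hp : IsPrincipal (· + ·) p)
    (ha : CoeffBelow p a) (hb : CoeffBelow p b) : CoeffBelow p (a + b) := by
  refine nfInduction (P := fun a => CoeffBelow p a → CoeffBelow p (a + b))
    (fun _ => by rwa [zero_add]) ?_ a ha.1 ha
  intro α β γ hα h0 hβ hγ hγ' _ iγ h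
  rw [coeffBelow_nf hα h0 hβ hγ hγ'] at h
  obtain ⟨h1, h2, h3⟩ := h
  have h4 := iγ h3
  rw [add_assoc]
  obtain ⟨c, hc⟩ : ∃ c, c = γ + b := ⟨_, rfl⟩
  rw [← hc] at h4 ⊢
  rcases lt_or_ge c (Om ^ α) with hlt | hge
  · exact (coeffBelow_nf hα h0 hβ hlt h4.1).2 ⟨h1, h2, h4⟩
  · have hc0 : c ≠ 0 := ((opow_pos α Om_pos).trans_le hge).ne'
    have hle : α ≤ nfExp c := le_log_of_opow_le one_lt_Om hge
    rcases hle.eq_or_lt with he | hlt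
    · have hn := nf_eq c
      rw [← he] at hn
      have hr := nfRem_lt_opow c
      rw [← he] at hr
      have h5 := (nfRem_lt hc0).trans h4.1
      rw [← hn, coeffBelow_nf hα (nfCoeff_ne_zero hc0) (nfCoeff_lt c) hr h5] at h4
      rw [← hn, ← add_assoc, ← mul_add]
      refine (coeffBelow_nf hα ?_ (add_lt_Om hβ (nfCoeff_lt c)) hr h5).2
        ⟨hp h1 h4.1, h2, h4.2.2⟩
      exact ((pos_iff_ne_zero.2 h0).trans_le le_self_add).ne'
    · have h5 : Om ^ α * β + c = c := by
        have h6 : Om ^ α * β < ω ^ (Om * nfExp c) := by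
          rw [← Om_opow]; exact opow_mul_lt_opow hβ hlt
        refine add_of_omega0_opow_le h6 ?_
        rw [← Om_opow]
        exact opow_log_le_self Om hc0
      rw [h5]; exact h4

theorem CoeffBelow.fsOm {p ξ x : Ordinal.{0}} (hp : IsPrincipal (· + ·) p)
    (hξ : CoeffBelow p ξ) (hx : x < Om) (hxp : x < p) : CoeffBelow p (fsOm ξ x) := by
  have hp0 : 0 < p := (zero_le (a := x)).trans_lt hxp
  refine nfInduction (P := fun ξ => CoeffBelow p ξ → CoeffBelow p (Ouroboros.fsOm ξ x))
    (fun h => by simpa using h) ?_ ξ hξ.1 hξ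
  intro α β γ hα h0 hβ hγ hγ' iα iγ h
  rw [coeffBelow_nf hα h0 hβ hγ hγ'] at h
  obtain ⟨h1, h2, h3⟩ := h
  by_cases hγ0 : γ = 0
  · rw [hγ0, add_zero]
    rcases zero_or_succ_or_isSuccLimit β with hz | ⟨δ, hδ⟩ | hl
    · exact absurd hz h0
    · have hδ : δ + 1 = β := hδ
      subst hδ
      rw [fsOm_mul_add_one hβ]
      have hδβ : δ < δ + 1 := lt_add_one δ
      refine (coeffBelow_opow_mul hp0 h2 (hδβ.trans hβ) (hδβ.trans h1)).add hp ?_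
      rcases zero_or_succ_or_isSuccLimit α with hz | ⟨ε, hε⟩ | hl
      · rw [hz, opow_zero, fsOm_one]; exact coeffBelow_zero hp0
      · have hε : ε + 1 = α := hε
        subst hε
        -- The exponent is ε + 1 and (ε + 1)[x] = ε, so the induction hypothesis for the exponent
        -- also bounds the coefficients of its predecessor ε.
        have := iα h2
        rw [fsOm_add_one ((lt_add_one ε).trans hα)] at this
        rw [fsOm_opow_add_one]
        exact coeffBelow_opow_mul hp0 this hx hxp
      · rw [fsOm_opow_limit hα hl, ← mul_one (Om ^ _)]
        exact coeffBelow_opow_mul hp0 (iα h2) one_lt_Om ((le_add_self).trans_lt h1)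
    · rw [fsOm_mul_limit hβ hl]
      exact coeffBelow_opow_mul hp0 h2 hx hxp
  · rw [fsOm_nf h0 hβ hγ hγ0]
    exact (coeffBelow_opow_mul hp0 h2 hβ h1).add hp (iγ h3)

end

end Ouroboros

namespace Ouroboros

noncomputable section

/-! ## Buchholz's fundamental sequences -/

theorem not_isFix_zero : ¬IsFix 0 := by
  rintro ⟨-, h, -⟩
  simp at h

theorem fsTheta_one (n : ℕ) : fsTheta 1 n = 0 := by
  have h : thetaInv 1 = 0 := by rw [← theta_zero, thetaInv_theta epsOm_pos]
  have h2 : thetaStar 0 = 0 := by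
    rw [thetaStar, if_neg, if_neg not_isFix_zero]
    rintro ⟨ζ, hζ⟩
    exact ordinal_add_one_ne_zero ζ hζ.symm
  rw [fsTheta, dif_neg one_ne_zero, if_neg (by simp), h,
    if_pos ⟨Om_pos, Or.inr (Or.inr rfl)⟩, h2, zero_mul]

/-- The terms of ξ are at least ω^θ and those of η at most ω^θ, so nothing is absorbed in ξ + η, and
the leading terms of ξ are peeled off one by one. -/
theorem fsTheta_add {θ ξ η : Ordinal.{0}} (hd : ω ^ θ ∣ ξ) (h0 : η ≠ 0) (hη : η < ω ^ (θ + 1))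
    (n : ℕ) : fsTheta (ξ + η) n = ξ + fsTheta η n := by
  induction ξ using WellFoundedLT.induction with
  | ind ξ ih =>
    by_cases hξ : ξ = 0
    · rw [hξ, zero_add, zero_add]
    obtain ⟨l, hl⟩ : ∃ l, l = log ω ξ := ⟨_, rfl⟩
    have hle : ω ^ l ≤ ξ := hl ▸ opow_log_le_self ω hξ
    obtain ⟨ξ', hξ'⟩ : ∃ ξ', ξ = ω ^ l + ξ' := ⟨ξ - ω ^ l, (Ordinal.add_sub_cancel_of_le hle).symm⟩
    have hlt : ξ' < ξ := by
      have := sub_omega0_opow_log_lt hξ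
      rwa [← hl, hξ', Ordinal.add_sub_cancel, ← hξ'] at this
    have hθ : θ ≤ l := by
      rw [hl]
      exact le_log_of_opow_le one_lt_omega0 (le_of_dvd hξ hd)
    have hd' : ω ^ θ ∣ ξ' := by
      rw [hξ'] at hd
      exact (Ordinal.dvd_add_iff (opow_dvd_opow ω hθ)).1 hd
    have hlog : log ω (ξ + η) = l := by
      rw [log_eq_iff one_lt_omega0 (by
        rw [← pos_iff_ne_zero]; exact (pos_iff_ne_zero.2 hξ).trans_le le_self_add)]
      refine ⟨hle.trans le_self_add, isPrincipal_add_omega0_opow _ ?_ (hη.trans_le ?_)⟩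
      · rw [hl]; exact lt_opow_succ_log_self one_lt_omega0 ξ
      · exact opow_le_opow_right omega0_pos (by gcongr)
    have hsum : ξ + η = ω ^ l + (ξ' + η) := by rw [hξ', add_assoc]
    have hpos : 0 < ξ' + η := (pos_iff_ne_zero.2 h0).trans_le le_add_self
    rw [fsTheta, dif_neg (by rw [hsum]; exact (hpos.trans_le le_add_self).ne'), hlog, if_pos (by
      rw [hsum]
      exact lt_add_of_pos_right _ hpos), hsum, Ordinal.add_sub_cancel, ih ξ' hlt hd', ← add_assoc,
      ← hξ']

theorem fsTheta_add_one (ξ : Ordinal.{0}) (n : ℕ) : fsTheta (ξ + 1) n = ξ := by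
  rw [fsTheta_add (θ := 0) (by simp) one_ne_zero (by simp), fsTheta_one, add_zero]

theorem fsTheta_theta {ζ : Ordinal.{0}} (h : ζ < epsOm) (n : ℕ) :
    fsTheta (theta ζ) n =
      if ζ < Om ∧ IsJump ζ then thetaStar ζ * n
      else if cofin (checkOrd ζ) = Om then
        Nat.rec (thetaStar ζ) (fun _ x => theta (fsOm (checkOrd ζ) x)) n
      else if cofin (checkOrd ζ) < theta ζ then
        theta (fsOm (checkOrd ζ) (fsTheta (cofin (checkOrd ζ)) n) + thetaStar ζ)
      else 0 := by
  obtain ⟨θ, hθ⟩ := exists_theta_eq h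
  have h1 : ¬ω ^ log ω (theta ζ) < theta ζ := by
    rw [hθ, log_opow one_lt_omega0]
    exact lt_irrefl _
  rw [fsTheta, dif_neg (theta_pos h).ne', if_neg h1, thetaInv_theta h]
  rfl

theorem one_lt_of_isSuccLimit {ξ : Ordinal.{0}} (hl : IsSuccLimit ξ) : 1 < ξ := by
  have := hl.add_one_lt hl.bot_lt
  rwa [Ordinal.bot_eq_zero, zero_add] at this

theorem thetaStar_add_one (ζ : Ordinal.{0}) : thetaStar (ζ + 1) = theta ζ := by
  rw [thetaStar, if_pos ⟨ζ, rfl⟩, pred_add_one]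

theorem thetaStar_limit {ζ : Ordinal.{0}} (h : IsSuccLimit ζ) :
    thetaStar ζ = if IsFix ζ then cofin ζ else 0 := by
  rw [thetaStar, if_neg (not_exists_of_isSuccLimit h)]

theorem isSuccLimit_theta {ζ : Ordinal.{0}} (h : ζ < epsOm) (h0 : ζ ≠ 0) :
    IsSuccLimit (theta ζ) := by
  refine isSuccLimit_of_isPrincipal_add ?_ (isPrincipal_theta h)
  rw [← theta_zero]
  exact theta_lt_theta h (pos_iff_ne_zero.2 h0) (by simpa using theta_pos h)

theorem opow_add_one_le_of_lt {θ θ' : Ordinal.{0}} (h : ω ^ θ < ω ^ θ') :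
    ω ^ (θ + 1) ≤ ω ^ θ' :=
  opow_le_opow_right omega0_pos (Order.add_one_le_of_lt
    ((opow_lt_opow_iff_right one_lt_omega0).1 h))

/-- The values `ω ^ (θ + 1)` are collapses of elements of `Jump`. -/
theorem exists_jump_theta_eq {θ : Ordinal.{0}} (h : BelowBH (ω ^ θ)) :
    ∃ ζ < Om, theta ζ = ω ^ (θ + 1) ∧ IsJump ζ ∧ thetaStar ζ = ω ^ θ := by
  obtain ⟨γ, hγ, he⟩ := exists_theta_eq_opow h
  have hlt : ω ^ θ < ω ^ (θ + 1) := (opow_lt_opow_iff_right one_lt_omega0).2 (lt_add_one θ)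
  -- With ω^θ = ϑ(γ): if γ is countable, the wanted argument is the successor γ + 1; if γ ≥ Ω, then
  -- ω^θ = ϑ(γ) with γ > ω^θ, and ω^θ itself is the argument, as a member of `Fix`.
  rcases lt_or_ge γ Om with hγΩ | hγΩ
  · have h1 : γ + 1 < Om := isSuccLimit_Om.add_one_lt hγΩ
    refine ⟨γ + 1, h1, le_antisymm (theta_le ⟨⟨_, rfl⟩, ?_, fun δ hδ _ => ?_⟩) ?_,
      Or.inr (Or.inl ⟨γ, rfl⟩), by rw [thetaStar_add_one, he]⟩
    · rw [maxCoeff_of_lt_Om h1]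
      have := maxCoeff_lt_theta hγ
      rw [maxCoeff_of_lt_Om hγΩ, he] at this
      exact (Order.add_one_le_of_lt this).trans_lt hlt
    · refine lt_of_le_of_lt ?_ hlt
      rw [← he]
      rcases (Order.lt_add_one_iff.1 hδ).eq_or_lt with rfl | h2
      · exact le_rfl
      · exact (theta_lt_theta_of_lt_Om h2 hγΩ).le
    · have h2 := theta_lt_theta_of_lt_Om (lt_add_one γ) h1
      obtain ⟨θ', hθ'⟩ := exists_theta_eq (lt_epsOm_of_lt_Om h1)
      rw [he, hθ'] at h2
      rw [hθ']
      exact opow_add_one_le_of_lt h2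
  · have hp : ω ^ θ < Om := h.lt_Om
    have hp' := lt_epsOm_of_lt_Om hp
    have hl : IsSuccLimit (ω ^ θ) := by
      rw [← he]
      exact isSuccLimit_theta hγ (Om_pos.trans_le hγΩ).ne'
    have hfix : IsFix (ω ^ θ) := by
      refine ⟨hp', ?_, ?_, γ, hp.trans_le hγΩ, hγ, ?_⟩
      · rw [fsOm_of_isSuccLimit hp hl, maxCoeff_of_lt_Om one_lt_Om, maxCoeff_of_lt_Om hp]
        exact (one_lt_of_isSuccLimit hl)
      · rw [maxCoeff_of_lt_Om hp, cofin_of_isSuccLimit hp hl]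
      · rw [cofin_of_isSuccLimit hp hl, he]
    refine ⟨ω ^ θ, hp, le_antisymm (theta_le ⟨⟨_, rfl⟩, ?_, fun δ hδ _ => ?_⟩) ?_,
      Or.inl hfix, ?_⟩
    · rwa [maxCoeff_of_lt_Om hp]
    · refine lt_trans ?_ hlt
      rw [← he]
      refine theta_lt_theta hγ ((hδ.trans hp).trans_le hγΩ) ?_
      rwa [maxCoeff_of_lt_Om (hδ.trans hp), he]
    · have h2 := maxCoeff_lt_theta hp'
      obtain ⟨θ', hθ'⟩ := exists_theta_eq hp'
      rw [hθ', maxCoeff_of_lt_Om hp] at h2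
      rw [hθ']
      exact opow_add_one_le_of_lt h2
    · rw [thetaStar_limit hl, if_pos hfix, cofin_of_isSuccLimit hp hl]

theorem fsTheta_opow_add_one {θ : Ordinal.{0}} (h : BelowBH (ω ^ θ)) (n : ℕ) :
    fsTheta (ω ^ (θ + 1)) n = ω ^ θ * n := by
  obtain ⟨ζ, hζ, he, hj, hs⟩ := exists_jump_theta_eq h
  rw [← he, fsTheta_theta (lt_epsOm_of_lt_Om hζ), if_pos ⟨hζ, hj⟩, hs]

/-- A countable limit θ in `Fix` is ϑ(γ) with γ > θ, hence an epsilon number: ω^δ ≤ ϑ(δ) < ϑ(γ) = θ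
for all δ < θ. -/
theorem not_isFix_of_lt_opow {θ : Ordinal.{0}} (h : θ < Om) (hl : IsSuccLimit θ)
    (hlt : θ < ω ^ θ) : ¬IsFix θ := by
  rintro ⟨-, -, -, γ, hγ, hγ', he⟩
  rw [cofin_of_isSuccLimit h hl] at he
  refine absurd ?_ (not_le.2 hlt)
  rw [opow_le_of_isSuccLimit omega0_ne_zero hl]
  intro δ hδ
  refine (opow_le_theta (hδ.trans h)).trans ?_
  rw [he]
  refine (theta_lt_theta hγ' (hδ.trans hγ) ?_).le
  rwa [maxCoeff_of_lt_Om (hδ.trans h), ← he]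

theorem fsTheta_opow_of_lt_opow {θ : Ordinal.{0}} (h : θ < Om) (hl : IsSuccLimit θ)
    (hlt : θ < ω ^ θ) (n : ℕ) : fsTheta (ω ^ θ) n = theta (fsTheta θ n) := by
  have hfix := not_isFix_of_lt_opow h hl hlt
  have hs : thetaStar θ = 0 := by rw [thetaStar_limit hl, if_neg hfix]
  have hc : checkOrd θ = θ := by rw [checkOrd, hs, if_neg (lt_irrefl _)]
  have ht := theta_of_lt_opow hl h hlt
  rw [← ht, fsTheta_theta (lt_epsOm_of_lt_Om h), if_neg, hc, cofin_of_isSuccLimit h hl,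
    if_neg h.ne, if_pos (ht ▸ hlt), hs, add_zero, fsOm_of_isSuccLimit h hl]
  rintro ⟨-, h1 | h1 | h1⟩
  · exact hfix h1
  · exact not_exists_of_isSuccLimit hl h1
  · exact hl.ne_bot h1

/-- If θ is not an epsilon number, the left side is ϑ(θ[n]), at most ω^{θ[n]+1}. If it is one, then
ω^θ = θ and the bound is trivial. -/
theorem fsTheta_opow_limit_le {θ : Ordinal.{0}} (h : θ < Om) (hl : IsSuccLimit θ) {n : ℕ}
    (hlt : fsTheta θ n < Om) : fsTheta (ω ^ θ) n ≤ ω ^ (fsTheta θ n + 1) := by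
  rcases (right_le_opow θ one_lt_omega0).eq_or_lt with he | hlt'
  · rw [← he]
    exact le_self_add.trans (right_le_opow _ one_lt_omega0)
  · rw [fsTheta_opow_of_lt_opow h hl hlt']
    exact theta_le_opow hlt

/-- Terms of β below ω^θ vanish in the sum, so equality with β may fail; replacing β by its part
divisible by ω^θ reduces to `fsTheta_add`. -/
theorem fsTheta_add_opow_le (β θ : Ordinal.{0}) (n : ℕ) :
    fsTheta (β + ω ^ θ) n ≤ β + fsTheta (ω ^ θ) n := by
  have h1 : β = ω ^ θ * (β / ω ^ θ) + β % ω ^ θ := (div_add_mod _ _).symm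
  have h2 : β + ω ^ θ = ω ^ θ * (β / ω ^ θ) + ω ^ θ := by
    conv_lhs => rw [h1]
    rw [add_assoc, add_omega0_opow (mod_lt _ (opow_ne_zero _ omega0_ne_zero))]
  rw [h2, fsTheta_add (θ := θ) (dvd_mul_right _ _) (opow_ne_zero _ omega0_ne_zero)
    ((opow_lt_opow_iff_right one_lt_omega0).2 (lt_add_one θ))]
  gcongr
  exact mul_div_le _ _

/-! ## The least `β` with `p < ϑ(α + β)` -/

/-- The least `β` with `p < ϑ(α + β)`. -/
def minBeta (α p : Ordinal.{0}) : Ordinal.{0} := sInf {β | p < theta (α + β)}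

theorem lt_theta_add_self {α p : Ordinal.{0}} (h : α < epsOm) (hp : p < Om) :
    p < theta (Om * α + p) := by
  have := maxCoeff_lt_theta (Om_mul_add_lt_epsOm h hp)
  rw [maxCoeff_Om_mul_add h hp] at this
  exact (le_max_right _ _).trans_lt this

theorem minBeta_le {α p β : Ordinal.{0}} (h : p < theta (α + β)) : minBeta α p ≤ β :=
  csInf_le' (s := {β | p < theta (α + β)}) h

theorem minBeta_le_self {α p : Ordinal.{0}} (h : α < epsOm) (hp : p < Om) :
    minBeta (Om * α) p ≤ p := minBeta_le (lt_theta_add_self h hp)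

theorem lt_theta_minBeta {α p : Ordinal.{0}} (h : α < epsOm) (hp : p < Om) :
    p < theta (Om * α + minBeta (Om * α) p) :=
  csInf_mem (s := {β | p < theta (Om * α + β)}) ⟨p, lt_theta_add_self h hp⟩

theorem theta_le_of_lt_minBeta {α p β : Ordinal.{0}} (h : β < minBeta α p) :
    theta (α + β) ≤ p := by
  by_contra! h1
  exact absurd (minBeta_le h1) (not_le.2 h)

theorem lt_minBeta_of_theta_le {α p β : Ordinal.{0}} (h : α < epsOm) (hp : p < Om) (hβ : β < Om)
    (hle : theta (Om * α + β) ≤ p) : β < minBeta (Om * α) p := by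
  by_contra! h1
  exact absurd ((lt_theta_minBeta h hp).trans_le (theta_add_le_theta_add h h1 hβ)) (not_lt.2 hle)

theorem minBeta_mono {α p p' : Ordinal.{0}} (h : α < epsOm) (hp : p ≤ p') (hp' : p' < Om) :
    minBeta (Om * α) p ≤ minBeta (Om * α) p' :=
  minBeta_le (hp.trans_lt (lt_theta_minBeta h hp'))

/-- Let q be the supremum of ϑ(Ω·α + δ) over δ < β. By minimality of β, q ≤ p < ϑ(Ω·α + β). As β is
a limit, q is an ω-power closed under ϑ below Ω·α + β. If β < q, then q would be a candidate for
ϑ(Ω·α + β), which is impossible; so β = q. Below the Bachmann-Howard ordinal q = ϑ(γ) for some γ.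
Closure excludes γ < Ω·α + β and the value excludes equality, so γ is larger. -/
theorem isFix_of_isSuccLimit_minBeta {α p : Ordinal.{0}} (h : α < epsOm) (hp : BelowBH p)
    (hl : IsSuccLimit (minBeta (Om * α) p)) : IsFix (Om * α + minBeta (Om * α) p) := by
  obtain ⟨β, hβ⟩ : ∃ β, β = minBeta (Om * α) p := ⟨_, rfl⟩
  have hmin : ∀ δ < β, theta (Om * α + δ) ≤ p := fun δ hδ =>
    theta_le_of_lt_minBeta (hβ ▸ hδ)
  have hβp : β ≤ p := hβ ▸ minBeta_le_self h hp.lt_Om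
  have hβΩ : β < Om := hβp.trans_lt hp.lt_Om
  have hlt : p < theta (Om * α + β) := hβ ▸ lt_theta_minBeta h hp.lt_Om
  rw [← hβ] at hl ⊢
  have hε := Om_mul_add_lt_epsOm h hβΩ
  have hαβ : maxCoeff (Om * α) < theta (Om * α + 0) := by
    have := maxCoeff_lt_theta (Om_mul_lt_epsOm h)
    rwa [add_zero]
  -- `q` is the supremum of the values at smaller arguments
  obtain ⟨q, hq⟩ : ∃ q, q = ⨆ δ : Set.Iio β, theta (Om * α + δ.1) := ⟨_, rfl⟩
  have hqle : ∀ δ < β, theta (Om * α + δ) ≤ q := fun δ hδ => by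
    rw [hq]
    exact Ordinal.le_iSup (fun δ : Set.Iio β => theta (Om * α + δ.1)) ⟨δ, hδ⟩
  have hqlt : ∀ δ < β, theta (Om * α + δ) < q := fun δ hδ =>
    (theta_add_lt_theta_add h (lt_add_one δ) ((hl.add_one_lt hδ).trans hβΩ)).trans_le
      (hqle _ (hl.add_one_lt hδ))
  have hqp : q ≤ p := by
    rw [hq]
    exact Ordinal.iSup_le fun δ => hmin _ δ.2
  have hex : ∀ x < q, ∃ δ < β, x < theta (Om * α + δ) := by
    intro x hx
    rw [hq, Ordinal.lt_iSup_iff] at hx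
    obtain ⟨δ, hδ⟩ := hx
    exact ⟨δ.1, δ.2, hδ⟩
  have hα : maxCoeff (Om * α) < q := hαβ.trans_le (hqle 0 hl.bot_lt)
  have hprin : IsPrincipal (· + ·) q := by
    intro a b ha hb
    obtain ⟨δ, hδ, hδa⟩ := hex a ha
    obtain ⟨δ', hδ', hδb⟩ := hex b hb
    have hm : max δ δ' < β := max_lt hδ hδ'
    refine (add_lt_theta (Om_mul_add_lt_epsOm h (hm.trans hβΩ)) (hδa.trans_le ?_)
      (hδb.trans_le ?_)).trans_le (hqle _ hm)
    · exact theta_add_le_theta_add h (le_max_left _ _) (hm.trans hβΩ)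
    · exact theta_add_le_theta_add h (le_max_right _ _) (hm.trans hβΩ)
  obtain ⟨θ, hθ⟩ : ∃ θ : Ordinal.{0}, ω ^ θ = q := by
    rcases isPrincipal_add_iff_zero_or_omega0_opow.1 hprin with h0 | h0
    · exact absurd (h0 ▸ hα) (not_lt.2 zero_le)
    · exact h0
  have hclosed : ∀ ζ < Om * α + β, maxCoeff ζ < q → theta ζ < q := by
    intro ζ hζ hc
    obtain ⟨δ, hδ, hδc⟩ := hex _ hc
    obtain ⟨δ', hδ', hδζ⟩ := (lt_add_iff_of_isSuccLimit hl).1 hζ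
    have hm : max δ δ' < β := max_lt hδ hδ'
    refine (theta_lt_theta (Om_mul_add_lt_epsOm h (hm.trans hβΩ)) (hδζ.trans_le ?_)
      (hδc.trans_le ?_)).trans_le (hqle _ hm)
    · gcongr; exact le_max_right _ _
    · exact theta_add_le_theta_add h (le_max_left _ _) (hm.trans hβΩ)
  have hβq : β = q := by
    refine le_antisymm (le_of_forall_lt fun δ hδ => ?_) ?_
    · exact (lt_theta_add_self h (hδ.trans hβΩ)).trans (hqlt δ hδ)
    · by_contra! hlt'
      have hc : maxCoeff (Om * α + β) < q := by
        rw [maxCoeff_Om_mul_add h hβΩ]; exact max_lt hα hlt'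
      exact absurd (hlt.trans_le ((theta_le ⟨⟨θ, hθ.symm⟩, hc, hclosed⟩).trans hqp)) (lt_irrefl _)
  obtain ⟨γ, hγ, hγq⟩ := exists_theta_eq_opow (hp.mono (hθ.trans_le hqp))
  rw [hθ] at hγq
  have hγc : maxCoeff γ < q := hγq ▸ maxCoeff_lt_theta hγ
  have hcof : cofin (Om * α + β) = β := by
    rw [cofin_Om_mul_add h hβΩ hl.ne_bot, cofin_of_isSuccLimit hβΩ hl]
  refine ⟨hε, ?_, ?_, γ, ?_, hγ, ?_⟩
  · rw [fsOm_Om_mul_add h hβΩ hl.ne_bot, fsOm_of_isSuccLimit hβΩ hl,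
      maxCoeff_Om_mul_add h one_lt_Om,
      maxCoeff_Om_mul_add h hβΩ]
    exact max_lt ((hβq ▸ hα).trans_le (le_max_right _ _))
      ((one_lt_of_isSuccLimit hl).trans_le (le_max_right _ _))
  · rw [hcof, maxCoeff_Om_mul_add h hβΩ, max_eq_right (hβq ▸ hα).le]
  · rcases lt_trichotomy (Om * α + β) γ with h1 | h1 | h1
    · exact h1
    · exact absurd (hγq ▸ h1 ▸ hlt) (not_lt.2 hqp)
    · exact absurd (hγq ▸ hclosed γ h1 hγc) (lt_irrefl _)
  · rw [hcof, hγq, hβq]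

/-- If β = δ + 1, then ϑ* is ϑ(Ω·α + δ), at most p by minimality of β. On `Fix`, ϑ* is the
cofinality, which equals the maximal coefficient; the coefficients of Ω·α and β ≤ p are all at most
p. -/
theorem thetaStar_minBeta_le {α p : Ordinal.{0}} (h : α < epsOm) (hp : p < Om)
    (hc : maxCoeff (Om * α) ≤ p) : thetaStar (Om * α + minBeta (Om * α) p) ≤ p := by
  have hle := minBeta_le_self h hp
  have hs : ∀ ζ, ζ < epsOm → maxCoeff ζ ≤ p → IsFix ζ → cofin ζ ≤ p := by
    rintro ζ - h2 ⟨-, -, h3, -⟩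
    rwa [← h3]
  have hε := Om_mul_add_lt_epsOm h (hle.trans_lt hp)
  have hm : maxCoeff (Om * α + minBeta (Om * α) p) ≤ p := by
    rw [maxCoeff_Om_mul_add h (hle.trans_lt hp)]
    exact max_le hc hle
  by_cases hsucc : ∃ ζ, Om * α + minBeta (Om * α) p = ζ + 1
  · rcases zero_or_succ_or_isSuccLimit (minBeta (Om * α) p) with h0 | ⟨δ, hδ⟩ | hl
    · rw [h0, add_zero] at hsucc
      by_cases hα : α = 0
      · rw [hα, mul_zero] at hsucc
        obtain ⟨ζ, hζ⟩ := hsucc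
        exact absurd hζ.symm (ordinal_add_one_ne_zero ζ)
      · exact absurd hsucc (not_exists_of_isSuccLimit
          (isSuccLimit_mul_left isSuccLimit_Om (pos_iff_ne_zero.2 hα)))
    · have hδ' : minBeta (Om * α) p = δ + 1 := hδ.symm
      rw [hδ', ← add_assoc, thetaStar_add_one]
      exact theta_le_of_lt_minBeta (hδ' ▸ lt_add_one δ)
    · exact absurd hsucc (not_exists_of_isSuccLimit (isSuccLimit_add _ hl))
  · rw [thetaStar, if_neg hsucc]
    split_ifs with hf
    · exact hs _ hε hm hf
    · exact zero_le

theorem Om_mul_add_div {α ρ : Ordinal.{0}} (hρ : ρ < Om) : (Om * α + ρ) / Om = α := by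
  rw [mul_add_div _ Om_pos.ne', div_eq_zero_of_lt hρ, add_zero]

/-- If β is a successor or, by `isFix_of_isSuccLimit_minBeta`, a limit, then ϑ* > 0 and the
countable part is removed; if β = 0 there is nothing to remove. So the fundamental sequence of ϑ(Ω·α
+ β) depends on β only through ϑ*. -/
theorem checkOrd_minBeta {α p : Ordinal.{0}} (h : α < epsOm) (hp : BelowBH p) :
    checkOrd (Om * α + minBeta (Om * α) p) = Om * α := by
  have hβ := (minBeta_le_self h hp.lt_Om).trans_lt hp.lt_Om
  rw [checkOrd, Om_mul_add_div hβ]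
  split_ifs with hs
  · rfl
  · rcases zero_or_succ_or_isSuccLimit (minBeta (Om * α) p) with h0 | ⟨δ, hδ⟩ | hl
    · rw [h0, add_zero]
    · have hδ' : minBeta (Om * α) p = δ + 1 := hδ.symm
      rw [hδ', ← add_assoc, thetaStar_add_one] at hs
      exact absurd (theta_pos (Om_mul_add_lt_epsOm h ((hδ' ▸ lt_add_one δ).trans hβ))) hs
    · rw [thetaStar_limit (isSuccLimit_add _ hl), if_pos (isFix_of_isSuccLimit_minBeta h hp hl),
        cofin_Om_mul_add h hβ hl.ne_bot, cofin_of_isSuccLimit hβ hl] at hs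
      exact absurd hl.bot_lt hs

end

end Ouroboros

namespace Ouroboros

noncomputable section

/-! ## Evaluations along `b`-decompositions -/

theorem decomp_eq (b m : ℕ) :
    b ^ Nat.log b m * (m / b ^ Nat.log b m) + m % b ^ Nat.log b m = m := Nat.div_add_mod _ _

theorem decomp_props {b m : ℕ} (hb : 2 ≤ b) (hm : m ≠ 0) :
    Nat.log b m < m ∧ 0 < m / b ^ Nat.log b m ∧ m / b ^ Nat.log b m < b ∧
      m % b ^ Nat.log b m < b ^ Nat.log b m ∧ m % b ^ Nat.log b m < m := by
  have h1 : 0 < b ^ Nat.log b m := Nat.pow_pos (by omega)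
  have h2 := Nat.pow_log_le_self b hm
  refine ⟨Nat.log_lt_self b hm, Nat.div_pos h2 h1, ?_, Nat.mod_lt _ h1,
    (Nat.mod_lt _ h1).trans_le h2⟩
  rw [Nat.div_lt_iff_lt_mul h1]
  have := Nat.lt_pow_succ_log_self (b := b) (by omega) m
  rwa [pow_succ, mul_comm] at this

theorem decomp_log {b e a r : ℕ} (h0 : 0 < a) (ha : a < b) (hr : r < b ^ e) :
    Nat.log b (b ^ e * a + r) = e := by
  have hpos := Nat.mul_pos (Nat.pow_pos (n := e) (show 0 < b by omega)) h0
  rw [Nat.log_eq_iff (Or.inr ⟨by omega, by omega⟩)]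
  constructor
  · exact (Nat.le_mul_of_pos_right _ h0).trans (Nat.le_add_right _ _)
  · calc b ^ e * a + r < b ^ e * a + b ^ e := by omega
      _ = b ^ e * (a + 1) := by ring
      _ ≤ b ^ e * b := Nat.mul_le_mul_left _ ha
      _ = b ^ (e + 1) := (pow_succ _ _).symm

theorem decomp_div {b e a r : ℕ} (hr : r < b ^ e) : (b ^ e * a + r) / b ^ e = a := by
  rw [Nat.mul_add_div (by omega), Nat.div_eq_of_lt hr, add_zero]

theorem decomp_mod {b e a r : ℕ} (hr : r < b ^ e) : (b ^ e * a + r) % b ^ e = r := by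
  rw [Nat.mul_add_mod, Nat.mod_eq_of_lt hr]

theorem le_exp_of_dvd {b e a r k : ℕ} (h0 : 0 < a) (ha : a < b) (hr : r < b ^ e)
    (hd : b ^ k ∣ b ^ e * a + r) : k ≤ e := by
  by_contra! hlt
  have h1 : b ^ (e + 1) ≤ b ^ k := Nat.pow_le_pow_right (by omega) hlt
  have h2 := Nat.le_of_dvd (by
    have := Nat.mul_pos (Nat.pow_pos (n := e) (show 0 < b by omega)) h0
    omega) hd
  have h3 : b ^ e * a + r < b ^ e * (a + 1) := by rw [mul_add, mul_one]; omega
  have h4 : b ^ e * (a + 1) ≤ b ^ e * b := Nat.mul_le_mul_left _ ha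
  rw [pow_succ] at h1
  omega

/-- Induction along `b`-decompositions. -/
theorem decompInduction {b : ℕ} (hb : 2 ≤ b) {P : ℕ → Prop} (h0 : P 0)
    (hs : ∀ e a r, 0 < a → a < b → r < b ^ e → P e → P r → P (b ^ e * a + r)) (m : ℕ) : P m := by
  induction m using Nat.strong_induction_on with
  | _ m ih =>
    by_cases hm : m = 0
    · rwa [hm]
    · obtain ⟨h1, h2, h3, h4, h5⟩ := decomp_props hb hm
      rw [← decomp_eq b m]
      exact hs _ _ _ h2 h3 h4 (ih _ h1) (ih _ h5)

/-- `E` evaluates `b`-decompositions with base `X` and coefficients `f`. -/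
structure IsEval (X : Ordinal.{0}) (f : ℕ → Ordinal.{0}) (b : ℕ) (E : ℕ → Ordinal.{0}) : Prop where
  one_lt : 1 < X
  two_le : 2 ≤ b
  zero : E 0 = 0
  coeff_zero : f 0 = 0
  coeff_mono : ∀ a a', a < a' → a' < b → f a < f a'
  coeff_lt : ∀ a < b, f a < X
  decomp : ∀ e a r, 0 < a → a < b → r < b ^ e → E (b ^ e * a + r) = X ^ E e * f a + E r

namespace IsEval

variable {X : Ordinal.{0}} {f : ℕ → Ordinal.{0}} {b : ℕ} {E : ℕ → Ordinal.{0}}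

theorem coeff_pos (h : IsEval X f b E) {a : ℕ} (h0 : 0 < a) (ha : a < b) : 0 < f a := by
  have := h.coeff_mono 0 a h0 ha
  rwa [h.coeff_zero] at this

theorem decomp_lt (h : IsEval X f b E) {e a r : ℕ} (h0 : 0 < a) (ha : a < b) (hr : r < b ^ e)
    (hr' : E r < X ^ E e) {y : Ordinal.{0}} (hy : f a < y) : E (b ^ e * a + r) < X ^ E e * y := by
  rw [h.decomp e a r h0 ha hr]
  exact opow_mul_add_lt_opow_mul hr' hy

/-- Monotonicity is assumed only below n because this bound is used inside the induction that proves
`strictMono`. -/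
theorem lt_opow_aux (h : IsEval X f b E) {n : ℕ} (hmono : ∀ e < n, ∀ e' < e, E e' < E e)
    (m : ℕ) : ∀ e < n, m < b ^ e → E m < X ^ E e := by
  refine decompInduction h.two_le (P := fun m => ∀ e < n, m < b ^ e → E m < X ^ E e) ?_ ?_ m
  · intro e _ _
    rw [h.zero]
    exact opow_pos _ (one_pos.trans h.one_lt)
  · intro e' a r h0 ha hr _ ir e he hlt
    have hee : e' < e := by
      by_contra! hle
      have h1 : b ^ e ≤ b ^ e' := Nat.pow_le_pow_right (by have := h.two_le; omega) hle
      have h2 : b ^ e' ≤ b ^ e' * a + r :=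
        (Nat.le_mul_of_pos_right _ h0).trans (Nat.le_add_right _ _)
      omega
    have h1 := h.decomp_lt h0 ha hr (ir e' (hee.trans he) hr) (h.coeff_lt a ha)
    refine h1.trans_le ?_
    rw [← opow_add_one]
    exact opow_le_opow_right (one_pos.trans h.one_lt) (Order.add_one_le_of_lt (hmono e he e' hee))

/-- Decompositions compare lexicographically by exponent, coefficient and remainder, and
`lt_opow_aux` keeps each remainder below the power it follows. -/
theorem strictMono (h : IsEval X f b E) : StrictMono E := by
  have key : ∀ n, ∀ m < n, E m < E n := by
    intro n
    induction n using Nat.strong_induction_on with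
    | _ n ih =>
      intro m hmn
      have hn : n ≠ 0 := by omega
      obtain ⟨e1, h2, h3, h4, h5⟩ := decomp_props h.two_le hn
      have hd := decomp_eq b n
      revert e1 h2 h3 h4 h5 hd
      generalize Nat.log b n = e
      generalize n / b ^ e = a
      generalize n % b ^ e = r
      intro e1 h2 h3 h4 h5 hd
      have hE := h.decomp e a r h2 h3 h4
      rw [hd] at hE
      have hX := one_pos.trans h.one_lt
      have hlow : X ^ E e * f a ≤ E n := by rw [hE]; exact le_self_add
      have hlow' : X ^ E e ≤ E n := (Ordinal.le_mul_left _ (h.coeff_pos h2 h3)).trans hlow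
      by_cases hm : m = 0
      · rw [hm, h.zero]
        exact (opow_pos _ hX).trans_le hlow'
      obtain ⟨e1', h2', h3', h4', h5'⟩ := decomp_props h.two_le hm
      have hd' := decomp_eq b m
      revert e1' h2' h3' h4' h5' hd'
      generalize Nat.log b m = e'
      generalize m / b ^ e' = a'
      generalize m % b ^ e' = r'
      intro e1' h2' h3' h4' h5' hd'
      have hee : e' ≤ e := by
        by_contra! hlt
        have h6 : b ^ (e + 1) ≤ b ^ e' := Nat.pow_le_pow_right (by omega) hlt
        have h7 : b ^ e' ≤ b ^ e' * a' := Nat.le_mul_of_pos_right _ h2'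
        have h8 : b ^ e * a + r < b ^ e * (a + 1) := by rw [mul_add, mul_one]; omega
        have h9 : b ^ e * (a + 1) ≤ b ^ e * b := Nat.mul_le_mul_left _ h3
        rw [pow_succ] at h6
        omega
      have hrlt : E r' < X ^ E e' := h.lt_opow_aux (n := n) (fun e he e' he' => ih e he e' he')
        r' e' (by omega) h4'
      rcases hee.lt_or_eq with hlt | rfl
      · rw [← hd']
        refine (h.decomp_lt h2' h3' h4' hrlt (h.coeff_lt a' h3')).trans_le (le_trans ?_ hlow')
        rw [← opow_add_one]
        exact opow_le_opow_right hX (Order.add_one_le_of_lt (ih e e1 e' hlt))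
      · rcases lt_trichotomy a' a with hlt | rfl | hgt
        · rw [← hd']
          exact (h.decomp_lt h2' h3' h4' hrlt (h.coeff_mono _ _ hlt h3)).trans_le hlow
        · rw [← hd', h.decomp _ _ _ h2' h3' h4', hE]
          exact (add_lt_add_iff_left _).2 (ih r h5 r' (by omega))
        · have h8 : b ^ e' * a + r < b ^ e' * (a + 1) := by rw [mul_add, mul_one]; omega
          have h9 : b ^ e' * (a + 1) ≤ b ^ e' * a' := Nat.mul_le_mul_left _ hgt
          omega
  exact fun m n hmn => key n m hmn

theorem lt_opow (h : IsEval X f b E) {m e : ℕ} (hm : m < b ^ e) : E m < X ^ E e :=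
  h.lt_opow_aux (n := e + 1) (fun _ _ _ he => h.strictMono he) m e (Nat.lt_succ_self e) hm

theorem natCast_le (h : IsEval X f b E) (m : ℕ) : (m : Ordinal.{0}) ≤ E m := by
  induction m with
  | zero => simp
  | succ m ih =>
    rw [Nat.cast_succ]
    exact Order.add_one_le_of_lt (ih.trans_lt (h.strictMono (Nat.lt_succ_self m)))

theorem of_lt (h : IsEval X f b E) {a : ℕ} (ha : a < b) : E a = f a := by
  by_cases h0 : a = 0
  · rw [h0, h.zero, h.coeff_zero]
  · have := h.decomp 0 a 0 (by omega) ha (by simp)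
    simpa [h.zero] using this

theorem add (h : IsEval X f b E) {k x r : ℕ} (hx : b ^ k ∣ x) (hr : r < b ^ k) :
    E (x + r) = E x + E r := by
  revert hx
  refine decompInduction h.two_le (P := fun x => b ^ k ∣ x → E (x + r) = E x + E r) ?_ ?_ x
  · intro _
    rw [h.zero, zero_add, zero_add]
  · intro e a r' h0 ha hr' _ ir hd
    have hke : k ≤ e := le_exp_of_dvd h0 ha hr' hd
    have hbk : b ^ k ∣ b ^ e := pow_dvd_pow b hke
    have hd' : b ^ k ∣ r' := (Nat.dvd_add_right (hbk.mul_right a)).1 hd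
    have hlt : r' + r < b ^ e := by
      obtain ⟨s, hs⟩ := hbk
      obtain ⟨t, ht⟩ := hd'
      rw [hs, ht] at hr' ⊢
      have h5 : t < s := lt_of_mul_lt_mul_left hr' (Nat.zero_le _)
      calc b ^ k * t + r < b ^ k * t + b ^ k := by omega
        _ = b ^ k * (t + 1) := by ring
        _ ≤ b ^ k * s := Nat.mul_le_mul_left _ h5
    rw [add_assoc, h.decomp e a _ h0 ha hlt, ir hd', h.decomp e a r' h0 ha hr', add_assoc]

theorem dvd (h : IsEval X f b E) {k x : ℕ} (hx : b ^ k ∣ x) : X ^ E k ∣ E x := by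
  revert hx
  refine decompInduction h.two_le (P := fun x => b ^ k ∣ x → X ^ E k ∣ E x) ?_ ?_ x
  · intro _
    rw [h.zero]
    exact dvd_zero _
  · intro e a r' h0 ha hr' _ ir hd
    have hke : k ≤ e := le_exp_of_dvd h0 ha hr' hd
    have hd' : b ^ k ∣ r' := (Nat.dvd_add_right ((pow_dvd_pow b hke).mul_right a)).1 hd
    rw [h.decomp e a r' h0 ha hr']
    exact dvd_add ((opow_dvd_opow X (h.strictMono.monotone hke)).mul_right _) (ir hd')

end IsEval

theorem bigO_zero {f : ℕ → Ordinal.{0}} {b : ℕ} (hb : 2 ≤ b) (hf : f 0 = 0) : bigO f b 0 = 0 := by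
  rw [bigO, dif_neg (by omega), dif_pos (by omega), hf]

theorem isEval_bigO {f : ℕ → Ordinal.{0}} {b : ℕ} (hb : 2 ≤ b) (hf : f 0 = 0)
    (hmono : ∀ a a', a < a' → a' < b → f a < f a') (hlt : ∀ a < b, f a < Om) :
    IsEval Om f b (bigO f b) := by
  refine ⟨one_lt_Om, hb, bigO_zero hb hf, hf, hmono, hlt, fun e a r h0 ha hr => ?_⟩
  by_cases hlt : b ^ e * a + r < b
  · have he : e = 0 := by
      by_contra he
      have h1 : b ^ 1 ≤ b ^ e := Nat.pow_le_pow_right (by omega) (by omega)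
      have h2 : b ^ e ≤ b ^ e * a := Nat.le_mul_of_pos_right _ h0
      rw [pow_one] at h1
      omega
    subst he
    have hr0 : r = 0 := by simpa using hr
    subst hr0
    rw [bigO, dif_neg (by omega), dif_pos hlt, bigO_zero hb hf]
    simp
  · rw [bigO, dif_neg (by omega), dif_neg hlt, decomp_log h0 ha hr, decomp_div hr, decomp_mod hr]

theorem bigO_congr {f g : ℕ → Ordinal.{0}} {b : ℕ} (h : ∀ a < b, f a = g a) (m : ℕ) :
    bigO f b m = bigO g b m := by
  induction m using Nat.strong_induction_on with
  | _ m ih =>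
    conv_lhs => rw [bigO]
    conv_rhs => rw [bigO]
    split_ifs with h1 h2
    · rfl
    · exact h m h2
    · obtain ⟨h3, h4, h5, h6, h7⟩ := decomp_props (b := b) (m := m) (by omega) (by omega)
      rw [ih _ h3, ih _ h7, h _ h5]

/-- The base change on natural numbers with finite coefficients. -/
def natBaseChange (U : ℕ → ℕ) (b c m : ℕ) : ℕ :=
  if _hb : b < 2 then 0
  else if _hm : m < b then U m
  else
    c ^ natBaseChange U b c (Nat.log b m) * U (m / b ^ Nat.log b m)
      + natBaseChange U b c (m % b ^ Nat.log b m)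
termination_by m
decreasing_by
  · exact Nat.log_lt_self b (by omega)
  · exact (Nat.mod_lt _ (Nat.pow_pos (by omega))).trans_le (Nat.pow_log_le_self b (by omega))

theorem baseChangeWith_coe {up : ℕ → ℕ∞} {U : ℕ → ℕ} {b : ℕ} (h : ∀ a < b, up a = (U a : ℕ∞))
    (c m : ℕ) : baseChangeWith up b c m = (natBaseChange U b c m : ℕ∞) := by
  induction m using Nat.strong_induction_on with
  | _ m ih =>
    rw [baseChangeWith, natBaseChange]
    split_ifs with h1 h2
    · rfl
    · exact h m h2
    · obtain ⟨h3, h4, h5, h6, h7⟩ := decomp_props (b := b) (m := m) (by omega) (by omega)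
      rw [ih _ h3, ih _ h7, h _ h5, Nat.cast_add, Nat.cast_mul]
      rfl

theorem natBaseChange_congr {U V : ℕ → ℕ} {b : ℕ} (h : ∀ a < b, U a = V a) (c m : ℕ) :
    natBaseChange U b c m = natBaseChange V b c m := by
  have h1 := baseChangeWith_coe (up := fun a => (U a : ℕ∞)) (U := U) (b := b) (fun _ _ => rfl) c m
  have h2 := baseChangeWith_coe (up := fun a => (U a : ℕ∞)) (U := V) (b := b)
    (fun a ha => by rw [h a ha]) c m
  exact_mod_cast h1.symm.trans h2

theorem natBaseChange_of_lt {U : ℕ → ℕ} {b c m : ℕ} (hb : 2 ≤ b) (hm : m < b) :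
    natBaseChange U b c m = U m := by
  rw [natBaseChange, dif_neg (by omega), dif_pos hm]

theorem natBaseChange_decomp {U : ℕ → ℕ} {b c e a r : ℕ} (hb : 2 ≤ b) (hU : U 0 = 0) (h0 : 0 < a)
    (ha : a < b) (hr : r < b ^ e) :
    natBaseChange U b c (b ^ e * a + r) =
      c ^ natBaseChange U b c e * U a + natBaseChange U b c r := by
  by_cases hlt : b ^ e * a + r < b
  · have he : e = 0 := by
      by_contra he
      have h1 : b ^ 1 ≤ b ^ e := Nat.pow_le_pow_right (by omega) (by omega)
      have h2 : b ^ e ≤ b ^ e * a := Nat.le_mul_of_pos_right _ h0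
      rw [pow_one] at h1
      omega
    subst he
    have hr0 : r = 0 := by simpa using hr
    subst hr0
    rw [natBaseChange_of_lt hb hlt, natBaseChange_of_lt hb (by omega), hU]
    simp
  · rw [natBaseChange, dif_neg (by omega), dif_neg hlt, decomp_log h0 ha hr, decomp_div hr,
      decomp_mod hr]

/-- Read in the ordinals, a base change is an evaluation with the finite base c. Monotonicity and
additivity are thus obtained together with those of `bigO`. -/
theorem isEval_natBaseChange {U : ℕ → ℕ} {b c : ℕ} (hb : 2 ≤ b) (hc : 2 ≤ c) (hU : U 0 = 0)
    (hmono : ∀ a a', a < a' → a' < b → U a < U a') (hlt : ∀ a < b, U a < c) :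
    IsEval c (fun a => (U a : Ordinal.{0})) b (fun m => (natBaseChange U b c m : Ordinal.{0})) where
  one_lt := by exact_mod_cast hc
  two_le := hb
  zero := by rw [natBaseChange_of_lt hb (by omega), hU, Nat.cast_zero]
  coeff_zero := by rw [hU, Nat.cast_zero]
  coeff_mono a a' h h' := by exact_mod_cast hmono a a' h h'
  coeff_lt a h := by exact_mod_cast hlt a h
  decomp e a r h0 ha hr := by
    rw [natBaseChange_decomp hb hU h0 ha hr, Nat.cast_add, natCast_mul, natCast_pow, opow_natCast]

/-- The hypotheses under which the base change from `b` to `c` with coefficients `U` is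
well behaved. -/
structure GoodDigits (U : ℕ → ℕ) (b c : ℕ) : Prop where
  two_le : 2 ≤ b
  two_le' : 2 ≤ c
  zero : U 0 = 0
  mono : ∀ a a', a < a' → a' < b → U a < U a'
  lt : ∀ a < b, U a < c

namespace GoodDigits

variable {U : ℕ → ℕ} {b c : ℕ}

theorem isEval (h : GoodDigits U b c) :
    IsEval c (fun a => (U a : Ordinal.{0})) b (fun m => (natBaseChange U b c m : Ordinal.{0})) :=
  isEval_natBaseChange h.two_le h.two_le' h.zero h.mono h.lt

theorem strictMono (h : GoodDigits U b c) : StrictMono (natBaseChange U b c) := fun m n hmn => by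
  have := h.isEval.strictMono hmn
  exact_mod_cast this

theorem map_zero (h : GoodDigits U b c) : natBaseChange U b c 0 = 0 := by
  have := h.isEval.zero
  exact_mod_cast this

theorem of_lt (h : GoodDigits U b c) {a : ℕ} (ha : a < b) : natBaseChange U b c a = U a :=
  natBaseChange_of_lt h.two_le ha

theorem pos (h : GoodDigits U b c) {a : ℕ} (h0 : 0 < a) (ha : a < b) : 0 < U a := by
  have := h.mono 0 a h0 ha
  omega

theorem le_map (h : GoodDigits U b c) (m : ℕ) : m ≤ natBaseChange U b c m := h.strictMono.le_apply

theorem map_lt_pow (h : GoodDigits U b c) {m e : ℕ} (hm : m < b ^ e) :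
    natBaseChange U b c m < c ^ natBaseChange U b c e := by
  have := h.isEval.lt_opow hm
  rw [opow_natCast, ← natCast_pow] at this
  exact_mod_cast this

theorem map_add (h : GoodDigits U b c) {k x r : ℕ} (hx : b ^ k ∣ x) (hr : r < b ^ k) :
    natBaseChange U b c (x + r) = natBaseChange U b c x + natBaseChange U b c r := by
  have := h.isEval.add hx hr
  exact_mod_cast this

theorem map_decomp (h : GoodDigits U b c) {e a r : ℕ} (h0 : 0 < a) (ha : a < b) (hr : r < b ^ e) :
    natBaseChange U b c (b ^ e * a + r) =
      c ^ natBaseChange U b c e * U a + natBaseChange U b c r :=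
  natBaseChange_decomp h.two_le h.zero h0 ha hr

theorem dvd_map (h : GoodDigits U b c) {k x : ℕ} (hx : b ^ k ∣ x) :
    c ^ k ∣ natBaseChange U b c x := by
  revert hx
  refine decompInduction h.two_le (P := fun x => b ^ k ∣ x → c ^ k ∣ natBaseChange U b c x) ?_ ?_ x
  · intro _
    rw [h.map_zero]
    exact dvd_zero _
  · intro e a r' h0 ha hr' _ ir hd
    have hke : k ≤ e := le_exp_of_dvd h0 ha hr' hd
    have hd' : b ^ k ∣ r' := (Nat.dvd_add_right ((pow_dvd_pow b hke).mul_right a)).1 hd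
    rw [h.map_decomp h0 ha hr']
    exact dvd_add ((pow_dvd_pow c (hke.trans (h.le_map e))).mul_right _) (ir hd')

theorem map_mul_base (h : GoodDigits U b c) (hU : U 1 = 1) {v : ℕ} (hv : v < b) :
    natBaseChange U b c (b * v) = c * U v := by
  by_cases h0 : v = 0
  · rw [h0, mul_zero, h.map_zero, h.zero, mul_zero]
  · have := h.map_decomp (e := 1) (a := v) (r := 0) (by omega) hv (by have := h.two_le; simp; omega)
    rw [pow_one, add_zero, h.map_zero, add_zero,
      h.of_lt (a := 1) (by have := h.two_le; omega), hU,
      pow_one] at this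
    exact this

end GoodDigits

/-- If `g` interprets the coefficients `U a` as `f a`, then base change preserves the
interpretation. -/
theorem bigO_natBaseChange {U : ℕ → ℕ} {b c : ℕ} {f g : ℕ → Ordinal.{0}} (h : GoodDigits U b c)
    (hf : IsEval Om f b (bigO f b)) (hg : IsEval Om g c (bigO g c)) (hfg : ∀ a < b, g (U a) = f a)
    (m : ℕ) : bigO g c (natBaseChange U b c m) = bigO f b m := by
  refine decompInduction h.two_le
    (P := fun m => bigO g c (natBaseChange U b c m) = bigO f b m) ?_ ?_ m
  · rw [h.map_zero, hf.zero, hg.zero]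
  · intro e a r h0 ha hr ie ir
    rw [h.map_decomp h0 ha hr, hf.decomp e a r h0 ha hr,
      hg.decomp _ _ _ (h.pos h0 ha) (h.lt a ha) (h.map_lt_pow hr), ie, ir, hfg a ha]

end

end Ouroboros

namespace Ouroboros

noncomputable section

/-! ## Base hierarchies -/

theorem coe_lt_nextBase_iff {B : Set ℕ} {c x : ℕ} :
    (x : ℕ∞) < nextBase B c ↔ ∀ b ∈ B, c < b → x < b := by
  constructor
  · intro h b hb hcb
    have h1 : nextBase B c ≤ (b : ℕ∞) := sInf_le ⟨b, hb, hcb, rfl⟩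
    exact_mod_cast h.trans_le h1
  · intro h
    have h1 : ((x + 1 : ℕ) : ℕ∞) ≤ nextBase B c := by
      apply le_sInf
      rintro _ ⟨b, hb, hcb, rfl⟩
      exact_mod_cast h b hb hcb
    refine lt_of_lt_of_le ?_ h1
    exact_mod_cast Nat.lt_succ_self x

theorem nextBase_eq {B : Set ℕ} {b s : ℕ} (hs : s ∈ B) (hbs : b < s)
    (hmin : ∀ x ∈ B, b < x → s ≤ x) : nextBase B b = s := by
  refine le_antisymm (sInf_le (show (s : ℕ∞) ∈ _ from ⟨s, hs, hbs, rfl⟩)) ?_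
  apply le_sInf
  rintro _ ⟨x, hx, hbx, rfl⟩
  exact_mod_cast hmin x hx hbx

theorem exists_nextBase {B : Set ℕ} {b b' : ℕ} (hb' : b' ∈ B) (h : b < b') :
    ∃ s ∈ B, b < s ∧ s ≤ b' ∧ ∀ x ∈ B, b < x → s ≤ x := by
  have hex : ∃ s, s ∈ B ∧ b < s := ⟨b', hb', h⟩
  exact ⟨Nat.find hex, (Nat.find_spec hex).1, (Nat.find_spec hex).2, Nat.find_min' hex ⟨hb', h⟩,
    fun x hx hbx => Nat.find_min' hex ⟨hx, hbx⟩⟩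

theorem IsBaseHierarchy.dvd_of_le {B : Set ℕ} (hB : IsBaseHierarchy B) {b b' : ℕ} (hb : b ∈ B)
    (hb' : b' ∈ B) (h : b ≤ b') : b ∣ b' := by
  obtain ⟨k, hk⟩ : ∃ k, k = b' - b := ⟨_, rfl⟩
  induction k using Nat.strong_induction_on generalizing b with
  | _ k ih =>
    rcases h.eq_or_lt with rfl | hlt
    · exact dvd_rfl
    · obtain ⟨s, hs, hbs, hsb, hmin⟩ := exists_nextBase hb' hlt
      exact (hB.dvd_next b hb s (nextBase_eq hs hbs hmin)).trans
        (ih (b' - s) (by omega) hs hsb rfl)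

theorem isBaseHierarchy_of_dvd {B : Set ℕ} (h2 : ∀ b ∈ B, 2 ≤ b) (hne : B.Nonempty)
    (hd : ∀ b ∈ B, ∀ b' ∈ B, b ≤ b' → b ∣ b') : IsBaseHierarchy B := by
  refine ⟨h2, hne, fun b hb s hs => ?_⟩
  have hS : {x : ℕ∞ | ∃ b' ∈ B, b < b' ∧ x = (b' : ℕ∞)}.Nonempty := by
    by_contra! he
    rw [nextBase, he, _root_.sInf_empty] at hs
    exact absurd hs (ENat.top_ne_natCast s)
  obtain ⟨b', hb', hlt, he⟩ := csInf_mem hS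
  rw [nextBase, he] at hs
  have : b' = s := by exact_mod_cast hs
  rw [← this]
  exact hd b hb b' hb' hlt.le

theorem IsBaseHierarchy.sInf_mem {B : Set ℕ} (hB : IsBaseHierarchy B) : sInf B ∈ B :=
  Nat.sInf_mem hB.nonempty

theorem IsBaseHierarchy.two_le_sInf {B : Set ℕ} (hB : IsBaseHierarchy B) : 2 ≤ sInf B :=
  hB.two_le _ hB.sInf_mem

theorem IsBaseHierarchy.sInf_dvd {B : Set ℕ} (hB : IsBaseHierarchy B) {b : ℕ} (hb : b ∈ B) :
    sInf B ∣ b := hB.dvd_of_le hB.sInf_mem hb (Nat.sInf_le hb)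

theorem baseOf_eq {B : Set ℕ} {b n : ℕ} (hb : b ∈ B) (hbn : b ≤ n)
    (hmax : ∀ x ∈ B, x ≤ n → x ≤ b) : baseOf B n = b := by
  rw [baseOf, if_pos ((Nat.sInf_le hb).trans hbn)]
  exact IsGreatest.csSup_eq ⟨⟨hb, hbn⟩, fun x hx => hmax x hx.1 hx.2⟩

theorem baseOf_spec {B : Set ℕ} (hne : B.Nonempty) {n : ℕ} (h : sInf B ≤ n) :
    baseOf B n ∈ B ∧ baseOf B n ≤ n ∧ ∀ x ∈ B, x ≤ n → x ≤ baseOf B n := by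
  rw [baseOf, if_pos h]
  have hbdd : BddAbove {b | b ∈ B ∧ b ≤ n} := ⟨n, fun x hx => hx.2⟩
  have hmem := Nat.sSup_mem (s := {b | b ∈ B ∧ b ≤ n}) ⟨sInf B, Nat.sInf_mem hne, h⟩ hbdd
  exact ⟨hmem.1, hmem.2, fun x hx hxn => le_csSup hbdd ⟨hx, hxn⟩⟩

theorem baseOf_self {B : Set ℕ} {b : ℕ} (hb : b ∈ B) : baseOf B b = b :=
  baseOf_eq hb le_rfl fun _ _ h => h

theorem baseOf_succ {B : Set ℕ} (hne : B.Nonempty) {n : ℕ} (h : sInf B ≤ n) (hn : n + 1 ∉ B) :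
    baseOf B (n + 1) = baseOf B n := by
  obtain ⟨h1, h2, h3⟩ := baseOf_spec hne h
  refine baseOf_eq h1 (by omega) fun x hx hxn => h3 x hx ?_
  have : x ≠ n + 1 := fun he => hn (he ▸ hx)
  omega

/-! ## The upgrade operator -/

theorem upgrade_of_lt {B S : Set ℕ} {n : ℕ} (h : n < sInf B) : upgrade B S n = n := by
  rw [upgrade]
  simp only [if_pos h]

theorem baseChangeWith_congr {up up' : ℕ → ℕ∞} {b : ℕ} (h : ∀ a < b, up a = up' a) (c m : ℕ) :
    baseChangeWith up b c m = baseChangeWith up' b c m := by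
  induction m using Nat.strong_induction_on with
  | _ m ih =>
    conv_lhs => rw [baseChangeWith]
    conv_rhs => rw [baseChangeWith]
    split_ifs with h1 h2
    · rfl
    · exact h m h2
    · obtain ⟨h3, h4, h5, h6, h7⟩ := decomp_props (b := b) (m := m) (by omega) (by omega)
      rw [ih _ h3, ih _ h7, h _ h5]

/-- The bases that are eligible for the upgrade of `n`. -/
def IsWitness (B S : Set ℕ) (n c : ℕ) : Prop :=
  c ∈ S ∧ upgrade B S (n - 1) < baseChange B S (baseOf B n) c n ∧
    baseChange B S (baseOf B n) c n < nextBase S c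

theorem upgrade_unfold {B S : Set ℕ} (hne : B.Nonempty) {n : ℕ} (h : sInf B ≤ n) (h0 : 0 < n) :
    upgrade B S n = if {c | IsWitness B S n c}.Nonempty then
      baseChange B S (baseOf B n) (sInf {c | IsWitness B S n c}) n else ⊤ := by
  have hb := (baseOf_spec hne h).2.1
  have hc : ∀ c, baseChangeWith (fun m => if _h : m < n then upgrade B S m else 0) (baseOf B n) c n
      = baseChange B S (baseOf B n) c n := fun c =>
    baseChangeWith_congr (fun a ha => by rw [dif_pos (ha.trans_le hb)]) c n
  rw [upgrade]
  simp only [if_neg (not_lt.2 h), hc, dif_pos (show n - 1 < n by omega)]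
  rfl

theorem baseChange_coe {B S : Set ℕ} {U : ℕ → ℕ} {b : ℕ}
    (h : ∀ a < b, upgrade B S a = (U a : ℕ∞)) (c m : ℕ) :
    baseChange B S b c m = (natBaseChange U b c m : ℕ∞) := baseChangeWith_coe h c m

theorem upgrade_eq {B S : Set ℕ} (hne : B.Nonempty) {U : ℕ → ℕ} {n c : ℕ} (h : sInf B ≤ n)
    (h0 : 0 < n) (hup : ∀ m < n, upgrade B S m = (U m : ℕ∞)) (hc : c ∈ S)
    (hlt : U (n - 1) < natBaseChange U (baseOf B n) c n)
    (hnext : ∀ x ∈ S, c < x → natBaseChange U (baseOf B n) c n < x)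
    (hmin : ∀ x ∈ S, x < c → natBaseChange U (baseOf B n) x n ≤ U (n - 1) ∨
      ∃ y ∈ S, x < y ∧ y ≤ natBaseChange U (baseOf B n) x n) :
    upgrade B S n = (natBaseChange U (baseOf B n) c n : ℕ∞) := by
  have hb := (baseOf_spec hne h).2.1
  have hbc : ∀ x, baseChange B S (baseOf B n) x n = (natBaseChange U (baseOf B n) x n : ℕ∞) :=
    fun x => baseChange_coe (fun a ha => hup a (ha.trans_le hb)) x n
  have hw : IsWitness B S n c := by
    refine ⟨hc, ?_, ?_⟩
    · rw [hbc, hup _ (by omega)]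
      exact_mod_cast hlt
    · rw [hbc, coe_lt_nextBase_iff]
      exact hnext
  have hinf : sInf {c | IsWitness B S n c} = c := by
    refine IsLeast.csInf_eq ⟨hw, fun x hx => ?_⟩
    by_contra! hxc
    obtain ⟨hx1, hx2, hx3⟩ := hx
    rw [hbc, hup _ (by omega)] at hx2
    rw [hbc, coe_lt_nextBase_iff] at hx3
    rcases hmin x hx1 hxc with h1 | ⟨y, hy, hxy, hyx⟩
    · exact absurd h1 (not_le.2 (by exact_mod_cast hx2))
    · exact absurd hyx (not_le.2 (hx3 y hy hxy))
  rw [upgrade_unfold hne h h0, if_pos ⟨c, hw⟩, hinf, hbc]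

/-- Bases above K exceed all upgrade values up to n. They neither come between a value and its base
nor become smaller witnesses, so the least witness does not change. This is why later stages leave
earlier upgrades alone. -/
theorem upgrade_eq_of_subset {B S T : Set ℕ} (hB : IsBaseHierarchy B) (hST : S ⊆ T) {U : ℕ → ℕ}
    {n K : ℕ} (hup : ∀ m ≤ n, upgrade B S m = (U m : ℕ∞)) (hK : ∀ m ≤ n, U m ≤ K)
    (hS : ∀ x ∈ S, x ≤ K) (hT : ∀ x ∈ T, x ∉ S → K < x) :
    ∀ m ≤ n, upgrade B T m = (U m : ℕ∞) := by
  intro m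
  induction m using Nat.strong_induction_on with
  | _ m ih =>
    intro hm
    rcases lt_or_ge m (sInf B) with hq | hq
    · rw [← hup m hm, upgrade_of_lt hq, upgrade_of_lt hq]
    · have h2 := hB.two_le_sInf
      have hb := (baseOf_spec hB.nonempty hq).2.1
      have hbc : ∀ x, baseChange B S (baseOf B m) x m = (natBaseChange U (baseOf B m) x m : ℕ∞) :=
        fun x => baseChange_coe (fun a ha => hup a (by omega)) x m
      have hU := hup m hm
      rw [upgrade_unfold hB.nonempty hq (by omega)] at hU
      split_ifs at hU with hne
      · obtain ⟨h3, h4, h5⟩ := Nat.sInf_mem hne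
        have hmin : ∀ x, IsWitness B S m x → sInf {c | IsWitness B S m c} ≤ x :=
          fun x hx => Nat.sInf_le hx
        generalize sInf {c | IsWitness B S m c} = c at hU h3 h4 h5 hmin
        rw [hbc] at hU h4 h5
        have hU' : natBaseChange U (baseOf B m) c m = U m := by exact_mod_cast hU
        rw [hup _ (by omega)] at h4
        rw [coe_lt_nextBase_iff] at h5
        rw [← hU']
        refine upgrade_eq hB.nonempty hq (by omega) (fun k hk => ih k hk (by omega)) (hST h3)
          (by exact_mod_cast h4) (fun x hx hcx => ?_) (fun x hx hxc => ?_)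
        · by_cases hxS : x ∈ S
          · exact h5 x hxS hcx
          · exact (hU' ▸ hK m hm).trans_lt (hT x hx hxS)
        · have hxS : x ∈ S := by
            by_contra hxS
            exact absurd (hT x hx hxS) (not_lt.2 (hxc.le.trans (hS c h3)))
          by_contra! hcon
          have : IsWitness B S m x := by
            refine ⟨hxS, ?_, ?_⟩
            · rw [hbc, hup _ (by omega)]; exact_mod_cast hcon.1
            · rw [hbc, coe_lt_nextBase_iff]
              exact fun y hy hxy => hcon.2 y (hST hy) hxy
          exact absurd (hmin x this) (not_le.2 hxc)
      · exact absurd hU (ENat.top_ne_natCast _)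

theorem natBaseChange_self {U : ℕ → ℕ} {b c : ℕ} (hb : 2 ≤ b) (h0 : U 0 = 0) (h1 : U 1 = 1) :
    natBaseChange U b c b = c := by
  have := natBaseChange_decomp (U := U) (b := b) (c := c) (e := 1) (a := 1) (r := 0) hb h0
    one_pos (by omega) (by simp; omega)
  rw [natBaseChange_of_lt (m := 1) hb (by omega), natBaseChange_of_lt (m := 0) hb (by omega),
    h0, h1] at this
  simpa using this

/-! ## The stages of the ouroboros successor -/

/-- `S` is an approximation to the ouroboros successor of `B` that is correct up to `n`, with
maximum `c`, and `U` is the upgrade operator up to `n`. -/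
structure StageInv (B S : Set ℕ) (U : ℕ → ℕ) (c n : ℕ) : Prop where
  le_n : sInf B ≤ n
  mem : c ∈ S
  le : ∀ x ∈ S, x ≤ c
  dvd : ∀ x ∈ S, ∀ y ∈ S, x ≤ y → x ∣ y
  lt_of_mem : ∀ x ∈ S, sInf B < x
  succ_mem : sInf B + 1 ∈ S
  up : ∀ m ≤ n, upgrade B S m = (U m : ℕ∞)
  mono : ∀ m m', m < m' → m' ≤ n → U m < U m'
  base_le : c ≤ U n
  val : U n = natBaseChange U (baseOf B n) c n
  digit_lt : ∀ m < baseOf B n, U m < c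

namespace StageInv

variable {B S : Set ℕ} {U : ℕ → ℕ} {c n : ℕ}

theorem of_lt (h : StageInv B S U c n) {m : ℕ} (hm : m < sInf B) : U m = m := by
  have := h.up m (hm.le.trans h.le_n)
  rw [upgrade_of_lt hm] at this
  exact_mod_cast this.symm

theorem congr (h : StageInv B S U c n) (hB : IsBaseHierarchy B) {V : ℕ → ℕ}
    (hV : ∀ m ≤ n, V m = U m) : StageInv B S V c n := by
  have hb := (baseOf_spec hB.nonempty h.le_n).2.1
  refine ⟨h.le_n, h.mem, h.le, h.dvd, h.lt_of_mem, h.succ_mem, fun m hm => ?_,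
    fun m m' hm hm' => ?_, ?_, ?_, fun m hm => ?_⟩
  · rw [hV m hm, h.up m hm]
  · rw [hV m (by omega), hV m' hm']; exact h.mono m m' hm hm'
  · rw [hV n le_rfl]; exact h.base_le
  · rw [hV n le_rfl, natBaseChange_congr (V := U) (fun a ha => hV a (by omega)), ← h.val]
  · rw [hV m (by omega)]; exact h.digit_lt m hm

theorem goodDigits (h : StageInv B S U c n) (hB : IsBaseHierarchy B) {d : ℕ} (hd : c ≤ d) :
    GoodDigits U (baseOf B n) d := by
  have hb := baseOf_spec hB.nonempty h.le_n
  have h2 := hB.two_le_sInf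
  have h3 := h.lt_of_mem c h.mem
  refine ⟨hB.two_le _ hb.1, by omega, h.of_lt (by omega),
    fun a a' ha ha' => h.mono a a' ha (by omega),
    fun a ha => (h.digit_lt a ha).trans_le hd⟩

/-- The common part of the three kinds of stage. The new maximum c' has no successor in S', so it is
a witness for n + 1. It is the least one as soon as `hnot` excludes the candidates between c and c';
smaller ones fail automatically. -/
theorem step (h : StageInv B S U c n) (hB : IsBaseHierarchy B) {S' : Set ℕ} {c' : ℕ}
    (hS : S ⊆ S') (hnew : ∀ x ∈ S', x ∉ S → U n < x) (hc' : c' ∈ S') (hmax : ∀ x ∈ S', x ≤ c')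
    (hdvd : ∀ x ∈ S', ∀ y ∈ S', x ≤ y → x ∣ y)
    (hlt : U n < natBaseChange U (baseOf B (n + 1)) c' (n + 1))
    (hle : c' ≤ natBaseChange U (baseOf B (n + 1)) c' (n + 1))
    (hdig : ∀ m < baseOf B (n + 1), U m < c')
    (hnot : ∀ x ∈ S', c ≤ x → x < c' → natBaseChange U (baseOf B (n + 1)) x (n + 1) ≤ U n ∨
      ∃ y ∈ S', x < y ∧ y ≤ natBaseChange U (baseOf B (n + 1)) x (n + 1)) :
    StageInv B S' (Function.update U (n + 1) (natBaseChange U (baseOf B (n + 1)) c' (n + 1)))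
      c' (n + 1) := by
  have hq : sInf B ≤ n + 1 := h.le_n.trans (Nat.le_succ n)
  have hb := (baseOf_spec hB.nonempty hq).2.1
  obtain ⟨V, hV⟩ : ∃ V, V = Function.update U (n + 1)
    (natBaseChange U (baseOf B (n + 1)) c' (n + 1)) := ⟨_, rfl⟩
  have hVU : ∀ m ≤ n, V m = U m := fun m hm => by
    rw [hV, Function.update_of_ne (by omega)]
  have hVn : V (n + 1) = natBaseChange U (baseOf B (n + 1)) c' (n + 1) := by
    rw [hV, Function.update_self]
  rw [← hV]
  have hUK : ∀ m ≤ n, U m ≤ U n := fun m hm => by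
    rcases hm.eq_or_lt with rfl | hlt'
    · exact le_rfl
    · exact (h.mono m n hlt' le_rfl).le
  have hup : ∀ m ≤ n, upgrade B S' m = (U m : ℕ∞) :=
    upgrade_eq_of_subset hB hS h.up hUK (fun x hx => (h.le x hx).trans h.base_le) hnew
  have hcongr : ∀ x, natBaseChange V (baseOf B (n + 1)) x (n + 1) =
      natBaseChange U (baseOf B (n + 1)) x (n + 1) := fun x =>
    natBaseChange_congr (fun a ha => hVU a (by omega)) x (n + 1)
  refine ⟨hq, hc', hmax, hdvd, fun x hx => ?_, hS h.succ_mem, fun m hm => ?_, fun m m' hm hm' => ?_,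
    by rwa [hVn], by rw [hVn, hcongr], fun m hm => ?_⟩
  · by_cases hxS : x ∈ S
    · exact h.lt_of_mem x hxS
    · exact ((h.lt_of_mem c h.mem).trans_le h.base_le).trans (hnew x hx hxS)
  · rcases Nat.lt_or_ge n m with hlt' | hle'
    · have he : m = n + 1 := by omega
      subst he
      rw [hVn]
      refine upgrade_eq hB.nonempty hq (by omega) (fun k hk => hup k (by omega)) hc' hlt
        (fun x hx hcx => absurd (hmax x hx) (not_le.2 hcx)) (fun x hx hxc => ?_)
      by_cases hcx : c ≤ x
      · exact hnot x hx hcx hxc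
      · push Not at hcx
        -- For x < c: a value above U n is also at least c, as c ≤ U n, so the base c disqualifies
        -- x.
        rcases le_or_gt (natBaseChange U (baseOf B (n + 1)) x (n + 1)) (U n) with h1 | h1
        · exact Or.inl h1
        · exact Or.inr ⟨c, hS h.mem, hcx, (h.base_le.trans_lt h1).le⟩
    · rw [hVU m hle']; exact hup m hle'
  · rcases Nat.lt_or_ge n m' with hlt' | hle'
    · have he : m' = n + 1 := by omega
      subst he
      rw [hVn, hVU m (by omega)]
      exact (hUK m (by omega)).trans_lt hlt
    · rw [hVU m (by omega), hVU m' hle']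
      exact h.mono m m' hm hle'
  · rw [hVU m (by omega)]
    exact hdig m hm

end StageInv

theorem stageInv_initial {B : Set ℕ} (hB : IsBaseHierarchy B) :
    StageInv B {sInf B + 1} (fun m => if m < sInf B then m else sInf B + 1) (sInf B + 1)
      (sInf B) := by
  have h2 := hB.two_le_sInf
  obtain ⟨U, hU⟩ : ∃ U : ℕ → ℕ, U = fun m => if m < sInf B then m else sInf B + 1 := ⟨_, rfl⟩
  have hlt : ∀ m < sInf B, U m = m := fun m hm => by rw [hU]; exact if_pos hm
  have hq : U (sInf B) = sInf B + 1 := by rw [hU]; exact if_neg (lt_irrefl _)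
  have hb := baseOf_self hB.sInf_mem
  have hself : natBaseChange U (sInf B) (sInf B + 1) (sInf B) = sInf B + 1 :=
    natBaseChange_self h2 (hlt 0 (by omega)) (hlt 1 (by omega))
  rw [← hU]
  refine ⟨le_rfl, rfl, fun x hx => by rw [Set.mem_singleton_iff.1 hx], fun x hx y hy _ => ?_,
    fun x hx => ?_, rfl, fun m hm => ?_, fun m m' hm hm' => ?_, hq.ge, ?_, fun m hm => ?_⟩
  · rw [Set.mem_singleton_iff.1 hx, Set.mem_singleton_iff.1 hy]
  · rw [Set.mem_singleton_iff.1 hx]; omega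
  · rcases hm.lt_or_eq with hm' | rfl
    · rw [upgrade_of_lt hm', hlt m hm']
    · have := upgrade_eq (S := {sInf B + 1}) (U := U) (n := sInf B) (c := sInf B + 1) hB.nonempty
        le_rfl (by omega) (fun m hm => by rw [upgrade_of_lt hm, hlt m hm]) rfl (by
          rw [hb, hself, hlt _ (by omega)]; omega)
        (fun x hx hlt => absurd hlt (by rw [Set.mem_singleton_iff.1 hx]; exact lt_irrefl _))
        (fun x hx hlt => absurd hlt (by rw [Set.mem_singleton_iff.1 hx]; exact lt_irrefl _))
      rw [this, hb, hself, hq]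
  · rcases hm'.lt_or_eq with h3 | rfl
    · rw [hlt m (by omega), hlt m' h3]; exact hm
    · rw [hq, hlt m hm]; omega
  · rw [hb, hself, hq]
  · rw [hb] at hm
    rw [hlt m hm]; omega

end

end Ouroboros

/-! ### The chain of bases added at a critical number, and the passage between stages -/

namespace Ouroboros

noncomputable section

/-- The numbers `d_0 = c`, `d_{j+1} = ` base change of `n` from `b` to `d_j`. -/
def natChain (U : ℕ → ℕ) (b n c : ℕ) : ℕ → ℕ
  | 0 => c
  | j + 1 => natBaseChange U b (natChain U b n c j) n

section Chain

variable {U : ℕ → ℕ} {b n c : ℕ}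

theorem GoodDigits.lt_map {d : ℕ} (h : GoodDigits U b d) (h1 : U 1 = 1) (hbn : b < n) :
    d < natBaseChange U b d n := by
  have := h.strictMono hbn
  rwa [natBaseChange_self h.two_le h.zero h1] at this

theorem le_natChain (hg : ∀ d, c ≤ d → GoodDigits U b d) (h1 : U 1 = 1) (hbn : b < n) (j : ℕ) :
    c ≤ natChain U b n c j := by
  induction j with
  | zero => exact le_rfl
  | succ j ih => exact ih.trans ((hg _ ih).lt_map h1 hbn).le

theorem natChain_lt_succ (hg : ∀ d, c ≤ d → GoodDigits U b d) (h1 : U 1 = 1) (hbn : b < n)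
    (j : ℕ) : natChain U b n c j < natChain U b n c (j + 1) :=
  (hg _ (le_natChain hg h1 hbn j)).lt_map h1 hbn

theorem natChain_strictMono (hg : ∀ d, c ≤ d → GoodDigits U b d) (h1 : U 1 = 1) (hbn : b < n) :
    StrictMono (natChain U b n c) := strictMono_nat_of_lt_succ (natChain_lt_succ hg h1 hbn)

theorem natChain_dvd (hg : ∀ d, c ≤ d → GoodDigits U b d) (h1 : U 1 = 1) (hbn : b < n)
    (hd : b ∣ n) {i j : ℕ} (hij : i ≤ j) : natChain U b n c i ∣ natChain U b n c j := by
  induction j, hij using Nat.le_induction with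
  | base => exact dvd_rfl
  | succ j _ ih =>
    refine ih.trans ?_
    have := (hg _ (le_natChain hg h1 hbn j)).dvd_map (k := 1) (x := n) (by simpa using hd)
    simpa [natChain] using this

end Chain

theorem stage_of_le {B : Set ℕ} {k n : ℕ} (h : n ≤ sInf B) : stage B k n = {sInf B + 1} := by
  cases n with
  | zero => rfl
  | succ n => rw [stage, if_pos h]

theorem stage_subset_succ (B : Set ℕ) (k n : ℕ) : stage B k n ⊆ stage B k (n + 1) := by
  by_cases h : n + 1 ≤ sInf B
  · rw [stage_of_le h, stage_of_le (Nat.le_of_succ_le h)]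
  · rw [stage, if_neg h]
    split_ifs
    · exact Set.subset_union_left
    · exact Set.subset_union_left
    · exact subset_rfl

namespace StageInv

variable {B S : Set ℕ} {U : ℕ → ℕ} {c n : ℕ}

theorem sSup_eq (h : StageInv B S U c n) : sSup S = c := IsGreatest.csSup_eq ⟨h.mem, h.le⟩

theorem one (h : StageInv B S U c n) (hB : IsBaseHierarchy B) : U 1 = 1 :=
  h.of_lt (by have := hB.two_le_sInf; omega)

theorem coe_digits (h : StageInv B S U c n) (hB : IsBaseHierarchy B) :
    ∀ a < baseOf B n, upgrade B S a = (U a : ℕ∞) := fun a ha =>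
  h.up a (ha.le.trans (baseOf_spec hB.nonempty h.le_n).2.1)

theorem chain_eq (h : StageInv B S U c n) (hB : IsBaseHierarchy B) (hn : n + 1 ∉ B) (j : ℕ) :
    chain B S (n + 1) c j = natChain U (baseOf B n) (n + 1) c j := by
  induction j with
  | zero => rfl
  | succ j ih =>
    rw [chain, natChain, ih, baseOf_succ hB.nonempty h.le_n hn, baseChange_coe (h.coe_digits hB)]
    rfl

theorem stage_crit {k : ℕ} (h : StageInv B (stage B k n) U c n) (hB : IsBaseHierarchy B)
    (hn : n + 1 ∉ B) (hd : baseOf B n ∣ n + 1) :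
    stage B k (n + 1) = stage B k n ∪
      {d | ∃ j, 1 ≤ j ∧ j ≤ k ∧ d = natChain U (baseOf B n) (n + 1) c j} := by
  rw [stage, if_neg (by have := h.le_n; omega), if_neg hn, baseOf_succ hB.nonempty h.le_n hn,
    if_pos hd, h.sSup_eq]
  simp only [h.chain_eq hB hn]

theorem stage_noncrit {k : ℕ} (h : StageInv B (stage B k n) U c n) (hB : IsBaseHierarchy B)
    (hn : n + 1 ∉ B) (hd : ¬baseOf B n ∣ n + 1) : stage B k (n + 1) = stage B k n := by
  rw [stage, if_neg (by have := h.le_n; omega), if_neg hn, baseOf_succ hB.nonempty h.le_n hn,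
    if_neg hd]

theorem stage_base {k : ℕ} (h : StageInv B (stage B k n) U c n) (hB : IsBaseHierarchy B)
    (hn : n + 1 ∈ B) : ∃ a, stage B k (n + 1) = stage B k n ∪ {c * a} ∧ U n < c * a ∧
      c * a ≤ U n + c := by
  have hc : 0 < c := (Nat.zero_le _).trans_lt (h.lt_of_mem c h.mem)
  have hset : {a : ℕ | baseChange B (stage B k n) (baseOf B n) c n < ((c * a : ℕ) : ℕ∞)} =
      {a : ℕ | U n < c * a} := by
    ext a
    rw [Set.mem_ofPred_eq, Set.mem_ofPred_eq, baseChange_coe (h.coe_digits hB), ← h.val]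
    exact Nat.cast_lt
  have hne : {a : ℕ | U n < c * a}.Nonempty :=
    ⟨U n + 1, (Nat.lt_succ_self _).trans_le (Nat.le_mul_of_pos_left _ hc)⟩
  have hst : stage B k (n + 1) = stage B k n ∪ {c * sInf {a : ℕ | U n < c * a}} := by
    rw [stage, if_neg (by have := h.le_n; omega), if_pos hn, h.sSup_eq, hset]
  refine ⟨_, hst, Nat.sInf_mem hne, ?_⟩
  have hmin : ∀ a, U n < c * a → sInf {a : ℕ | U n < c * a} ≤ a := fun a ha => Nat.sInf_le ha
  have hmem : U n < c * sInf {a : ℕ | U n < c * a} := Nat.sInf_mem hne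
  generalize sInf {a : ℕ | U n < c * a} = a at hmin hmem
  cases a with
  | zero => omega
  | succ a =>
    by_contra! hlt
    rw [mul_add, mul_one] at hlt
    have := hmin a (by omega)
    omega

theorem step_noncrit (h : StageInv B S U c n) (hB : IsBaseHierarchy B) (hn : n + 1 ∉ B) :
    ∃ V, StageInv B S V c (n + 1) ∧ ∀ m ≤ n, V m = U m := by
  have hb := baseOf_succ hB.nonempty h.le_n hn
  have hg := h.goodDigits hB le_rfl
  have hlt : U n < natBaseChange U (baseOf B n) c (n + 1) := by
    rw [h.val]
    exact hg.strictMono (Nat.lt_succ_self n)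
  refine ⟨_, h.step hB subset_rfl (fun x hx hx' => absurd hx hx') h.mem h.le h.dvd
    (by rwa [hb]) (by rw [hb]; exact h.base_le.trans hlt.le) (by rw [hb]; exact h.digit_lt)
    (fun x _ h1 h2 => absurd h1 (not_le.2 h2)), fun m hm => Function.update_of_ne (by omega) _ _⟩

theorem step_base (h : StageInv B S U c n) (hB : IsBaseHierarchy B) (hn : n + 1 ∈ B) {a : ℕ}
    (ha : U n < c * a) :
    ∃ V, StageInv B (S ∪ {c * a}) V (c * a) (n + 1) ∧ ∀ m ≤ n, V m = U m := by
  have hb := baseOf_self hn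
  have h2 := hB.two_le_sInf
  have hq := h.le_n
  have hself : ∀ x, natBaseChange U (n + 1) x (n + 1) = x := fun x =>
    natBaseChange_self (by omega) (h.of_lt (by omega)) (h.one hB)
  have hmax : ∀ x ∈ S ∪ {c * a}, x ≤ c * a := by
    rintro x (hx | hx)
    · exact (h.le x hx).trans (h.base_le.trans ha.le)
    · rw [Set.mem_singleton_iff.1 hx]
  refine ⟨_, h.step hB Set.subset_union_left (fun x hx hx' => ?_) (Or.inr rfl) hmax ?_
    (by rwa [hb, hself]) (by rw [hb, hself]) (fun m hm => ?_) (fun x hx h1 h2 => ?_),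
    fun m hm => Function.update_of_ne (by omega) _ _⟩
  · rcases hx with hx | hx
    · exact absurd hx hx'
    · rwa [Set.mem_singleton_iff.1 hx]
  · rintro x (hx | hx) y (hy | hy) hxy
    · exact h.dvd x hx y hy hxy
    · rw [Set.mem_singleton_iff.1 hy]
      exact (h.dvd x hx c h.mem (h.le x hx)).mul_right a
    · rw [Set.mem_singleton_iff.1 hx] at hxy
      have := (h.le y hy).trans h.base_le
      omega
    · rw [Set.mem_singleton_iff.1 hx, Set.mem_singleton_iff.1 hy]
  · rw [hb] at hm
    rcases (Nat.lt_succ_iff.1 hm).eq_or_lt with rfl | hlt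
    · exact ha
    · exact (h.mono m n hlt le_rfl).trans ha
  · rcases hx with hx | hx
    · left
      rw [hb, hself]
      exact (h.le x hx).trans h.base_le
    · exact absurd (Set.mem_singleton_iff.1 hx) h2.ne

/-- The chain is made so that its last term is the base of the next upgrade: for j < k the base
change of n + 1 to d_j is d_{j+1}, which is a base, so d_j is no witness, whereas above d_k there is
no base yet. -/
theorem step_crit (h : StageInv B S U c n) (hB : IsBaseHierarchy B) (hn : n + 1 ∉ B)
    (hd : baseOf B n ∣ n + 1) {k : ℕ} (hk : 1 ≤ k) :
    (∃ V, StageInv B (S ∪ {d | ∃ j, 1 ≤ j ∧ j ≤ k ∧ d = natChain U (baseOf B n) (n + 1) c j}) V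
      (natChain U (baseOf B n) (n + 1) c k) (n + 1) ∧ ∀ m ≤ n, V m = U m) ∧
    ∀ x ∈ {d | ∃ j, 1 ≤ j ∧ j ≤ k ∧ d = natChain U (baseOf B n) (n + 1) c j}, U n < x := by
  have hb := baseOf_succ hB.nonempty h.le_n hn
  have hg : ∀ d, c ≤ d → GoodDigits U (baseOf B n) d := fun d hd => h.goodDigits hB hd
  have h1 := h.one hB
  have hbn : baseOf B n < n + 1 := by
    have := (baseOf_spec hB.nonempty h.le_n).2.1
    omega
  have hsm := natChain_strictMono hg h1 hbn
  have hUn : U n < natChain U (baseOf B n) (n + 1) c 1 := by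
    rw [natChain, natChain, h.val]
    exact (hg c le_rfl).strictMono (Nat.lt_succ_self n)
  have hnew : ∀ x ∈ {d | ∃ j, 1 ≤ j ∧ j ≤ k ∧ d = natChain U (baseOf B n) (n + 1) c j},
      U n < x := by
    rintro x ⟨j, hj1, -, rfl⟩
    exact hUn.trans_le (hsm.monotone hj1)
  have hkk := hsm (Nat.lt_succ_self k)
  have hUk : U n < natChain U (baseOf B n) (n + 1) c k := hUn.trans_le (hsm.monotone hk)
  refine ⟨⟨_, h.step hB Set.subset_union_left (fun x hx hx' => hnew x (hx.resolve_left hx'))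
    (Or.inr ⟨k, hk, le_rfl, rfl⟩) ?_ ?_ ?_ ?_ (fun m hm => ?_) (fun x hx h2 h3 => ?_),
    fun m hm => Function.update_of_ne (by omega) _ _⟩, hnew⟩
  · rintro x (hx | ⟨j, -, hjk, rfl⟩)
    · exact (h.le x hx).trans (h.base_le.trans hUk.le)
    · exact hsm.monotone hjk
  · rintro x (hx | ⟨j, hj1, hjk, rfl⟩) y (hy | ⟨j', hj1', hjk', rfl⟩) hxy
    · exact h.dvd x hx y hy hxy
    · exact (h.dvd x hx c h.mem (h.le x hx)).trans
        (natChain_dvd hg h1 hbn hd (i := 0) (Nat.zero_le j'))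
    · have h4 := hnew _ ⟨j, hj1, hjk, rfl⟩
      have h5 := (h.le y hy).trans h.base_le
      omega
    · exact natChain_dvd hg h1 hbn hd (hsm.le_iff_le.1 hxy)
  · rw [hb]; exact hUk.trans hkk
  · rw [hb]; exact hkk.le
  · rw [hb] at hm
    exact (h.digit_lt m hm).trans_le (hsm.monotone (Nat.zero_le k))
  · right
    have hx' : ∃ j < k, x = natChain U (baseOf B n) (n + 1) c j := by
      rcases hx with hx | ⟨j, -, hjk, rfl⟩
      · exact ⟨0, hk, le_antisymm (h.le x hx) h2⟩
      · exact ⟨j, hsm.lt_iff_lt.1 h3, rfl⟩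
    obtain ⟨j, hj, rfl⟩ := hx'
    refine ⟨natChain U (baseOf B n) (n + 1) c (j + 1), Or.inr ⟨j + 1, by omega, hj, rfl⟩,
      hsm (Nat.lt_succ_self j), ?_⟩
    rw [hb]
    exact le_rfl

theorem step_stage {k : ℕ} (hk : 1 ≤ k) (h : StageInv B (stage B k n) U c n)
    (hB : IsBaseHierarchy B) :
    (∃ V c', StageInv B (stage B k (n + 1)) V c' (n + 1) ∧ ∀ m ≤ n, V m = U m) ∧
      ∀ x ∈ stage B k (n + 1), x ∉ stage B k n → U n < x := by
  by_cases hn : n + 1 ∈ B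
  · obtain ⟨a, hst, ha, -⟩ := h.stage_base hB hn
    obtain ⟨V, hV⟩ := h.step_base hB hn ha
    rw [hst]
    refine ⟨⟨V, _, hV⟩, fun x hx hx' => ?_⟩
    rw [Set.mem_singleton_iff.1 (hx.resolve_left hx')]
    exact ha
  · by_cases hd : baseOf B n ∣ n + 1
    · rw [h.stage_crit hB hn hd]
      obtain ⟨⟨V, hV⟩, hnew⟩ := h.step_crit hB hn hd hk
      exact ⟨⟨V, _, hV⟩, fun x hx hx' => hnew x (hx.resolve_left hx')⟩
    · rw [h.stage_noncrit hB hn hd]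
      obtain ⟨V, hV⟩ := h.step_noncrit hB hn
      exact ⟨⟨V, _, hV⟩, fun x hx hx' => absurd hx hx'⟩

end StageInv

/-- The upgrade relative to stage n is final on arguments up to n, so the upgrades read off at the
various stages glue to one function U. -/
theorem exists_stageInv {B : Set ℕ} (hB : IsBaseHierarchy B) {k : ℕ} (hk : 1 ≤ k) :
    ∃ U : ℕ → ℕ, ∀ n, sInf B ≤ n → StageInv B (stage B k n) U (sSup (stage B k n)) n := by
  have hex : ∀ n, sInf B ≤ n → ∃ U c, StageInv B (stage B k n) U c n := by
    intro n hn
    induction n, hn using Nat.le_induction with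
    | base =>
      rw [stage_of_le le_rfl]
      exact ⟨_, _, stageInv_initial hB⟩
    | succ n hn ih =>
      obtain ⟨U, c, h⟩ := ih
      obtain ⟨⟨V, c', h', -⟩, -⟩ := h.step_stage hk hB
      exact ⟨V, c', h'⟩
  let W : ℕ → ℕ → ℕ := fun n m => (upgrade B (stage B k n) m).toNat
  have hW : ∀ n, sInf B ≤ n → StageInv B (stage B k n) (W n) (sSup (stage B k n)) n := by
    intro n hn
    obtain ⟨U, c, h⟩ := hex n hn
    rw [h.sSup_eq]
    refine h.congr hB fun m hm => ?_
    simp only [W, h.up m hm]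
    rfl
  have hWs : ∀ n, sInf B ≤ n → ∀ m ≤ n, W (n + 1) m = W n m := by
    intro n hn m hm
    obtain ⟨⟨V, c', h', hV⟩, -⟩ := (hW n hn).step_stage hk hB
    rw [← hV m hm]
    simp only [W, h'.up m (by omega)]
    rfl
  have hWmax : ∀ n, ∀ m ≤ n, sInf B ≤ n → W n m = W (max m (sInf B)) m := by
    intro n m hm hq
    have hle : max m (sInf B) ≤ n := max_le hm hq
    induction n, hle using Nat.le_induction with
    | base => rfl
    | succ n hn ih =>
      rw [hWs n ((le_max_right _ _).trans hn) m ((le_max_left _ _).trans hn),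
        ih ((le_max_left _ _).trans hn) ((le_max_right _ _).trans hn)]
  refine ⟨fun m => W (max m (sInf B)) m, fun n hn => (hW n hn).congr hB fun m hm => ?_⟩
  exact (hWmax n m hm hn).symm

/-! ## The ouroboros successor and its upgrade operator -/

/-- `x` and `y` are consecutive elements of `C`. -/
def Consec (C : Set ℕ) (x y : ℕ) : Prop := x ∈ C ∧ y ∈ C ∧ x < y ∧ ∀ z ∈ C, z < y → z ≤ x

theorem Consec.baseOf_eq {C : Set ℕ} {x y z : ℕ} (h : Consec C x y) (hxz : x ≤ z) (hzy : z < y) :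
    baseOf C z = x :=
  Ouroboros.baseOf_eq h.1 hxz fun w hw hwz => h.2.2.2 w hw (hwz.trans_lt hzy)

theorem Consec.sSup_eq {C : Set ℕ} {x y : ℕ} (h : Consec C x y) : sSup {d | d ∈ C ∧ d < y} = x :=
  IsGreatest.csSup_eq ⟨⟨h.1, h.2.2.1⟩, fun z hz => h.2.2.2 z hz.1 hz.2⟩

/-- The properties of the ouroboros successor `C` of `B`, of its upgrade operator `U`, and of the
bases `c n` of the upgrades `U n`. -/
structure Ouro (B C : Set ℕ) (k : ℕ) (U c : ℕ → ℕ) : Prop where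
  hB : IsBaseHierarchy B
  hC : IsBaseHierarchy C
  sInf_eq : sInf C = sInf B + 1
  up : ∀ n, upgrade B C n = (U n : ℕ∞)
  of_lt : ∀ n < sInf B, U n = n
  strictMono : StrictMono U
  c_initial : c (sInf B) = sInf B + 1
  val : ∀ n, sInf B ≤ n → U n = natBaseChange U (baseOf B n) (c n) n
  base_le : ∀ n, sInf B ≤ n → c n ≤ U n
  good : ∀ n, sInf B ≤ n → ∀ d, c n ≤ d → GoodDigits U (baseOf B n) d
  baseOf_eq : ∀ n, sInf B ≤ n → ∀ x, c n ≤ x → x ≤ U n → baseOf C x = c n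
  c_mem : ∀ n, sInf B ≤ n → c n ∈ C
  c_noncrit : ∀ n, sInf B ≤ n → n + 1 ∉ B → ¬baseOf B n ∣ n + 1 → c (n + 1) = c n
  c_base : ∀ n, sInf B ≤ n → n + 1 ∈ B → c (n + 1) = U (n + 1) ∧ c n ∣ c (n + 1) ∧
    U n < c (n + 1) ∧ c (n + 1) ≤ U n + c n ∧ Consec C (c n) (c (n + 1))
  c_crit : ∀ n, sInf B ≤ n → n + 1 ∉ B → baseOf B n ∣ n + 1 →
    c (n + 1) = natChain U (baseOf B n) (n + 1) (c n) k ∧ ∀ j < k,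
      Consec C (natChain U (baseOf B n) (n + 1) (c n) j)
        (natChain U (baseOf B n) (n + 1) (c n) (j + 1))

/-- Elements of C missing from stage n exceed U n. Everything about bases up to U n, including which
of them are consecutive, can therefore be read off at stage n. -/
theorem exists_ouro {B : Set ℕ} (hB : IsBaseHierarchy B) {k : ℕ} (hk : 1 ≤ k) :
    ∃ U c, Ouro B (ouroboros B k) k U c := by
  obtain ⟨U, hU⟩ := exists_stageInv hB hk
  obtain ⟨c, hc⟩ : ∃ c : ℕ → ℕ, c = fun n => sSup (stage B k n) := ⟨_, rfl⟩
  have hI : ∀ n, sInf B ≤ n → StageInv B (stage B k n) U (c n) n := fun n hn => by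
    rw [hc]; exact hU n hn
  have hsub : Monotone (stage B k) := monotone_nat_of_le_succ (stage_subset_succ B k)
  have hsubC : ∀ n, stage B k n ⊆ ouroboros B k := fun n => Set.subset_iUnion _ n
  have h2 := hB.two_le_sInf
  have hmono : StrictMono U := by
    intro m m' hm
    exact (hI (max m' (sInf B)) (le_max_right _ _)).mono m m' hm (le_max_left _ _)
  have hnew : ∀ n, sInf B ≤ n → ∀ x ∈ ouroboros B k, x ∉ stage B k n → U n < x := by
    intro n hn x hx hxn
    obtain ⟨m, hm⟩ := Set.mem_iUnion.1 hx
    have hnm : n ≤ m := by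
      by_contra! hlt
      exact hxn (hsub hlt.le hm)
    induction m, hnm using Nat.le_induction with
    | base => exact absurd hm hxn
    | succ m hnm ih =>
      by_cases hxm : x ∈ stage B k m
      · exact ih hxm
      · exact (hmono.monotone hnm).trans_lt
          (((hI m (hn.trans hnm)).step_stage hk hB).2 x hm hxm)
  have hmemC : ∀ x ∈ ouroboros B k, ∃ n, sInf B ≤ n ∧ x ∈ stage B k n := by
    intro x hx
    obtain ⟨m, hm⟩ := Set.mem_iUnion.1 hx
    exact ⟨max m (sInf B), le_max_right _ _, hsub (le_max_left _ _) hm⟩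
  have hqlt : ∀ x ∈ ouroboros B k, sInf B < x := by
    intro x hx
    obtain ⟨n, hn, hxn⟩ := hmemC x hx
    exact (hI n hn).lt_of_mem x hxn
  have hqmem : sInf B + 1 ∈ ouroboros B k := hsubC (sInf B) (hI _ le_rfl).succ_mem
  have hC : IsBaseHierarchy (ouroboros B k) := by
    refine isBaseHierarchy_of_dvd (fun x hx => by have := hqlt x hx; omega) ⟨_, hqmem⟩ ?_
    intro x hx y hy hxy
    obtain ⟨n, hn, hxn⟩ := hmemC x hx
    obtain ⟨m, hm, hym⟩ := hmemC y hy
    exact (hI (max n m) (hn.trans (le_max_left _ _))).dvd x (hsub (le_max_left _ _) hxn) y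
      (hsub (le_max_right _ _) hym) hxy
  have hUK : ∀ n, ∀ m ≤ n, U m ≤ U n := fun n m hm => hmono.monotone hm
  have hbound : ∀ n, sInf B ≤ n → ∀ x ∈ ouroboros B k, x ≤ U n → x ∈ stage B k n := by
    intro n hn x hx hxU
    by_contra hxn
    exact absurd (hnew n hn x hx hxn) (not_lt.2 hxU)
  refine ⟨U, c, hB, hC, ?_, ?_, ?_, hmono, ?_, fun n hn => (hI n hn).val,
    fun n hn => (hI n hn).base_le, fun n hn d hd => (hI n hn).goodDigits hB hd,
    fun n hn x hx hxU => ?_, fun n hn => hsubC n (hI n hn).mem, ?_, ?_, ?_⟩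
  · exact IsLeast.csInf_eq ⟨hqmem, fun x hx => hqlt x hx⟩
  · intro n
    have hq : sInf B ≤ max n (sInf B) := le_max_right _ _
    exact upgrade_eq_of_subset hB (hsubC (max n (sInf B))) (hI _ hq).up (hUK _)
      (fun x hx => ((hI _ hq).le x hx).trans (hI _ hq).base_le) (hnew _ hq) n (le_max_left _ _)
  · exact fun n hn => (hI _ le_rfl).of_lt hn
  · have := (hI _ le_rfl).mem
    rw [stage_of_le le_rfl] at this
    exact this
  · exact Ouroboros.baseOf_eq (hsubC n (hI n hn).mem) hx fun y hy hyx =>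
      (hI n hn).le y (hbound n hn y hy (hyx.trans hxU))
  · intro n hn hnB hd
    have h1 := hI (n + 1) (hn.trans (Nat.le_succ n))
    rw [(hI n hn).stage_noncrit hB hnB hd] at h1
    rw [← h1.sSup_eq, ← (hI n hn).sSup_eq]
  · intro n hn hnB
    have hn' := hn.trans (Nat.le_succ n)
    have hinv := hI (n + 1) hn'
    obtain ⟨a, hst, ha, ha'⟩ := (hI n hn).stage_base hB hnB
    have hca : c (n + 1) = c n * a := by
      have hmem : c n * a ∈ stage B k (n + 1) := by rw [hst]; exact Or.inr rfl
      have h3 := hinv.mem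
      rw [hst] at h3
      rcases h3 with h3 | h3
      · have h4 := (hI n hn).le _ h3
        have h5 := hinv.le _ hmem
        have h6 := (hI n hn).base_le
        omega
      · exact h3
    have hself : U (n + 1) = c (n + 1) := by
      rw [hinv.val, baseOf_self hnB]
      exact natBaseChange_self (by omega) ((hI _ le_rfl).of_lt (by omega)) ((hI _ le_rfl).one hB)
    refine ⟨hself.symm, hca ▸ dvd_mul_right _ _, hca ▸ ha, hca ▸ ha',
      hsubC n (hI n hn).mem, hsubC _ hinv.mem, ?_, fun z hz hzlt => ?_⟩
    · rw [hca]; exact (hI n hn).base_le.trans_lt ha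
    · have h3 := hbound (n + 1) hn' z hz (by omega)
      rw [hst] at h3
      rcases h3 with h3 | h3
      · exact (hI n hn).le z h3
      · rw [Set.mem_singleton_iff] at h3; omega
  · intro n hn hnB hd
    have hn' := hn.trans (Nat.le_succ n)
    have hinv := hI (n + 1) hn'
    have hst := (hI n hn).stage_crit hB hnB hd
    have hg : ∀ d, c n ≤ d → GoodDigits U (baseOf B n) d := fun d hd => (hI n hn).goodDigits hB hd
    have hbn : baseOf B n < n + 1 := by
      have := (baseOf_spec hB.nonempty hn).2.1
      omega
    have hsm := natChain_strictMono hg ((hI n hn).one hB) hbn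
    have hmem : ∀ j ≤ k, natChain U (baseOf B n) (n + 1) (c n) j ∈ stage B k (n + 1) := by
      intro j hj
      rw [hst]
      by_cases h0 : j = 0
      · subst h0; exact Or.inl (hI n hn).mem
      · exact Or.inr ⟨j, by omega, hj, rfl⟩
    have hform : ∀ z ∈ stage B k (n + 1), z ≤ c n ∨
        ∃ j ≤ k, z = natChain U (baseOf B n) (n + 1) (c n) j := by
      intro z hz
      rw [hst] at hz
      rcases hz with hz | ⟨j, -, hj, rfl⟩
      · exact Or.inl ((hI n hn).le z hz)
      · exact Or.inr ⟨j, hj, rfl⟩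
    have hck : c (n + 1) = natChain U (baseOf B n) (n + 1) (c n) k := by
      refine le_antisymm ?_ (hinv.le _ (hmem k le_rfl))
      rcases hform _ hinv.mem with h3 | ⟨j, hj, h3⟩
      · exact h3.trans (hsm.monotone (Nat.zero_le k))
      · rw [h3]; exact hsm.monotone hj
    refine ⟨hck, fun j hj => ⟨hsubC _ (hmem j hj.le), hsubC _ (hmem (j + 1) hj),
      hsm (Nat.lt_succ_self j), fun z hz hzlt => ?_⟩⟩
    have hzle : z ≤ U (n + 1) := by
      refine hzlt.le.trans ((hsm.monotone hj).trans ?_)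
      rw [← hck]
      exact hinv.base_le
    rcases hform z (hbound (n + 1) hn' z hz hzle) with h3 | ⟨i, -, rfl⟩
    · exact h3.trans (hsm.monotone (Nat.zero_le j))
    · exact hsm.monotone (Nat.lt_succ_iff.1 (hsm.lt_iff_lt.1 hzlt))

end

end Ouroboros

namespace Ouroboros

noncomputable section

/-! ## Unfolding the ordinal interpretation -/

section Coefficients

variable {f : ℕ → Ordinal.{0}} {b : ℕ}

theorem bigO_lt_epsOm (hE : IsEval Om f b (bigO f b)) (m : ℕ) : bigO f b m < epsOm := by
  refine decompInduction hE.two_le (P := fun m => bigO f b m < epsOm) ?_ ?_ m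
  · rw [hE.zero]; exact epsOm_pos
  · intro e a r h0 ha hr ie ir
    rw [hE.decomp e a r h0 ha hr]
    exact nf_lt_epsOm ie (hE.coeff_lt a ha) ir

theorem maxCoeff_bigO_le (hE : IsEval Om f b (bigO f b)) {y : Ordinal.{0}}
    (hy : ∀ a < b, f a ≤ y) (m : ℕ) : maxCoeff (bigO f b m) ≤ y := by
  refine decompInduction hE.two_le (P := fun m => maxCoeff (bigO f b m) ≤ y) ?_ ?_ m
  · rw [hE.zero, maxCoeff_zero]; exact zero_le
  · intro e a r h0 ha hr ie ir
    rw [hE.decomp e a r h0 ha hr, maxCoeff_nf (bigO_lt_epsOm hE e) (hE.coeff_pos h0 ha).ne'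
      (hE.coeff_lt a ha) (hE.lt_opow hr)]
    exact max_le (hy a ha) (max_le ie ir)

/-- Ω² divides O(b²u), so the α of the definition is itself a multiple of Ω. The lemmas on ϑ(Ω·α +
ρ) then apply to the arguments that occur. -/
theorem alphaWith_spec (hE : IsEval Om f b (bigO f b)) (n : ℕ) :
    ∃ α < epsOm, alphaWith f b n = Om * α ∧ bigO f b (b ^ 2 * (n / b ^ 2)) = Om * (Om * α) := by
  obtain ⟨γ, hγ⟩ := hE.dvd (k := 2) (x := b ^ 2 * (n / b ^ 2)) (dvd_mul_right _ _)
  -- O(2) need not be 2: for b = 2 and o_B it is Ω. Only this inequality is needed.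
  have h2 : (2 : Ordinal.{0}) ≤ bigO f b 2 := by exact_mod_cast hE.natCast_le 2
  obtain ⟨δ, hδ⟩ := (opow_dvd_opow Om h2).mul_right γ
  rw [← hγ] at hδ
  have hO : Om ^ (2 : Ordinal.{0}) = Om * Om := by
    have := opow_add_one Om 1
    rwa [one_add_one_eq_two, opow_one] at this
  rw [hO, mul_assoc] at hδ
  refine ⟨δ, ?_, ?_, hδ⟩
  · have h3 := bigO_lt_epsOm hE (b ^ 2 * (n / b ^ 2))
    rw [hδ] at h3
    exact ((Ordinal.le_mul_right _ Om_pos).trans (Ordinal.le_mul_right _ Om_pos)).trans_lt h3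
  · rw [alphaWith, hδ, mul_div_cancel _ Om_pos.ne']

theorem maxCoeff_alphaWith_le (hE : IsEval Om f b (bigO f b)) {y : Ordinal.{0}}
    (hy : ∀ a < b, f a ≤ y) (n : ℕ) : maxCoeff (alphaWith f b n) ≤ y := by
  obtain ⟨α, hα, h1, h2⟩ := alphaWith_spec hE n
  rw [h1]
  refine (maxCoeff_le_maxCoeff_Om_mul (Om_mul_lt_epsOm hα)).trans ?_
  rw [← h2]
  exact maxCoeff_bigO_le hE hy _

theorem alphaWith_congr {g : ℕ → Ordinal.{0}} (h : ∀ a < b, f a = g a) (n : ℕ) :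
    alphaWith f b n = alphaWith g b n := by rw [alphaWith, alphaWith, bigO_congr h]

end Coefficients

theorem tildeV_le (q b n : ℕ) : tildeV q b n ≤ n / b % b := by
  rw [tildeV]
  split_ifs
  · exact Nat.sub_le _ _
  · exact le_rfl

theorem tildeV_lt {b : ℕ} (hb : 0 < b) (q n : ℕ) : tildeV q b n < b :=
  (tildeV_le q b n).trans_lt (Nat.mod_lt _ hb)

theorem zetaWith_congr {f g : ℕ → Ordinal.{0}} {b : ℕ} (hb : 0 < b) (h : ∀ a ≤ b, f a = g a)
    (q n : ℕ) : zetaWith f q b n = zetaWith g q b n := by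
  have h1 := alphaWith_congr (fun a ha => h a (le_of_lt ha)) n
  rw [zetaWith, zetaWith, betaWith, betaWith, h1, h b le_rfl, h _ (tildeV_lt hb q n).le]

section Unfold

variable {B : Set ℕ}

theorem ordInterp_of_lt {n : ℕ} (h : n < sInf B) : ordInterp B n = n := by
  rw [ordInterp]
  simp only [if_pos h]

theorem ordInterp_sInf : ordInterp B (sInf B) = ω := by
  rw [ordInterp]
  simp

theorem ordInterp_base {d n : ℕ} (hB : IsBaseHierarchy B) (h : Consec B d n) :
    ordInterp B n = ordInterp B (n - d) * 2 := by
  have h1 : sInf B ≤ d := Nat.sInf_le h.1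
  have h2 := hB.two_le_sInf
  have h3 := h.2.2.1
  rw [ordInterp]
  simp only [if_neg (show ¬n < sInf B by omega), if_neg (show ¬n = sInf B by omega), if_pos h.2.1,
    h.sSup_eq, dif_pos (show n - d < n by omega)]

theorem ordInterp_add (hB : IsBaseHierarchy B) {b x r : ℕ} (hr : r < b) (hx : b ∣ x)
    (hb : baseOf B (x + r) = b) (hq : sInf B ≤ x) :
    ordInterp B (x + r) = ordInterp B x + ordInterp B r := by
  have h2 := hB.two_le_sInf
  by_cases h0 : r = 0
  · rw [h0, ordInterp_of_lt (n := 0) (by omega), Nat.cast_zero, add_zero, add_zero]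
  · have hnd : ¬b ∣ x + r := fun hd => by
      have := Nat.le_of_dvd (by omega) ((Nat.dvd_add_right hx).1 hd)
      omega
    have hnB : x + r ∉ B := fun hmem => by
      rw [baseOf_self hmem] at hb
      exact hnd (hb ▸ dvd_rfl)
    have h3 : b * ((x + r) / b) = x := by
      obtain ⟨t, rfl⟩ := hx
      rw [Nat.mul_add_div (by omega), Nat.div_eq_of_lt hr, add_zero]
    have h4 : (x + r) % b = r := by
      obtain ⟨t, rfl⟩ := hx
      rw [Nat.mul_add_mod, Nat.mod_eq_of_lt hr]
    rw [ordInterp]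
    simp only [if_neg (show ¬x + r < sInf B by omega), if_neg (show ¬x + r = sInf B by omega),
      if_neg hnB, hb, if_pos hnd, h3, h4, dif_pos (show x < x + r by omega),
      dif_pos (show r < x + r by omega)]

theorem ordInterp_crit (hB : IsBaseHierarchy B) {b n : ℕ} (hb : baseOf B n = b) (hbn : b < n)
    (hd : b ∣ n) (hq : sInf B ≤ b) :
    ordInterp B n = theta (zetaWith (ordInterp B) (sInf B) b n) := by
  have h2 := hB.two_le_sInf
  have hnB : n ∉ B := fun hmem => by
    rw [baseOf_self hmem] at hb
    omega
  rw [ordInterp]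
  simp only [if_neg (show ¬n < sInf B by omega), if_neg (show ¬n = sInf B by omega),
      if_neg hnB, hb, if_neg (not_not.2 hd)]
  rw [zetaWith_congr (by omega) fun a ha => dif_pos (show a < n by omega)]

end Unfold

/-! ## Monotonicity of the ordinal interpretation -/

/-- The last term `ω ^ f(ṽ)` of `zetaWith`. -/
def tailWith (f : ℕ → Ordinal.{0}) (q b n : ℕ) : Ordinal.{0} :=
  if tildeV q b n = 0 then 0 else ω ^ f (tildeV q b n)

theorem zetaWith_eq (f : ℕ → Ordinal.{0}) (q b n : ℕ) : zetaWith f q b n =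
    alphaWith f b n + (minBeta (alphaWith f b n) (f b) + tailWith f q b n) := by
  rw [← add_assoc]
  rfl

theorem Om_le_Om_mul {α : Ordinal.{0}} (h : α ≠ 0) : Om ≤ Om * α :=
  Ordinal.le_mul_left _ (pos_iff_ne_zero.2 h)

/-- For ζ ≥ Ω all countable arguments lie below ζ, so ϑ(ζ) is closed under ϑ on countable ordinals,
and ω^y ≤ ϑ(y). -/
theorem opow_lt_theta {ζ y : Ordinal.{0}} (h : ζ < epsOm) (hΩ : Om ≤ ζ) (hy : y < theta ζ) :
    ω ^ y < theta ζ := by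
  have h1 := hy.trans (theta_lt_Om h)
  refine (opow_le_theta h1).trans_lt (theta_lt_theta h (h1.trans_le hΩ) ?_)
  rwa [maxCoeff_of_lt_Om h1]

/-- Values with a smaller multiple of `Ω` in the argument. -/
theorem theta_lt_of_alpha_lt {α α' ζ p y t : Ordinal.{0}} (hζ : ζ < epsOm) (hα : Om * α ≤ ζ)
    (hlt : α' < α) (hp : p < theta ζ) (hc : maxCoeff (Om * α') ≤ p) (hy : y < theta ζ)
    (ht : t ≤ ω ^ y) : theta (Om * α' + (minBeta (Om * α') p + t)) < theta ζ := by
  have hα0 : α ≠ 0 := (zero_le.trans_lt hlt).ne'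
  have hΩ : Om ≤ ζ := (Om_le_Om_mul hα0).trans hα
  have hα' : α' < epsOm :=
    (hlt.trans_le ((Ordinal.le_mul_right _ Om_pos).trans hα)).trans hζ
  have hpΩ := hp.trans (theta_lt_Om hζ)
  have hβ : minBeta (Om * α') p < theta ζ := (minBeta_le_self hα' hpΩ).trans_lt hp
  have hρ : minBeta (Om * α') p + t < theta ζ :=
    add_lt_theta hζ hβ (ht.trans_lt (opow_lt_theta hζ hΩ hy))
  have hρΩ := hρ.trans (theta_lt_Om hζ)
  refine theta_lt_theta hζ ?_ ?_
  · calc Om * α' + (minBeta (Om * α') p + t) < Om * α' + Om := by gcongr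
      _ = Om * (α' + 1) := by rw [mul_add, mul_one]
      _ ≤ Om * α := by gcongr; exact Order.add_one_le_of_lt hlt
      _ ≤ ζ := hα
  · rw [maxCoeff_Om_mul_add hα' hρΩ]
    exact max_lt (hc.trans_lt hp) hρ

theorem tailWith_le (f : ℕ → Ordinal.{0}) (q b n : ℕ) :
    tailWith f q b n ≤ ω ^ f (tildeV q b n) := by
  rw [tailWith]
  split_ifs
  · exact zero_le
  · exact le_rfl

theorem ordinal_mul_two (x : Ordinal.{0}) : x * 2 = x + x := by
  rw [← one_add_one_eq_two, mul_add, mul_one]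

theorem exists_consec {B : Set ℕ} (hB : IsBaseHierarchy B) {n : ℕ} (hn : n ∈ B)
    (hq : sInf B < n) : ∃ d, Consec B d n ∧ baseOf B (n - 1) = d ∧ d ∣ n ∧ 2 ≤ d := by
  obtain ⟨h1, h2, h3⟩ := baseOf_spec hB.nonempty (show sInf B ≤ n - 1 by omega)
  refine ⟨_, ⟨h1, hn, by omega, fun z hz hzn => h3 z hz (by omega)⟩, rfl,
    hB.dvd_of_le h1 hn (by omega), hB.two_le _ h1⟩

/-- Subtracting b either lowers the digit v, or, if v = 0, borrows from u. -/
theorem digits_sub {b n : ℕ} (hb : 2 ≤ b) (hd : b ∣ n) (hbn : b < n) :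
    (0 < n / b % b ∧ (n - b) / b ^ 2 = n / b ^ 2 ∧ (n - b) / b % b + 1 = n / b % b) ∨
    (n / b % b = 0 ∧ 0 < n / b ^ 2 ∧ (n - b) / b ^ 2 < n / b ^ 2) := by
  obtain ⟨t, rfl⟩ := hd
  have hb0 : 0 < b := by omega
  have ht : 1 < t := by
    by_contra! h
    have : b * t ≤ b * 1 := Nat.mul_le_mul_left _ h
    omega
  have h1 : b * t - b = b * (t - 1) := by rw [Nat.mul_sub, mul_one]
  have h2 : ∀ s, b * s / b ^ 2 = s / b := fun s => by
    rw [pow_two, Nat.mul_div_mul_left _ _ hb0]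
  rw [h1, h2, h2, Nat.mul_div_cancel_left _ hb0, Nat.mul_div_cancel_left _ hb0]
  have h3 := Nat.div_add_mod t b
  have h4 := Nat.mod_lt t hb0
  by_cases hv : t % b = 0
  · right
    refine ⟨hv, ?_, ?_⟩
    · by_contra! h
      have h5 : t / b = 0 := Nat.le_zero.1 h
      rw [h5, hv] at h3
      omega
    · rw [Nat.div_lt_iff_lt_mul hb0, mul_comm (t / b)]
      omega
  · left
    have h5 : t - 1 = b * (t / b) + (t % b - 1) := by omega
    refine ⟨by omega, ?_, ?_⟩
    · rw [h5, Nat.mul_add_div hb0, Nat.div_eq_of_lt (show t % b - 1 < b by omega), add_zero]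
    · rw [h5, Nat.mul_add_mod, Nat.mod_eq_of_lt (show t % b - 1 < b by omega)]
      omega

/-- The shift by 2 starts at v = 2 because for u = 0 the first critical number above b is 2b; it is
dropped at v = min B, where ṽ only jumps upwards. The excluded case n - b = b is the one place where
ṽ would decrease, from 1 to 0. -/
theorem tildeV_sub_lt {q b n : ℕ} (hb : 2 ≤ b) (hd : b ∣ n) (hbn : b < n)
    (hbn' : n - b ≠ b) (h1 : 0 < n / b % b) (h2 : (n - b) / b ^ 2 = n / b ^ 2)
    (h3 : (n - b) / b % b + 1 = n / b % b) : tildeV q b (n - b) < tildeV q b n := by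
  have h4 : n / b ^ 2 = 0 → 3 ≤ n / b % b := by
    intro h0
    have h5 : n / b / b = 0 := by rw [Nat.div_div_eq_div_mul, ← pow_two]; exact h0
    have h6 := Nat.div_add_mod (n / b) b
    rw [h5, mul_zero, zero_add] at h6
    obtain ⟨t, rfl⟩ := hd
    rw [Nat.mul_div_cancel_left _ (by omega)] at h6 ⊢
    rw [h6]
    by_contra! h7
    interval_cases t
    · omega
    · omega
    · omega
  rw [tildeV, tildeV, h2]
  generalize n / b % b = v at *
  generalize (n - b) / b % b = v' at *
  generalize n / b ^ 2 = u at *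
  split_ifs <;> omega

/-- It is enough to compare n - 1 with n. For a critical n outside B, n - 1 = (n - b) + (b - 1), and
o(n) is additively principal and exceeds o(b). The summand o(n - b) is either o(b), or has the same
α and a smaller tail, or has a smaller α. Countability must be carried along, because monotonicity
of O needs coefficients below Ω. -/
theorem ordInterp_aux {B : Set ℕ} (hB : IsBaseHierarchy B) (n : ℕ) :
    (∀ m < n, ordInterp B m < ordInterp B n) ∧ BelowBH (ordInterp B n) := by
  induction n using Nat.strong_induction_on with
  | _ n ih =>
  have h2 := hB.two_le_sInf
  have hzero : ordInterp B 0 = 0 := by rw [ordInterp_of_lt (by omega), Nat.cast_zero]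
  rcases Nat.eq_zero_or_pos n with rfl | hn0
  · exact ⟨fun m hm => absurd hm (Nat.not_lt_zero m), by rw [hzero]; exact belowBH_natCast 0⟩
  have hle : ∀ m ≤ n - 1, ordInterp B m ≤ ordInterp B (n - 1) := fun m hm => by
    rcases hm.eq_or_lt with rfl | hlt
    · exact le_rfl
    · exact ((ih (n - 1) (by omega)).1 m hlt).le
  suffices h : ordInterp B (n - 1) < ordInterp B n ∧ BelowBH (ordInterp B n) from
    ⟨fun m hm => (hle m (by omega)).trans_lt h.1, h.2⟩
  rcases lt_trichotomy n (sInf B) with hnq | hnq | hnq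
  · rw [ordInterp_of_lt hnq, ordInterp_of_lt (by omega)]
    exact ⟨by exact_mod_cast (by omega : n - 1 < n), belowBH_natCast n⟩
  · rw [hnq, ordInterp_sInf, ordInterp_of_lt (by omega)]
    refine ⟨natCast_lt_omega0 _, ?_⟩
    have := (belowBH_natCast 1).omega0_opow
    rwa [Nat.cast_one, opow_one] at this
  by_cases hnB : n ∈ B
  · obtain ⟨d, hd, hbd, hdn, h2d⟩ := exists_consec hB hnB hnq
    have hdlt := hd.2.2.1
    have hnd : d ∣ n - d := Nat.dvd_sub hdn dvd_rfl
    have hdd : d ≤ n - d := Nat.le_of_dvd (by omega) hnd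
    have hqd : sInf B ≤ d := Nat.sInf_le hd.1
    have h3 : n - 1 = n - d + (d - 1) := by omega
    rw [ordInterp_base hB hd, ordinal_mul_two]
    refine ⟨?_, (ih (n - d) (by omega)).2.add (ih (n - d) (by omega)).2⟩
    rw [h3, ordInterp_add hB (by omega) hnd (h3 ▸ hbd) (by omega)]
    exact (add_lt_add_iff_left _).2 ((ih (n - d) (by omega)).1 _ (by omega))
  obtain ⟨hb1, hb2, hb3⟩ := baseOf_spec hB.nonempty hnq.le
  obtain ⟨b, hb⟩ : ∃ b, baseOf B n = b := ⟨_, rfl⟩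
  rw [hb] at hb1 hb2 hb3
  have hbn : b < n := hb2.lt_of_ne fun he => hnB (he ▸ hb1)
  have h2b := hB.two_le b hb1
  have hqb : sInf B ≤ b := Nat.sInf_le hb1
  have hbase : ∀ m, b ≤ m → m ≤ n → baseOf B m = b := fun m h1 h2 =>
    baseOf_eq hb1 h1 fun x hx hxm => hb3 x hx (hxm.trans h2)
  by_cases hd : b ∣ n
  · have hE : IsEval Om (ordInterp B) b (bigO (ordInterp B) b) :=
      isEval_bigO h2b hzero (fun a a' ha ha' => (ih a' (by omega)).1 a ha)
        fun a ha => (ih a (by omega)).2.lt_Om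
    have hab : ∀ a < b, ordInterp B a < ordInterp B b := (ih b hbn).1
    have hbΩ := (ih b hbn).2.lt_Om
    have hc := fun m => maxCoeff_alphaWith_le hE (fun a ha => (hab a ha).le) m
    have hv := tildeV_lt (show 0 < b by omega) (sInf B) n
    obtain ⟨α, hα, hα1, hα2⟩ := alphaWith_spec hE n
    have htail : BelowBH (tailWith (ordInterp B) (sInf B) b n) :=
      ((ih _ (by omega)).2.omega0_opow).mono (tailWith_le _ _ _ _)
    have hβ := minBeta_le_self hα hbΩ
    have hρ : BelowBH (minBeta (Om * α) (ordInterp B b) + tailWith (ordInterp B) (sInf B) b n) :=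
      ((ih b hbn).2.mono hβ).add htail
    rw [ordInterp_crit hB hb hbn hd hqb, zetaWith_eq, hα1]
    have hζ := Om_mul_add_lt_epsOm hα hρ.lt_Om
    have hbth : ordInterp B b < theta (Om * α + (minBeta (Om * α) (ordInterp B b) +
        tailWith (ordInterp B) (sInf B) b n)) :=
      (lt_theta_minBeta hα hbΩ).trans_le (theta_add_le_theta_add hα le_self_add hρ.lt_Om)
    refine ⟨?_, belowBH_theta hζ ?_⟩
    · have hnb : b ∣ n - b := Nat.dvd_sub hd dvd_rfl
      have hbb : b ≤ n - b := Nat.le_of_dvd (by omega) hnb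
      have h3 : n - 1 = n - b + (b - 1) := by omega
      rw [h3, ordInterp_add hB (by omega) hnb (hbase _ (by omega) (by omega)) (by omega)]
      refine add_lt_theta hζ ?_ ((hab _ (by omega)).trans hbth)
      by_cases hbb' : n - b = b
      · rw [hbb']; exact hbth
      obtain ⟨α', hα', hα1', hα2'⟩ := alphaWith_spec hE (n - b)
      rw [ordInterp_crit hB (hbase (n - b) hbb (by omega)) (by omega) hnb hqb, zetaWith_eq, hα1']
      rcases digits_sub h2b hd hbn with ⟨h4, h5, h6⟩ | ⟨h4, h5, h6⟩
      · have hαα : α' = α := by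
          rw [h5, hα2] at hα2'
          exact (mul_right_injective₀ Om_pos.ne' (mul_right_injective₀ Om_pos.ne' hα2')).symm
        rw [hαα]
        refine theta_add_lt_theta_add hα ?_ hρ.lt_Om
        refine (add_lt_add_iff_left _).2 ?_
        have h7 := tildeV_sub_lt (q := sInf B) h2b hd hbn hbb' h4 h5 h6
        rw [tailWith, tailWith, if_neg (show tildeV (sInf B) b n ≠ 0 by omega)]
        split_ifs
        · exact opow_pos _ omega0_pos
        · exact (opow_lt_opow_iff_right one_lt_omega0).2 ((ih _ (by omega)).1 _ h7)
      · have hαα : α' < α := by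
          have h7 := hE.strictMono (Nat.mul_lt_mul_of_pos_left h6 (show 0 < b ^ 2 by positivity))
          rw [hα2, hα2'] at h7
          exact lt_of_mul_lt_mul_left (lt_of_mul_lt_mul_left h7 zero_le) zero_le
        refine theta_lt_of_alpha_lt hζ le_self_add hαα hbth ?_ ?_ (tailWith_le _ _ _ _)
        · rw [← hα1']; exact hc _
        · exact (hab _ (tildeV_lt (by omega) _ _)).trans hbth
    · rw [maxCoeff_Om_mul_add hα hρ.lt_Om]
      rcases max_choice (maxCoeff (Om * α)) (minBeta (Om * α) (ordInterp B b) +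
        tailWith (ordInterp B) (sInf B) b n) with h7 | h7
      · rw [h7, ← hα1]; exact (ih b hbn).2.mono (hc n)
      · rw [h7]; exact hρ
  · have h3 := Nat.div_add_mod n b
    have h4 := Nat.mod_lt n (show 0 < b by omega)
    have h5 : n % b ≠ 0 := fun h => hd (Nat.dvd_of_mod_eq_zero h)
    have hx : b ∣ b * (n / b) := dvd_mul_right _ _
    have hbx : b ≤ b * (n / b) := by
      have := Nat.div_pos hbn.le (show 0 < b by omega)
      exact Nat.le_mul_of_pos_right _ this
    generalize b * (n / b) = x at *
    generalize n % b = r at *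
    have h6 : ordInterp B n = ordInterp B x + ordInterp B r := by
      rw [← h3, ordInterp_add hB h4 hx (h3 ▸ hb) (by omega)]
    have h7 : n - 1 = x + (r - 1) := by omega
    rw [h6, h7, ordInterp_add hB (by omega) hx (hbase _ (by omega) (by omega)) (by omega)]
    exact ⟨(add_lt_add_iff_left _).2 ((ih r (by omega)).1 _ (by omega)),
      (ih x (by omega)).2.add (ih r (by omega)).2⟩

section Consequences

variable {B : Set ℕ}

theorem ordInterp_strictMono (hB : IsBaseHierarchy B) : StrictMono (ordInterp B) :=
  fun m n h => (ordInterp_aux hB n).1 m h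

theorem belowBH_ordInterp (hB : IsBaseHierarchy B) (n : ℕ) : BelowBH (ordInterp B n) :=
  (ordInterp_aux hB n).2

theorem ordInterp_lt_Om (hB : IsBaseHierarchy B) (n : ℕ) : ordInterp B n < Om :=
  (belowBH_ordInterp hB n).lt_Om

theorem ordInterp_zero (hB : IsBaseHierarchy B) : ordInterp B 0 = 0 := by
  rw [ordInterp_of_lt (by have := hB.two_le_sInf; omega), Nat.cast_zero]

theorem isEval_ordInterp (hB : IsBaseHierarchy B) {b : ℕ} (hb : 2 ≤ b) :
    IsEval Om (ordInterp B) b (bigO (ordInterp B) b) :=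
  isEval_bigO hb (ordInterp_zero hB) (fun _ _ h _ => ordInterp_strictMono hB h)
    fun a _ => ordInterp_lt_Om hB a

/-- The structure of `o_B(n)` for critical `n ∉ B`. -/
theorem ordInterp_crit_eq (hB : IsBaseHierarchy B) {b n : ℕ} (hb : baseOf B n = b) (hbn : b < n)
    (hd : b ∣ n) (hq : sInf B ≤ b) : ∃ α < epsOm, alphaWith (ordInterp B) b n = Om * α ∧
      bigO (ordInterp B) b (b ^ 2 * (n / b ^ 2)) = Om * (Om * α) ∧
      maxCoeff (Om * α) ≤ ordInterp B (b - 1) ∧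
      minBeta (Om * α) (ordInterp B b) + tailWith (ordInterp B) (sInf B) b n < Om ∧
      ordInterp B n = theta (Om * α + (minBeta (Om * α) (ordInterp B b) +
        tailWith (ordInterp B) (sInf B) b n)) := by
  have h2b : 2 ≤ b := hB.two_le_sInf.trans hq
  obtain ⟨α, hα, h1, h2⟩ := alphaWith_spec (isEval_ordInterp hB h2b) n
  refine ⟨α, hα, h1, h2, ?_, add_lt_Om ?_ ?_, ?_⟩
  · rw [← h1]
    exact maxCoeff_alphaWith_le (isEval_ordInterp hB h2b)
      (fun a ha => (ordInterp_strictMono hB).monotone (by omega)) n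
  · exact (minBeta_le_self hα (ordInterp_lt_Om hB b)).trans_lt (ordInterp_lt_Om hB b)
  · exact (tailWith_le _ _ _ _).trans_lt (opow_lt_Om omega0_lt_Om (ordInterp_lt_Om hB _))
  · rw [ordInterp_crit hB hb hbn hd hq, zetaWith_eq, h1]

/-- Together with `ordInterp_succ`: o(n) is a limit exactly for positive multiples n of min B. Every
base is such a multiple, so divisibility passes to n mod b. -/
theorem isSuccLimit_ordInterp (hB : IsBaseHierarchy B) {n : ℕ} (h0 : 0 < n) (hd : sInf B ∣ n) :
    IsSuccLimit (ordInterp B n) := by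
  induction n using Nat.strong_induction_on with
  | _ n ih =>
  have h2 := hB.two_le_sInf
  have hqn := Nat.le_of_dvd h0 hd
  rcases hqn.eq_or_lt with hq | hq
  · rw [← hq, ordInterp_sInf]; exact isSuccLimit_omega0
  by_cases hnB : n ∈ B
  · obtain ⟨d, hc, -, hdn, h2d⟩ := exists_consec hB hnB hq
    have hdlt := hc.2.2.1
    rw [ordInterp_base hB hc, ordinal_mul_two]
    exact isSuccLimit_add _ (ih (n - d) (by omega) (by omega)
      (Nat.dvd_sub hd (hB.sInf_dvd hc.1)))
  obtain ⟨hb1, hb2, hb3⟩ := baseOf_spec hB.nonempty hq.le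
  obtain ⟨b, hb⟩ : ∃ b, baseOf B n = b := ⟨_, rfl⟩
  rw [hb] at hb1 hb2 hb3
  have hbn : b < n := hb2.lt_of_ne fun he => hnB (he ▸ hb1)
  have h2b := hB.two_le b hb1
  have hqb : sInf B ≤ b := Nat.sInf_le hb1
  by_cases hdb : b ∣ n
  · obtain ⟨α, hα, -, -, -, h4, h5⟩ := ordInterp_crit_eq hB hb hbn hdb hqb
    have h6 : (1 : Ordinal.{0}) < ordInterp B n := by
      have := (ordInterp_strictMono hB).lt_iff_lt.2 (show 1 < n by omega)
      exact lt_of_le_of_lt (Order.one_le_iff_pos.2 (ordInterp_zero hB ▸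
        ordInterp_strictMono hB one_pos)) this
    rw [h5] at h6 ⊢
    refine isSuccLimit_theta (Om_mul_add_lt_epsOm hα h4) fun h0 => ?_
    rw [h0, theta_zero] at h6
    exact lt_irrefl _ h6
  · have h3 := Nat.div_add_mod n b
    have h4 := Nat.mod_lt n (show 0 < b by omega)
    have h5 : n % b ≠ 0 := fun h => hdb (Nat.dvd_of_mod_eq_zero h)
    have hr : sInf B ∣ n % b := (Nat.dvd_mod_iff (hB.sInf_dvd hb1)).2 hd
    have hbx : b ≤ b * (n / b) := Nat.le_mul_of_pos_right _ (Nat.div_pos hbn.le (by omega))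
    rw [← h3, ordInterp_add hB h4 (dvd_mul_right _ _) (h3.symm ▸ hb) (by omega)]
    exact isSuccLimit_add _ (ih _ (by omega) (by omega) hr)

theorem ordInterp_succ (hB : IsBaseHierarchy B) {n : ℕ} (hd : ¬sInf B ∣ n + 1) :
    ordInterp B (n + 1) = ordInterp B n + 1 := by
  induction n using Nat.strong_induction_on with
  | _ n ih =>
  have h2 := hB.two_le_sInf
  rcases lt_trichotomy (n + 1) (sInf B) with hq | hq | hq
  · rw [ordInterp_of_lt hq, ordInterp_of_lt (by omega), Nat.cast_succ]
  · exact absurd (hq ▸ dvd_rfl) hd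
  have hnB : n + 1 ∉ B := fun h => hd (hB.sInf_dvd h)
  obtain ⟨hb1, hb2, hb3⟩ := baseOf_spec hB.nonempty hq.le
  obtain ⟨b, hb⟩ : ∃ b, baseOf B (n + 1) = b := ⟨_, rfl⟩
  rw [hb] at hb1 hb2 hb3
  have h2b := hB.two_le b hb1
  have hqb : sInf B ≤ b := Nat.sInf_le hb1
  have hdb : ¬b ∣ n + 1 := fun h => hd ((hB.sInf_dvd hb1).trans h)
  have h3 := Nat.div_add_mod (n + 1) b
  have h4 := Nat.mod_lt (n + 1) (show 0 < b by omega)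
  have hr : ¬sInf B ∣ (n + 1) % b := fun h => hd ((Nat.dvd_mod_iff (hB.sInf_dvd hb1)).1 h)
  have hbx : b ≤ b * ((n + 1) / b) := Nat.le_mul_of_pos_right _ (Nat.div_pos hb2 (by omega))
  have hx : b ∣ b * ((n + 1) / b) := dvd_mul_right _ _
  generalize b * ((n + 1) / b) = x at *
  generalize (n + 1) % b = r at *
  cases r with
  | zero => exact absurd (dvd_zero _) hr
  | succ r =>
    have hn : n = x + r := by omega
    have h7 : baseOf B (x + r) = b := baseOf_eq hb1 (by omega) fun y hy hyx => hb3 y hy (by omega)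
    rw [← h3, ordInterp_add hB h4 hx (h3.symm ▸ hb) (by omega), hn,
      ordInterp_add hB (by omega) hx h7 (by omega), ih r (by omega) hr, add_assoc]

/-- The form that `fsTheta_add` requires of the first summand in o(x) + o(r). Multiples k > 1 arise
only at bases, where the value is doubled. -/
theorem exists_ordInterp_eq_opow_mul (hB : IsBaseHierarchy B) {n : ℕ} (hq : sInf B ≤ n)
    (hd : baseOf B n ∣ n) : ∃ θ : Ordinal.{0}, ∃ k : ℕ, 0 < k ∧ ordInterp B n = ω ^ θ * k := by
  induction n using Nat.strong_induction_on with
  | _ n ih =>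
  have h2 := hB.two_le_sInf
  rcases hq.eq_or_lt with hq' | hq'
  · exact ⟨1, 1, one_pos, by rw [← hq', ordInterp_sInf]; simp⟩
  by_cases hnB : n ∈ B
  · obtain ⟨d, hc, hbd, hdn, h2d⟩ := exists_consec hB hnB hq'
    have hdlt := hc.2.2.1
    have hnd : d ∣ n - d := Nat.dvd_sub hdn dvd_rfl
    have hdd : d ≤ n - d := Nat.le_of_dvd (by omega) hnd
    have hqd : sInf B ≤ d := Nat.sInf_le hc.1
    have h7 : baseOf B (n - d) = d :=
      baseOf_eq hc.1 hdd fun y hy hyx => hc.2.2.2 y hy (by omega)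
    obtain ⟨θ, k, hk, he⟩ := ih (n - d) (by omega) (by omega) (by rwa [h7])
    refine ⟨θ, k * 2, by omega, ?_⟩
    rw [ordInterp_base hB hc, he, natCast_mul, mul_assoc]
    rfl
  obtain ⟨hb1, hb2, hb3⟩ := baseOf_spec hB.nonempty hq
  have hbn : baseOf B n < n := hb2.lt_of_ne fun he => hnB (he ▸ hb1)
  obtain ⟨α, hα, -, -, -, h4, h5⟩ := ordInterp_crit_eq hB rfl hbn hd (Nat.sInf_le hb1)
  obtain ⟨θ, hθ⟩ := exists_theta_eq (Om_mul_add_lt_epsOm hα h4)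
  exact ⟨θ, 1, one_pos, by rw [h5, hθ, Nat.cast_one, mul_one]⟩

end Consequences

end

end Ouroboros

/-! ### Digits and interpretations along the chain d_0, d_1, … at a critical number -/

namespace Ouroboros

noncomputable section

/-- The number `ṽ` as a function of `q = min B`, `u` and `v`. -/
def tilde (q u v : ℕ) : ℕ := if u = 0 ∧ 2 ≤ v ∧ v < q then v - 2 else v

theorem tilde_le (q u v : ℕ) : tilde q u v ≤ v := by
  rw [tilde]; split_ifs <;> omega

theorem tilde_congr {u u' : ℕ} (h : u = 0 ↔ u' = 0) (q v : ℕ) : tilde q u v = tilde q u' v := by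
  simp only [tilde, h]

/-- The term `ω ^ f(w)`, omitted if `w = 0`. -/
def tail (f : ℕ → Ordinal.{0}) (w : ℕ) : Ordinal.{0} := if w = 0 then 0 else ω ^ f w

theorem tail_le (f : ℕ → Ordinal.{0}) (w : ℕ) : tail f w ≤ ω ^ f w := by
  rw [tail]
  split_ifs
  · exact zero_le
  · exact le_rfl

theorem tail_lt_tail {f : ℕ → Ordinal.{0}} {w w' : ℕ} (hw : w' ≠ 0) (h : f w < f w') :
    tail f w < tail f w' := by
  rw [tail, tail, if_neg hw]
  split_ifs
  · exact opow_pos _ omega0_pos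
  · exact (opow_lt_opow_iff_right one_lt_omega0).2 h

theorem quotients {d x Y w : ℕ} (hd : 0 < d) (hY : d ^ 2 ∣ Y) (hw : w < d) (hx : x = Y + d * w) :
    d ^ 2 * (x / d ^ 2) = Y ∧ x / d % d = w ∧ (x / d ^ 2 = 0 ↔ Y = 0) := by
  obtain ⟨y, rfl⟩ := hY
  subst hx
  have hdw : d * w < d ^ 2 := by rw [pow_two]; exact Nat.mul_lt_mul_of_pos_left hw hd
  have h1 : (d ^ 2 * y + d * w) / d ^ 2 = y := by
    rw [Nat.mul_add_div (by positivity), Nat.div_eq_of_lt hdw, add_zero]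
  have h2 : (d ^ 2 * y + d * w) / d = d * y + w := by
    rw [show d ^ 2 * y + d * w = d * (d * y + w) by ring, Nat.mul_div_cancel_left _ hd]
  rw [h1, h2]
  refine ⟨rfl, ?_, ?_⟩
  · rw [Nat.mul_add_mod, Nat.mod_eq_of_lt hw]
  · constructor
    · rintro rfl; rw [mul_zero]
    · intro h0
      rcases Nat.mul_eq_zero.1 h0 with h0 | h0
      · exact absurd h0 (by positivity)
      · exact h0

/-- `n` is a critical number with base `b` and is not a base. -/
structure Crit (B : Set ℕ) (n b : ℕ) : Prop where
  base : baseOf B n = b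
  lt : b < n
  dvd : b ∣ n

namespace Crit

variable {B : Set ℕ} {n b : ℕ}

theorem sInf_lt (hc : Crit B n b) : sInf B < n := by
  by_contra! h
  have h1 := hc.base
  have h2 := hc.lt
  rw [baseOf] at h1
  rcases h.eq_or_lt with h | h
  · subst h
    rw [if_pos le_rfl] at h1
    by_cases hB : B.Nonempty
    · have h3 := baseOf_self (Nat.sInf_mem hB)
      rw [baseOf, if_pos le_rfl] at h3
      omega
    · rw [Set.not_nonempty_iff_eq_empty.1 hB] at h2
      simp at h2
  · rw [if_neg (by omega)] at h1
    omega

theorem mem (hc : Crit B n b) (hB : IsBaseHierarchy B) : b ∈ B :=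
  hc.base ▸ (baseOf_spec hB.nonempty hc.sInf_lt.le).1

theorem sInf_le (hc : Crit B n b) (hB : IsBaseHierarchy B) : sInf B ≤ b := Nat.sInf_le (hc.mem hB)

theorem not_mem (hc : Crit B n b) : n ∉ B := fun h => by
  have := hc.base
  have := hc.lt
  rw [baseOf_self h] at *
  omega

theorem baseOf_eq (hc : Crit B n b) (hB : IsBaseHierarchy B) {m : ℕ} (h1 : b ≤ m) (h2 : m ≤ n) :
    baseOf B m = b :=
  Ouroboros.baseOf_eq (hc.mem hB) h1 fun x hx hxm =>
    hc.base ▸ (baseOf_spec hB.nonempty hc.sInf_lt.le).2.2 x hx (hxm.trans h2)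

theorem eq_add (hc : Crit B n b) : n = b ^ 2 * (n / b ^ 2) + b * (n / b % b) := by
  have h1 := Nat.div_add_mod (n / b) b
  rw [Nat.div_div_eq_div_mul, ← pow_two] at h1
  have h2 := Nat.mul_div_cancel' hc.dvd
  conv_lhs => rw [← h2, ← h1]
  ring

theorem pos_or (hc : Crit B n b) : n / b ^ 2 ≠ 0 ∨ 2 ≤ n / b % b := by
  by_contra! h
  have h1 := hc.eq_add
  have h2 := hc.lt
  obtain ⟨h3, h4⟩ := h
  rw [h3, mul_zero, zero_add] at h1
  have : b * (n / b % b) ≤ b * 1 := Nat.mul_le_mul_left _ (by omega)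
  omega

end Crit

theorem ordInterp_theta {C : Set ℕ} (hC : IsBaseHierarchy C) {y d : ℕ} (hd : d ∈ C)
    (hb : baseOf C y = d) (hlt : d < y) (hdvd : d ∣ y) : ordInterp C y =
      theta (alphaWith (ordInterp C) d y + (minBeta (alphaWith (ordInterp C) d y) (ordInterp C d) +
        tail (ordInterp C) (tilde (sInf C) (y / d ^ 2) (y / d % d)))) := by
  rw [ordInterp_crit hC hb hlt hdvd (Nat.sInf_le hd), zetaWith_eq]
  rfl

namespace Ouro

variable {B C : Set ℕ} {k : ℕ} {U c : ℕ → ℕ}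

theorem U_zero (h : Ouro B C k U c) : U 0 = 0 :=
  h.of_lt 0 (by have := h.hB.two_le_sInf; omega)

theorem U_one (h : Ouro B C k U c) : U 1 = 1 :=
  h.of_lt 1 (by have := h.hB.two_le_sInf; omega)

theorem U_sInf (h : Ouro B C k U c) : U (sInf B) = sInf B + 1 := by
  rw [h.val _ le_rfl, h.c_initial, baseOf_self h.hB.sInf_mem,
    natBaseChange_self h.hB.two_le_sInf h.U_zero h.U_one]

theorem c_succ_le (h : Ouro B C k U c) {n : ℕ} (hn : sInf B ≤ n) : c n ≤ c (n + 1) := by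
  by_cases h1 : n + 1 ∈ B
  · exact (h.c_base n hn h1).2.2.2.2.2.2.1.le
  · by_cases h2 : baseOf B n ∣ n + 1
    · rw [(h.c_crit n hn h1 h2).1]
      exact le_natChain (fun d hd => h.good n hn d hd) h.U_one
        (by have := (baseOf_spec h.hB.nonempty hn).2.1; omega) k
    · exact (h.c_noncrit n hn h1 h2).ge

theorem c_mono (h : Ouro B C k U c) {m n : ℕ} (hm : sInf B ≤ m) (hmn : m ≤ n) : c m ≤ c n := by
  induction n, hmn using Nat.le_induction with
  | base => exact le_rfl
  | succ n hmn ih => exact ih.trans (h.c_succ_le (hm.trans hmn))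

theorem U_base (h : Ouro B C k U c) {b : ℕ} (hb : b ∈ B) : U b = c b := by
  have hq : sInf B ≤ b := Nat.sInf_le hb
  rcases hq.eq_or_lt with hq | hq
  · rw [← hq, h.U_sInf, h.c_initial]
  · obtain ⟨m, rfl⟩ : ∃ m, b = m + 1 := ⟨b - 1, by omega⟩
    exact (h.c_base m (by omega) hb).1.symm

/-- The threshold of the shift moves along with the digits: U fixes those below min B and sends the
others to at least min B + 1 = min C. -/
theorem U_tilde (h : Ouro B C k U c) (u v : ℕ) :
    tilde (sInf C) u (U v) = U (tilde (sInf B) u v) := by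
  have h2 := h.hB.two_le_sInf
  rw [tilde, tilde, h.sInf_eq]
  rcases lt_or_ge v (sInf B) with hv | hv
  · rw [h.of_lt v hv]
    by_cases h1 : u = 0 ∧ 2 ≤ v ∧ v < sInf B
    · rw [if_pos h1, if_pos ⟨h1.1, h1.2.1, by omega⟩, h.of_lt _ (by omega)]
    · rw [if_neg h1, if_neg fun hh => h1 ⟨hh.1, hh.2.1, hv⟩, h.of_lt v hv]
  · have h3 : sInf B + 1 ≤ U v := h.U_sInf ▸ h.strictMono.monotone hv
    rw [if_neg (by omega), if_neg (by omega)]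

theorem c_noncrit_add (h : Ouro B C k U c) {b x r : ℕ} (hb : baseOf B (x + r) = b) (hx : b ∣ x)
    (hr : r < b) (hq : sInf B ≤ x) (hbx : b ≤ x) : baseOf B x = b ∧ c (x + r) = c x := by
  induction r with
  | zero => exact ⟨hb, rfl⟩
  | succ r ih =>
    obtain ⟨hb1, hb2, hb3⟩ := baseOf_spec h.hB.nonempty (show sInf B ≤ x + (r + 1) by omega)
    rw [hb] at hb1 hb2 hb3
    have hnd : ¬b ∣ x + r + 1 := fun hd => by
      have := Nat.le_of_dvd (by omega) ((Nat.dvd_add_right hx).1 (add_assoc x r 1 ▸ hd))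
      omega
    have hb' : baseOf B (x + r) = b :=
      Ouroboros.baseOf_eq hb1 (by omega) fun y hy hyx => hb3 y hy (by omega)
    have hnB : x + r + 1 ∉ B := fun hmem => by
      have := hb3 _ hmem le_rfl
      omega
    obtain ⟨h1, h2⟩ := ih hb' (by omega)
    refine ⟨h1, ?_⟩
    rw [← add_assoc, h.c_noncrit (x + r) (by omega) hnB (by rwa [hb']), h2]

/-- The upgrade of a number that is not critical. -/
theorem U_add (h : Ouro B C k U c) {b x r : ℕ} (hb : baseOf B (x + r) = b) (hx : b ∣ x)
    (hr : r < b) (hq : sInf B ≤ x) (hbx : b ≤ x) : U (x + r) = U x + U r ∧ c x ∣ U x ∧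
      U r < c x ∧ baseOf C (U x + U r) = c x := by
  obtain ⟨h1, h2⟩ := h.c_noncrit_add hb hx hr hq hbx
  have hg := h.good x hq (c x) le_rfl
  rw [h1] at hg
  have h3 := h.val (x + r) (by omega)
  have h4 := h.val x hq
  rw [hb, h2, hg.map_add (k := 1) (by simpa using hx) (by simpa using hr), hg.of_lt hr] at h3
  rw [h1] at h4
  rw [← h4] at h3
  refine ⟨h3, ?_, hg.lt r hr, ?_⟩
  · have := hg.dvd_map (k := 1) (by simpa using hx)
    rw [h4]
    simpa using this
  · rw [← h3, ← h2]
    exact h.baseOf_eq _ (by omega) _ (h.base_le _ (by omega)) le_rfl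

theorem baseOf_pred (h : Ouro B C k U c) {n b : ℕ} (hc : Crit B n b) : baseOf B (n - 1) = b :=
  hc.baseOf_eq h.hB (by have := hc.lt; omega) (Nat.sub_le _ _)

theorem sInf_le_pred {n b : ℕ} (hc : Crit B n b) : sInf B ≤ n - 1 := by
  have := hc.sInf_lt
  omega

/-- The bases `d_0, d_1, …` that are added at the critical number `n` (with base `b`). -/
def base (U c : ℕ → ℕ) (b n j : ℕ) : ℕ := natChain U b n (c (n - 1)) j

theorem good_base (h : Ouro B C k U c) {n b : ℕ} (hc : Crit B n b) (j : ℕ) :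
    GoodDigits U b (base U c b n j) := by
  have hg : ∀ d, c (n - 1) ≤ d → GoodDigits U b d := fun d hd => by
    have := h.good (n - 1) (sInf_le_pred hc) d hd
    rwa [h.baseOf_pred hc] at this
  exact hg _ (le_natChain hg h.U_one hc.lt j)

theorem base_succ (n b j : ℕ) :
    base U c b n (j + 1) = natBaseChange U b (base U c b n j) n := rfl

theorem base_lt_succ (h : Ouro B C k U c) {n b : ℕ} (hc : Crit B n b) (j : ℕ) :
    base U c b n j < base U c b n (j + 1) :=
  (h.good_base hc j).lt_map h.U_one hc.lt

theorem c_eq_base (h : Ouro B C k U c) {n b : ℕ} (hc : Crit B n b) : c n = base U c b n k ∧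
    ∀ j < k, Consec C (base U c b n j) (base U c b n (j + 1)) := by
  have h1 : n - 1 + 1 = n := by have := hc.lt; omega
  have h2 := h.c_crit (n - 1) (sInf_le_pred hc)
  rw [h1, h.baseOf_pred hc] at h2
  exact h2 hc.not_mem hc.dvd

theorem U_eq_base (h : Ouro B C k U c) {n b : ℕ} (hc : Crit B n b) :
    U n = base U c b n (k + 1) := by
  rw [h.val n hc.sInf_lt.le, hc.base, (h.c_eq_base hc).1, base_succ]

theorem base_mem (h : Ouro B C k U c) {n b j : ℕ} (hc : Crit B n b) (hj : j ≤ k) :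
    base U c b n j ∈ C := by
  rcases hj.eq_or_lt with rfl | hj
  · rw [← (h.c_eq_base hc).1]
    exact h.c_mem n hc.sInf_lt.le
  · exact ((h.c_eq_base hc).2 j hj).1

theorem baseOf_base (h : Ouro B C k U c) {n b j x : ℕ} (hc : Crit B n b) (hj : j ≤ k)
    (h1 : base U c b n j ≤ x) (h2 : x < base U c b n (j + 1)) : baseOf C x = base U c b n j := by
  rcases hj.eq_or_lt with rfl | hj
  · rw [← h.U_eq_base hc] at h2
    rw [← (h.c_eq_base hc).1] at h1 ⊢
    exact h.baseOf_eq n hc.sInf_lt.le x h1 h2.le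
  · exact ((h.c_eq_base hc).2 j hj).baseOf_eq h1 h2

/-- Base change acts digit by digit, so in base d_j the number d_{j+1} has the upgraded digits of n:
a part divisible by d_j², which vanishes only with u, and the coefficient U v of d_j. -/
theorem base_digits (h : Ouro B C k U c) {n b : ℕ} (hc : Crit B n b) (j : ℕ) :
    base U c b n (j + 1) = natBaseChange U b (base U c b n j) (b ^ 2 * (n / b ^ 2)) +
      base U c b n j * U (n / b % b) ∧
    base U c b n j ^ 2 ∣ natBaseChange U b (base U c b n j) (b ^ 2 * (n / b ^ 2)) ∧
    U (n / b % b) < base U c b n j ∧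
    (natBaseChange U b (base U c b n j) (b ^ 2 * (n / b ^ 2)) = 0 ↔ n / b ^ 2 = 0) := by
  have hg := h.good_base hc j
  have hb := hg.two_le
  have hv : n / b % b < b := Nat.mod_lt _ (by omega)
  have h1 : b * (n / b % b) < b ^ 2 := by
    rw [pow_two]; exact Nat.mul_lt_mul_of_pos_left hv (by omega)
  refine ⟨?_, hg.dvd_map (dvd_mul_right _ _), hg.lt _ hv, ?_⟩
  · rw [base_succ, congrArg (natBaseChange U b (base U c b n j)) hc.eq_add,
      hg.map_add (dvd_mul_right _ _) h1, hg.map_mul_base h.U_one hv]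
  · constructor
    · intro h0
      have h2 := hg.le_map (b ^ 2 * (n / b ^ 2))
      rw [h0] at h2
      rcases Nat.mul_eq_zero.1 (Nat.le_zero.1 h2) with h3 | h3
      · exact absurd h3 (by positivity)
      · exact h3
    · intro h0
      rw [h0, mul_zero, hg.map_zero]

theorem base_dvd_succ (h : Ouro B C k U c) {n b : ℕ} (hc : Crit B n b) (j : ℕ) :
    base U c b n j ∣ base U c b n (j + 1) := by
  obtain ⟨h1, h2, -, -⟩ := h.base_digits hc j
  rw [h1]
  exact dvd_add ((dvd_pow_self _ two_ne_zero).trans h2) (dvd_mul_right _ _)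

/-- The difference of two consecutive new bases. -/
theorem base_sub (h : Ouro B C k U c) {n b j : ℕ} (hc : Crit B n b) (hj : j ≤ k) :
    base U c b n j ≤ base U c b n (j + 1) - base U c b n j ∧
    base U c b n j ∣ base U c b n (j + 1) - base U c b n j ∧
    baseOf C (base U c b n (j + 1) - base U c b n j) = base U c b n j := by
  have h1 := h.base_lt_succ hc j
  have h2 := (h.good_base hc j).two_le'
  have h3 := Nat.dvd_sub (h.base_dvd_succ hc j) dvd_rfl
  have h4 := Nat.le_of_dvd (by omega) h3
  exact ⟨h4, h3, h.baseOf_base hc hj h4 (by omega)⟩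

/-- Separates off n = 2b, where the difference of two links is a base and not a proper critical
number. The bound 3 ≤ min B ensures U 2 = 2. -/
theorem base_sub_eq (h : Ouro B C k U c) {n b : ℕ} (hq : 3 ≤ sInf B) (hc : Crit B n b) (j : ℕ) :
    base U c b n (j + 1) - base U c b n j = base U c b n j ↔ n / b ^ 2 = 0 ∧ n / b % b = 2 := by
  obtain ⟨h1, ⟨t, h2⟩, h3, h4⟩ := h.base_digits hc j
  have hd := h.base_lt_succ hc j
  have hU2 := h.of_lt 2 (by omega)
  have h5 := (h.good_base hc j).two_le'
  constructor
  · intro he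
    have ht : t = 0 := by
      by_contra ht
      have h6 : base U c b n j ^ 2 * 1 ≤ base U c b n j ^ 2 * t :=
        Nat.mul_le_mul_left _ (Nat.one_le_iff_ne_zero.2 ht)
      have h7 : 3 ≤ base U c b n j := by
        have h8 := (h.good_base hc j).lt 2
          (by have := hc.sInf_le h.hB; omega)
        omega
      have h8 : 3 * base U c b n j ≤ base U c b n j ^ 2 := by
        rw [pow_two]; exact Nat.mul_le_mul_right _ h7
      omega
    rw [ht, mul_zero] at h2
    refine ⟨h4.1 h2, h.strictMono.injective ?_⟩
    rw [hU2]
    rw [h2, zero_add] at h1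
    have h6 : base U c b n j * U (n / b % b) = base U c b n j * 2 := by omega
    exact Nat.eq_of_mul_eq_mul_left (by omega) h6
  · rintro ⟨h6, h7⟩
    rw [h4.2 h6, h7, hU2] at h1
    omega

theorem ordInterp_base_succ (h : Ouro B C k U c) {n b j : ℕ} (hc : Crit B n b) (hj : j < k) :
    ordInterp C (base U c b n (j + 1)) =
      ordInterp C (base U c b n (j + 1) - base U c b n j) * 2 :=
  ordInterp_base h.hC ((h.c_eq_base hc).2 j hj)

/-- Base change preserves O, so all links have the α of n. The free digit w serves both d_{j+1},
with w = U v, and d_{j+1} - d_j, with w = U v - 1. Preservation is assumed only below b, so the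
lemma is available inside the induction for `ordInterp_U`. -/
theorem alphaWith_base (h : Ouro B C k U c) {n b : ℕ} (hc : Crit B n b)
    (hU : ∀ m < b, ordInterp C (U m) = ordInterp B m) {j x w : ℕ}
    (hx : x = natBaseChange U b (base U c b n j) (b ^ 2 * (n / b ^ 2)) + base U c b n j * w)
    (hw : w < base U c b n j) :
    alphaWith (ordInterp C) (base U c b n j) x = alphaWith (ordInterp B) b n ∧
      (x / base U c b n j ^ 2 = 0 ↔ n / b ^ 2 = 0) ∧
      x / base U c b n j % base U c b n j = w := by
  obtain ⟨-, h2, -, h4⟩ := h.base_digits hc j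
  have hg := h.good_base hc j
  have h5 := hg.two_le'
  obtain ⟨h6, h7, h8⟩ := quotients (by omega) h2 hw hx
  refine ⟨?_, h8.trans h4, h7⟩
  rw [alphaWith, alphaWith, h6, bigO_natBaseChange hg (isEval_ordInterp h.hB hg.two_le)
    (isEval_ordInterp h.hC hg.two_le') hU]

theorem ordInterp_base_sub (h : Ouro B C k U c) (hq : 3 ≤ sInf B) {n b j : ℕ} (hc : Crit B n b)
    (hU : ∀ m < b, ordInterp C (U m) = ordInterp B m) (hj : j ≤ k) (hv : 0 < n / b % b)
    (huv : ¬(n / b ^ 2 = 0 ∧ n / b % b = 2)) :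
    ordInterp C (base U c b n (j + 1) - base U c b n j) =
      theta (alphaWith (ordInterp B) b n + (minBeta (alphaWith (ordInterp B) b n)
        (ordInterp C (base U c b n j)) +
        tail (ordInterp C) (tilde (sInf C) (n / b ^ 2) (U (n / b % b) - 1)))) := by
  obtain ⟨h1, h2, h3⟩ := h.base_sub hc hj
  obtain ⟨h4, -, h5, -⟩ := h.base_digits hc j
  have h6 : 0 < U (n / b % b) := by
    have := h.strictMono hv
    omega
  have h7 : base U c b n (j + 1) - base U c b n j =
      natBaseChange U b (base U c b n j) (b ^ 2 * (n / b ^ 2)) +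
        base U c b n j * (U (n / b % b) - 1) := by
    rw [h4, Nat.mul_sub, mul_one, Nat.add_sub_assoc (Nat.le_mul_of_pos_right _ h6)]
  obtain ⟨h8, h9, h10⟩ := h.alphaWith_base hc hU h7 (by omega)
  rw [ordInterp_theta h.hC (h.base_mem hc hj) h3
    (h1.lt_of_ne fun he => huv ((h.base_sub_eq hq hc j).1 he.symm)) h2, h8, tilde_congr h9, h10]

/-- Compared with o_B(n), both α and the tail are the same; only the lower bound defining β has
changed, from o_B(b) to o_C(d_k). -/
theorem ordInterp_U_crit (h : Ouro B C k U c) {n b : ℕ} (hc : Crit B n b)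
    (hU : ∀ m < b, ordInterp C (U m) = ordInterp B m) : ordInterp C (U n) =
      theta (alphaWith (ordInterp B) b n + (minBeta (alphaWith (ordInterp B) b n)
        (ordInterp C (base U c b n k)) +
        tail (ordInterp B) (tilde (sInf B) (n / b ^ 2) (n / b % b)))) := by
  obtain ⟨h4, -, h5, -⟩ := h.base_digits hc k
  obtain ⟨h8, h9, h10⟩ := h.alphaWith_base hc hU h4 h5
  have h11 := h.base_lt_succ hc k
  have hb : 0 < b := by have := (h.good_base hc k).two_le; omega
  have h12 : baseOf C (base U c b n (k + 1)) = base U c b n k := by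
    rw [← h.U_eq_base hc, ← (h.c_eq_base hc).1]
    exact h.baseOf_eq _ hc.sInf_lt.le _ (h.base_le _ hc.sInf_lt.le) le_rfl
  rw [h.U_eq_base hc, ordInterp_theta h.hC (h.base_mem hc le_rfl) h12 h11 (h.base_dvd_succ hc k),
    h8, tilde_congr h9, h10, h.U_tilde]
  have h13 : tail (ordInterp C) (U (tilde (sInf B) (n / b ^ 2) (n / b % b))) =
      tail (ordInterp B) (tilde (sInf B) (n / b ^ 2) (n / b % b)) := by
    have h14 : U (tilde (sInf B) (n / b ^ 2) (n / b % b)) = 0 ↔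
        tilde (sInf B) (n / b ^ 2) (n / b % b) = 0 := by
      rw [← h.strictMono.injective.eq_iff (a := tilde _ _ _) (b := 0), h.U_zero]
    rw [tail, tail]
    simp only [h14]
    rw [hU _ ((tilde_le _ _ _).trans_lt (Nat.mod_lt _ hb))]
  rw [h13]

end Ouro

end

end Ouroboros

/-! ### Preservation of the interpretation under upgrading -/

namespace Ouroboros

noncomputable section

/-- An additively principal `T` absorbs the difference of two values of `minBeta`. -/
theorem minBeta_add_tail {α p p' η T : Ordinal.{0}} (hα : α < epsOm) (hp : p ≤ p') (hp' : p' < Om)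
    (hT : IsPrincipal (· + ·) T) (hη : η < T)
    (h : p' < theta (Om * α + (minBeta (Om * α) p + η))) :
    minBeta (Om * α) p' + T = minBeta (Om * α) p + T := by
  have h1 := minBeta_mono hα hp hp'
  have h2 := minBeta_le h
  obtain ⟨ε, hε⟩ := exists_add_of_le h1
  rw [hε] at h2 ⊢
  have h3 : ε ≤ η := (add_le_add_iff_left _).1 h2
  rw [add_assoc, isPrincipal_add_iff_add_left_eq_self.1 hT _ (h3.trans_lt hη)]

theorem tilde_pos_cases {n b : ℕ} {B : Set ℕ} (hc : Crit B n b)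
    (h0 : tilde (sInf B) (n / b ^ 2) (n / b % b) = 0) (hq : 3 ≤ sInf B) :
    (n / b % b = 0 ∧ n / b ^ 2 ≠ 0) ∨ (n / b ^ 2 = 0 ∧ n / b % b = 2) := by
  have := hc.pos_or
  rw [tilde] at h0
  split_ifs at h0 with h1
  · right; omega
  · left
    exact ⟨h0, by omega⟩

namespace Ouro

variable {B C : Set ℕ} {k : ℕ} {U c : ℕ → ℕ}

/-- The last digits decrease. -/
theorem tilde_pred_lt (h : Ouro B C k U c) {u v : ℕ} (h0 : tilde (sInf B) u v ≠ 0) :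
    tilde (sInf C) u (U v - 1) < U (tilde (sInf B) u v) := by
  have h1 : 0 < v := by
    by_contra! hv
    have := tilde_le (sInf B) u v
    omega
  have h2 := h.strictMono h1
  rw [tilde] at h0 ⊢
  rw [tilde]
  rw [h.sInf_eq]
  by_cases h3 : u = 0 ∧ 2 ≤ v ∧ v < sInf B
  · rw [if_pos h3] at h0 ⊢
    rw [h.of_lt v h3.2.2, h.of_lt (v - 2) (by omega)]
    split_ifs <;> omega
  · rw [if_neg h3]
    split_ifs <;> omega

theorem ordInterp_base_zero_le (h : Ouro B C k U c) {n b : ℕ} (hc : Crit B n b)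
    (hU : ∀ m < n, ordInterp C (U m) = ordInterp B m) :
    ordInterp B b ≤ ordInterp C (base U c b n 0) ∧
      ordInterp C (base U c b n 0) ≤ ordInterp B (n - 1) := by
  have hlt := hc.lt
  have hq := hc.sInf_le h.hB
  have hm := (ordInterp_strictMono h.hC).monotone
  constructor
  · rw [← hU b hlt, h.U_base (hc.mem h.hB)]
    exact hm (h.c_mono hq (by omega))
  · rw [← hU (n - 1) (by omega)]
    exact hm (h.base_le _ (by omega))

/-- All new bases at `n` have values below `o(n)`, with some room if `ṽ > 0`. -/
theorem ordInterp_base_lt (h : Ouro B C k U c) (hq : 3 ≤ sInf B) {n b : ℕ} (hc : Crit B n b)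
    (hU : ∀ m < n, ordInterp C (U m) = ordInterp B m)
    (h0 : tilde (sInf B) (n / b ^ 2) (n / b % b) = 0) {j : ℕ} (hj : j ≤ k) :
    ordInterp C (base U c b n j) < ordInterp B n := by
  have hlt := hc.lt
  have hUb : ∀ m < b, ordInterp C (U m) = ordInterp B m := fun m hm => hU m (by omega)
  induction j with
  | zero =>
    exact (h.ordInterp_base_zero_le hc hU).2.trans_lt (ordInterp_strictMono h.hB (by omega))
  | succ j ih =>
    have ih := ih (by omega)
    obtain ⟨α, hα, hα1, hα2, hα3, hα4, hα5⟩ :=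
      ordInterp_crit_eq h.hB hc.base hlt hc.dvd (hc.sInf_le h.hB)
    rw [h.ordInterp_base_succ hc hj, ordinal_mul_two]
    suffices hs : ordInterp C (base U c b n (j + 1) - base U c b n j) < ordInterp B n by
      rw [hα5] at hs ⊢
      exact add_lt_theta (Om_mul_add_lt_epsOm hα hα4) hs hs
    -- If v = 0, the difference d_{j+1} - d_j comes from borrowing and has a smaller α. If n = 2b,
    -- the difference is d_j, and the induction hypothesis applies directly.
    rcases tilde_pos_cases hc h0 hq with ⟨hv, hu⟩ | huv
    · obtain ⟨h1, h2, h3⟩ := h.base_sub hc (j := j) (by omega)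
      obtain ⟨h4, h5, h6, h7⟩ := h.base_digits hc j
      have hd2 := (h.good_base hc j).two_le'
      rw [hv, h.U_zero, mul_zero, add_zero] at h4
      have hne : base U c b n (j + 1) - base U c b n j ≠ base U c b n j := fun he => by
        have := (h.base_sub_eq hq hc j).1 he
        exact hu this.1
      obtain ⟨α', hα', hα1', hα2', hα3', hα4', hα5'⟩ :=
        ordInterp_crit_eq h.hC h3 (h1.lt_of_ne hne.symm) h2
          (Nat.sInf_le (h.base_mem hc (by omega)))
      have h9 : base U c b n (j + 1) / base U c b n j % base U c b n j = 0 := by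
        have := (h.alphaWith_base hc hUb (x := base U c b n (j + 1)) (w := 0) (j := j)
          (by rw [h4, mul_zero, add_zero]) (by omega)).2.2
        exact this
      have h10 := (h.alphaWith_base hc hUb (x := base U c b n (j + 1)) (w := 0) (j := j)
          (by rw [h4, mul_zero, add_zero]) (by omega)).1
      have hE := isEval_ordInterp h.hC hd2
      have h12 : α' < α := by
        rcases digits_sub hd2 (h.base_dvd_succ hc j) (h.base_lt_succ hc j) with
          ⟨h11, -⟩ | ⟨-, -, h11⟩
        · omega
        · obtain ⟨α'', hα'', hα1'', hα2''⟩ := alphaWith_spec hE (base U c b n (j + 1))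
          have h13 := hE.strictMono (Nat.mul_lt_mul_of_pos_left h11
            (show 0 < base U c b n j ^ 2 by positivity))
          rw [hα2', hα2''] at h13
          have h14 : Om * α'' = Om * α := by rw [← hα1'', h10, hα1]
          rw [h14] at h13
          exact lt_of_mul_lt_mul_left (lt_of_mul_lt_mul_left h13 zero_le) zero_le
      rw [hα5']
      rw [hα5] at ih ⊢
      have hmono := (ordInterp_strictMono h.hC).monotone
      refine theta_lt_of_alpha_lt (Om_mul_add_lt_epsOm hα hα4) le_self_add h12 ih ?_ ?_
        (tailWith_le _ _ _ _)
      · exact hα3'.trans (hmono (Nat.sub_le _ _))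
      · exact (hmono (tildeV_lt (by omega) _ _).le).trans_lt ih
    · rw [(h.base_sub_eq hq hc j).2 huv]
      exact ih

/-- Each link doubles o_C(d_{j+1} - d_j), whose argument consists of α, the current minimal β and a
tail t below T = ω^{o(ṽ)}. So η has to grow only by t + 1 per link, and finitely many such
increments stay below T, which is additively principal. -/
theorem ordInterp_base_lt_of_tilde (h : Ouro B C k U c) (hq : 3 ≤ sInf B) {n b : ℕ}
    (hc : Crit B n b) (hU : ∀ m < n, ordInterp C (U m) = ordInterp B m)
    (h0 : tilde (sInf B) (n / b ^ 2) (n / b % b) ≠ 0) {j : ℕ} (hj : j ≤ k) :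
    ∃ η < tail (ordInterp B) (tilde (sInf B) (n / b ^ 2) (n / b % b)),
      ordInterp C (base U c b n j) < theta (alphaWith (ordInterp B) b n +
        (minBeta (alphaWith (ordInterp B) b n) (ordInterp B b) + η)) := by
  have hlt := hc.lt
  have hUb : ∀ m < b, ordInterp C (U m) = ordInterp B m := fun m hm => hU m (by omega)
  have hb2 := (h.good_base hc 0).two_le
  have hvb : n / b % b < b := Nat.mod_lt _ (by omega)
  have hv : 0 < n / b % b := by
    by_contra! hv
    have := tilde_le (sInf B) (n / b ^ 2) (n / b % b)
    omega
  have huv : ¬(n / b ^ 2 = 0 ∧ n / b % b = 2) := by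
    rintro ⟨h1, h2⟩
    rw [h1, h2, tilde, if_pos (by omega)] at h0
    omega
  obtain ⟨α, hα, hα1, hα2, hα3, hα4, hα5⟩ :=
    ordInterp_crit_eq h.hB hc.base hlt hc.dvd (hc.sInf_le h.hB)
  have hbs := fun j hj => h.ordInterp_base_sub (j := j) hq hc hUb hj hv huv
  have htl := h.tilde_pred_lt h0
  rw [hα1] at hbs ⊢
  have hmB := ordInterp_strictMono h.hB
  have hmC := ordInterp_strictMono h.hC
  obtain ⟨w, hw⟩ : ∃ w, w = tilde (sInf B) (n / b ^ 2) (n / b % b) := ⟨_, rfl⟩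
  have hwb : w < b := hw ▸ (tilde_le _ _ _).trans_lt hvb
  rw [← hw] at h0 htl ⊢
  have hTpos : (1 : Ordinal.{0}) < tail (ordInterp B) w := by
    rw [tail, if_neg h0]
    exact one_lt_opow.2 ⟨one_lt_omega0,
      (zero_le.trans_lt (hmB (Nat.pos_of_ne_zero h0))).ne'⟩
  have hTprin : IsPrincipal (· + ·) (tail (ordInterp B) w) := by
    rw [tail, if_neg h0]; exact isPrincipal_add_omega0_opow _
  have hTΩ : tail (ordInterp B) w < Om :=
    (tail_le _ _).trans_lt (opow_lt_Om omega0_lt_Om (ordInterp_lt_Om h.hB _))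
  have hβ := minBeta_le_self hα (ordInterp_lt_Om h.hB b)
  have hβΩ := hβ.trans_lt (ordInterp_lt_Om h.hB b)
  induction j with
  | zero =>
    have hnb : b ∣ n - b := Nat.dvd_sub hc.dvd dvd_rfl
    have hbb : b ≤ n - b := Nat.le_of_dvd (by omega) hnb
    have hne : n - b ≠ b := fun he => by
      have h1 := hc.eq_add
      have h2 := hc.pos_or
      have h3 : n / b = 2 := by
        rw [show n = b * 2 by omega, Nat.mul_div_cancel_left _ (by omega)]
      have h4 : n / b ^ 2 = 0 := by
        rw [pow_two, ← Nat.div_div_eq_div_mul, h3]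
        exact Nat.div_eq_of_lt (by have := hc.sInf_le h.hB; omega)
      refine huv ⟨h4, ?_⟩
      rw [h3, Nat.mod_eq_of_lt (by have := hc.sInf_le h.hB; omega)]
    have hbase : baseOf B (n - b) = b := hc.baseOf_eq h.hB hbb (Nat.sub_le _ _)
    have hdig : (n - b) / b ^ 2 = n / b ^ 2 ∧ (n - b) / b % b + 1 = n / b % b := by
      rcases digits_sub hb2 hc.dvd hlt with ⟨-, h1⟩ | ⟨h1, -⟩
      · exact h1
      · omega
    have hα1' : alphaWith (ordInterp B) b (n - b) = Om * α := by
      rw [← hα1, alphaWith, alphaWith, hdig.1]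
    have hval := ordInterp_theta h.hB (hc.mem h.hB) hbase (hbb.lt_of_ne hne.symm) hnb
    rw [hα1'] at hval
    have htt : tail (ordInterp B) (tilde (sInf B) ((n - b) / b ^ 2) ((n - b) / b % b)) <
        tail (ordInterp B) w := by
      refine tail_lt_tail h0 (hmB ?_)
      rw [hw]
      exact tildeV_sub_lt (q := sInf B) hb2 hc.dvd hlt hne hv hdig.1 hdig.2
    refine ⟨_, hTprin htt hTpos, ?_⟩
    refine (h.ordInterp_base_zero_le hc hU).2.trans_lt ?_
    have h3 : n - 1 = n - b + (b - 1) := by omega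
    have hle := Om_mul_add_lt_epsOm hα (add_lt_Om hβΩ ((hTprin htt hTpos).trans hTΩ))
    rw [h3, ordInterp_add h.hB (by omega) hnb
      (hc.baseOf_eq h.hB (by omega) (by omega)) (by have := hc.sInf_le h.hB; omega)]
    refine add_lt_theta hle ?_ ((hmB (show b - 1 < b by omega)).trans ?_)
    · rw [hval]
      refine theta_add_lt_theta_add hα ?_ (add_lt_Om hβΩ ((hTprin htt hTpos).trans hTΩ))
      exact (add_lt_add_iff_left _).2 (lt_add_one _)
    · exact (lt_theta_minBeta hα (ordInterp_lt_Om h.hB b)).trans_le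
        (theta_add_le_theta_add hα le_self_add
          (add_lt_Om hβΩ ((hTprin htt hTpos).trans hTΩ)))
  | succ j ih =>
    obtain ⟨η, hη, hlt'⟩ := ih (by omega)
    have htt : tail (ordInterp C) (tilde (sInf C) (n / b ^ 2) (U (n / b % b) - 1)) <
        tail (ordInterp B) w := by
      have h1 := hmC htl
      rw [hU w (by omega)] at h1
      rw [tail, tail, if_neg h0]
      split_ifs
      · exact opow_pos _ omega0_pos
      · exact (opow_lt_opow_iff_right one_lt_omega0).2 h1
    have hη' := hTprin hη (hTprin htt hTpos)
    have hΩ := add_lt_Om hβΩ (hη'.trans hTΩ)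
    have hle := Om_mul_add_lt_epsOm hα hΩ
    refine ⟨_, hη', ?_⟩
    have h2 : ordInterp C (base U c b n (j + 1) - base U c b n j) <
        theta (Om * α + (minBeta (Om * α) (ordInterp B b) + (η +
        (tail (ordInterp C) (tilde (sInf C) (n / b ^ 2) (U (n / b % b) - 1)) + 1)))) := by
      rw [hbs j (by omega)]
      refine theta_add_lt_theta_add hα ?_ hΩ
      rw [← add_assoc, ← add_assoc]
      exact lt_add_one_iff.2 (by gcongr; exact minBeta_le hlt')
    rw [h.ordInterp_base_succ hc hj, ordinal_mul_two]
    exact add_lt_theta hle h2 h2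

/-- The upgrade of a base `n` with predecessor `d`. -/
theorem U_sub_pred (h : Ouro B C k U c) {d n : ℕ} (hd : Consec B d n) :
    U n = U (n - d) + c (n - d) ∧ c (n - d) ∣ U (n - d) ∧ Consec C (c (n - d)) (U n) := by
  have hnB := hd.2.1
  have hdlt := hd.2.2.1
  have hqd : sInf B ≤ d := Nat.sInf_le hd.1
  have h2d := h.hB.two_le d hd.1
  have hbd : baseOf B (n - 1) = d := hd.baseOf_eq (by omega) (by omega)
  have hdn : d ∣ n := h.hB.dvd_of_le hd.1 hnB hdlt.le
  have h1 : n - 1 + 1 = n := by omega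
  obtain ⟨h2, h3, h4, h5, h6⟩ := h.c_base (n - 1) (by omega) (h1.symm ▸ hnB)
  rw [h1] at h2 h3 h4 h5 h6
  have hnd : d ∣ n - d := Nat.dvd_sub hdn dvd_rfl
  have hdd : d ≤ n - d := Nat.le_of_dvd (by omega) hnd
  have h7 : n - d + (d - 1) = n - 1 := by omega
  have hadd := h.U_add (b := d) (x := n - d) (r := d - 1) (by rwa [h7]) hnd (by omega)
    (by omega) hdd
  rw [h7] at hadd
  obtain ⟨h8, h9, h10, -⟩ := hadd
  have h11 : c (n - 1) = c (n - d) := by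
    have := (h.c_noncrit_add (b := d) (x := n - d) (r := d - 1) (by rwa [h7]) hnd (by omega)
      (by omega) hdd).2
    rwa [h7] at this
  rw [h11] at h3 h5 h6
  have h12 : U n = U (n - d) + c (n - d) := by
    rw [← h2]
    obtain ⟨s, hs⟩ := h9
    obtain ⟨t, ht⟩ := h3
    rw [hs] at h8 ⊢
    rw [h8, ht] at h4 h5
    rw [ht]
    have hcp : 0 < c (n - d) := by omega
    -- With c = c(n - d), U(n - 1) is c·s plus a digit below c. The new base c·t exceeds it by at
    -- most c, so t can only be s + 1.
    have h13 : s < t := by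
      by_contra! hle
      have := Nat.mul_le_mul_left (c (n - d)) hle
      omega
    have h14 : t < s + 2 := by
      by_contra! hle
      have := Nat.mul_le_mul_left (c (n - d)) hle
      rw [mul_add] at this
      omega
    rw [show t = s + 1 by omega, mul_add, mul_one]
  exact ⟨h12, h9, h2 ▸ h6⟩

/-- The upgrade preserves the ordinal interpretation. -/
theorem ordInterp_U (h : Ouro B C k U c) (hq : 3 ≤ sInf B) (n : ℕ) :
    ordInterp C (U n) = ordInterp B n := by
  induction n using Nat.strong_induction_on with
  | _ n ih =>
  have hmC := ordInterp_strictMono h.hC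
  rcases lt_trichotomy n (sInf B) with hn | hn | hn
  · rw [h.of_lt n hn, ordInterp_of_lt hn, ordInterp_of_lt (by rw [h.sInf_eq]; omega)]
  · rw [hn, h.U_sInf, ← h.sInf_eq, ordInterp_sInf, ordInterp_sInf]
  by_cases hnB : n ∈ B
  · obtain ⟨d, hd, -⟩ := exists_consec h.hB hnB hn
    have hdlt := hd.2.2.1
    have h2d := h.hB.two_le d hd.1
    obtain ⟨h12, -, h6⟩ := h.U_sub_pred hd
    rw [ordInterp_base h.hB hd, ← ih (n - d) (by omega), ordInterp_base h.hC h6, h12,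
      Nat.add_sub_cancel]
  obtain ⟨hb1, hb2, hb3⟩ := baseOf_spec h.hB.nonempty hn.le
  obtain ⟨b, hb⟩ : ∃ b, baseOf B n = b := ⟨_, rfl⟩
  rw [hb] at hb1 hb2 hb3
  have hbn : b < n := hb2.lt_of_ne fun he => hnB (he ▸ hb1)
  have h2b := h.hB.two_le b hb1
  have hqb : sInf B ≤ b := Nat.sInf_le hb1
  by_cases hd : b ∣ n
  · have hc : Crit B n b := ⟨hb, hbn, hd⟩
    rw [h.ordInterp_U_crit hc fun m hm => ih m (by omega), ordInterp_theta h.hB hb1 hb hbn hd]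
    obtain ⟨α, hα, hα1, hα2, hα3, hα4, hα5⟩ := ordInterp_crit_eq h.hB hb hbn hd hqb
    rw [hα1]
    have h1 := ordInterp_lt_Om h.hC (base U c b n k)
    have h2 : ordInterp B b ≤ ordInterp C (base U c b n k) := by
      refine (h.ordInterp_base_zero_le hc ih).1.trans (hmC.monotone ?_)
      rw [← (h.c_eq_base hc).1]
      exact h.c_mono (by omega) (Nat.sub_le _ _)
    congr 2
    -- Without a tail, o_C(d_k) < o_B(n) = ϑ(α + β) says that the old β still works, so the two
    -- minimal values agree. With a tail, the increase of β is at most some η below ω^{o(ṽ)} and is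
    -- absorbed by it.
    by_cases h0 : tilde (sInf B) (n / b ^ 2) (n / b % b) = 0
    · have h3 := h.ordInterp_base_lt hq hc ih h0 le_rfl
      rw [ordInterp_theta h.hB hb1 hb hbn hd, hα1] at h3
      rw [h0, tail, if_pos rfl, add_zero] at h3 ⊢
      rw [add_zero]
      exact le_antisymm (minBeta_le h3) (minBeta_mono hα h2 h1)
    · obtain ⟨η, hη, h3⟩ := h.ordInterp_base_lt_of_tilde hq hc ih h0 le_rfl
      rw [hα1] at h3
      refine minBeta_add_tail hα h2 h1 ?_ hη h3
      rw [tail, if_neg h0]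
      exact isPrincipal_add_omega0_opow _
  · have h3 := Nat.div_add_mod n b
    have h4 := Nat.mod_lt n (show 0 < b by omega)
    have h5 : n % b ≠ 0 := fun hh => hd (Nat.dvd_of_mod_eq_zero hh)
    have hx : b ∣ b * (n / b) := dvd_mul_right _ _
    have hbx : b ≤ b * (n / b) := Nat.le_mul_of_pos_right _ (Nat.div_pos hbn.le (by omega))
    generalize b * (n / b) = x at *
    generalize n % b = r at *
    subst h3
    obtain ⟨h6, h7, h8, h9⟩ := h.U_add hb hx h4 (by omega) hbx
    have h10 : sInf C ≤ U x := by
      rw [h.sInf_eq, ← h.U_sInf]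
      exact h.strictMono.monotone (by omega)
    rw [h6, ordInterp_add h.hC h8 h7 h9 h10, ih x (by omega), ih r (by omega),
      ordInterp_add h.hB h4 hx hb (by omega)]

end Ouro

end

end Ouroboros

/-! ### Fundamental sequences below ε_{Ω+1} compared with predecessors of base changes -/

namespace Ouroboros

noncomputable section

theorem IsEval.decomp_of_lt {X : Ordinal.{0}} {f : ℕ → Ordinal.{0}} {b : ℕ} {E : ℕ → Ordinal.{0}}
    (h : IsEval X f b E) {e a r : ℕ} (ha : a < b) (hr : r < b ^ e) :
    E (b ^ e * a + r) = X ^ E e * f a + E r := by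
  rcases Nat.eq_zero_or_pos a with rfl | h0
  · rw [mul_zero, zero_add, h.coeff_zero, mul_zero, zero_add]
  · exact h.decomp e a r h0 ha hr

theorem one_add_le_of_le {x y : Ordinal.{0}} (hy : ω ≤ y) (h : x ≤ y) : 1 + x ≤ y := by
  rcases lt_or_ge x ω with hx | hx
  · exact (isPrincipal_add_omega0 one_lt_omega0 hx).le.trans hy
  · rwa [one_add_of_omega0_le hx]

theorem one_add_le_of_lt {x y : Ordinal.{0}} (h : x < y) : 1 + x ≤ y := by
  rcases lt_or_ge x ω with hx | hx
  · obtain ⟨n, rfl⟩ := lt_omega0.1 hx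
    have : (1 : Ordinal.{0}) + n = n + 1 := by exact_mod_cast add_comm 1 n
    rw [this]
    exact Order.add_one_le_of_lt h
  · rw [one_add_of_omega0_le hx]; exact h.le

theorem omega0_le_ordInterp {B : Set ℕ} (hB : IsBaseHierarchy B) {n : ℕ} (h : sInf B ≤ n) :
    ω ≤ ordInterp B n := by
  rw [← ordInterp_sInf (B := B)]
  exact (ordInterp_strictMono hB).monotone h

theorem ordInterp_pred {B : Set ℕ} (hB : IsBaseHierarchy B) {n : ℕ} {δ : Ordinal.{0}}
    (h : ordInterp B n = δ + 1) : n ≠ 0 ∧ ¬sInf B ∣ n ∧ ordInterp B (n - 1) = δ := by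
  have h0 : n ≠ 0 := fun h0 => by
    rw [h0, ordInterp_zero hB] at h
    exact ordinal_add_one_ne_zero δ h.symm
  have h1 : ¬sInf B ∣ n := fun h1 => by
    have := isSuccLimit_ordInterp hB (Nat.pos_of_ne_zero h0) h1
    rw [h] at this
    exact not_isSuccLimit_add_one δ this
  refine ⟨h0, h1, ?_⟩
  obtain ⟨m, rfl⟩ := Nat.exists_eq_succ_of_ne_zero h0
  rw [ordInterp_succ hB h1] at h
  rw [Nat.succ_sub_one]
  exact Order.succ_injective h

theorem bigO_one {B : Set ℕ} (hB : IsBaseHierarchy B) {b : ℕ} (hb : 2 ≤ b) :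
    bigO (ordInterp B) b 1 = 1 := by
  rw [(isEval_ordInterp hB hb).of_lt (by omega),
    ordInterp_of_lt (by have := hB.two_le_sInf; omega), Nat.cast_one]

theorem ordInterp_one {B : Set ℕ} (hB : IsBaseHierarchy B) : ordInterp B 1 = 1 := by
  rw [ordInterp_of_lt (by have := hB.two_le_sInf; omega), Nat.cast_one]

/-- Predecessors of evaluations. -/
theorem bigO_pred {B : Set ℕ} (hB : IsBaseHierarchy B) {d : ℕ} (hd : 2 ≤ d) {n : ℕ}
    {δ : Ordinal.{0}} (h : bigO (ordInterp B) d n = δ + 1) :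
    n ≠ 0 ∧ bigO (ordInterp B) d (n - 1) = δ := by
  have hE := isEval_ordInterp hB hd
  have h1 := Nat.div_add_mod n d
  have h2 := Nat.mod_lt n (show 0 < d by omega)
  have h3 : d ^ 1 ∣ d * (n / d) := by rw [pow_one]; exact dvd_mul_right _ _
  have h4 : ∀ r < d, bigO (ordInterp B) d (d * (n / d) + r) =
      bigO (ordInterp B) d (d * (n / d)) + ordInterp B r := fun r hr => by
    rw [hE.add h3 (by rwa [pow_one]), hE.of_lt hr]
  have h5 := h4 _ h2
  rw [h1, h] at h5
  obtain ⟨γ, hγ⟩ := hE.dvd h3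
  rw [bigO_one hB hd, opow_one] at hγ
  have hr0 : n % d ≠ 0 := fun h0 => by
    rw [h0, ordInterp_zero hB, add_zero, hγ] at h5
    rcases eq_or_ne γ 0 with rfl | h6
    · rw [mul_zero] at h5
      exact ordinal_add_one_ne_zero _ h5
    · have h7 := isSuccLimit_mul_left isSuccLimit_Om (pos_iff_ne_zero.2 h6)
      rw [← h5] at h7
      exact not_isSuccLimit_add_one δ h7
  have hpos : 0 < ordInterp B (n % d) := by
    have := ordInterp_strictMono hB (Nat.pos_of_ne_zero hr0)
    rwa [ordInterp_zero hB] at this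
  obtain ⟨ε, hε⟩ := (add_eq_add_one hpos.ne').1 ⟨δ, h5.symm⟩
  obtain ⟨-, -, h8⟩ := ordInterp_pred hB hε
  refine ⟨fun h0 => by rw [h0, Nat.zero_mod] at hr0; exact hr0 rfl, ?_⟩
  have h9 : n - 1 = d * (n / d) + (n % d - 1) := by omega
  rw [h9, h4 _ (by omega), h8]
  rw [hε, ← add_assoc] at h5
  exact (Order.succ_injective h5).symm

namespace Ouro

variable {B C : Set ℕ} {k : ℕ} {U c : ℕ → ℕ}

/-- The values of o_C at U(a - 1) and U a differ by 1 and o_C is strictly increasing, so no number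
fits in between. -/
theorem U_pred (h : Ouro B C k U c) (hq : 3 ≤ sInf B) {a : ℕ} (h0 : a ≠ 0) (ha : ¬sInf B ∣ a) :
    U a = U (a - 1) + 1 := by
  obtain ⟨m, rfl⟩ := Nat.exists_eq_succ_of_ne_zero h0
  have h1 := ordInterp_succ h.hB ha
  rw [Nat.succ_sub_one]
  refine le_antisymm ?_ (h.strictMono (Nat.lt_succ_self m))
  rw [← (ordInterp_strictMono h.hC).le_iff_le, Nat.succ_eq_add_one, h.ordInterp_U hq, h1,
    ← h.ordInterp_U hq m]
  exact Order.add_one_le_of_lt (ordInterp_strictMono h.hC (Nat.lt_succ_self _))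

/-- Arguments `x` for fundamental sequences of cofinality `τ` that stay below the predecessors of
base changes from `b` to `d`. -/
def Admissible (B C : Set ℕ) (U : ℕ → ℕ) (b d : ℕ) (τ x : Ordinal.{0}) : Prop :=
  (τ = Om → x ≤ ordInterp C (d - 1)) ∧
    ∀ a < b, 0 < a → sInf B ∣ a → τ = ordInterp B a → x < ordInterp C (U a - 1)

/-- Both operations act on the last term only: A[x] modifies the last term of A, and subtracting 1
from Δ(m) borrows from its last term d^f·U(a), leaving U(a) - 1 copies of d^f and the remainder d^f
- 1. This dominates A[x] whether the coefficient o(a) is a limit, the exponent is a successor, or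
the exponent is a limit; in the last case one recurses into the exponent. The factor Ω^s with s = 1
serves the application, where O(n) is Ω times the uncountable part A of the argument of ϑ; exponents
need s = 0. -/
theorem fsOm_bigO_le (h : Ouro B C k U c) (hq : 3 ≤ sInf B) {b d : ℕ} (hg : GoodDigits U b d)
    (hd : sInf B + 1 < d) (m : ℕ) : ∀ s : ℕ, s ≤ 1 → b ^ s ∣ m → ∀ A : Ordinal.{0},
    Om ^ (s : Ordinal.{0}) * A = bigO (ordInterp B) b m → IsSuccLimit A →
    (cofin A = Om ∨ ∃ a < b, 0 < a ∧ sInf B ∣ a ∧ cofin A = ordInterp B a) ∧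
    ∀ x, Admissible B C U b d (cofin A) x → Om ^ (s : Ordinal.{0}) * fsOm A x ≤
      bigO (ordInterp C) d (natBaseChange U b d m - 1) := by
  induction m using Nat.strong_induction_on with
  | _ m ih =>
  intro s hs1 hsm A hA hAl
  have hb := hg.two_le
  have hE := isEval_ordInterp h.hB hb
  have hG := isEval_ordInterp h.hC hg.two_le'
  have hGm := hG.strictMono.monotone
  have hEG := bigO_natBaseChange hg hE hG fun a _ => h.ordInterp_U hq a
  have hm0 : m ≠ 0 := fun h0 => by
    rw [h0, hE.zero] at hA
    rcases mul_eq_zero.1 hA with h1 | h1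
    · exact (opow_pos _ Om_pos).ne' h1
    · exact hAl.ne_bot h1
  obtain ⟨hem, ha0, hab, hre, hrm⟩ := decomp_props hb hm0
  have hme := decomp_eq b m
  generalize Nat.log b m = e at *
  generalize m / b ^ e = a at *
  generalize m % b ^ e = r at *
  subst hme
  have hse : s ≤ e := le_exp_of_dvd ha0 hab hre hsm
  have hsr : b ^ s ∣ r := (Nat.dvd_add_right ((pow_dvd_pow b hse).mul_right a)).1 hsm
  have hOs : bigO (ordInterp B) b s = s := by
    interval_cases s
    · rw [hE.zero, Nat.cast_zero]
    · rw [bigO_one h.hB hb, Nat.cast_one]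
  obtain ⟨e', he'⟩ := exists_add_of_le (hE.strictMono.monotone hse)
  obtain ⟨Ar, hAr⟩ := hE.dvd hsr
  rw [hOs] at he' hAr
  have hoa0 : ordInterp B a ≠ 0 := (hE.coeff_pos ha0 hab).ne'
  have hoaΩ := ordInterp_lt_Om h.hB a
  have hOmpos : (0 : Ordinal.{0}) < Om ^ (s : Ordinal.{0}) := opow_pos _ Om_pos
  have hArlt : Ar < Om ^ e' := by
    have h1 := hE.lt_opow hre
    rw [hAr, he', opow_add] at h1
    exact lt_of_mul_lt_mul_left h1 zero_le
  -- The normal form of A is that of O(m) with Ω^s cancelled from every term; the exponent e'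
  -- satisfies O(e) = s + e'.
  have hAeq : A = Om ^ e' * ordInterp B a + Ar := by
    refine mul_right_injective₀ hOmpos.ne' ?_
    change Om ^ (s : Ordinal.{0}) * A = _ * _
    rw [hA, hE.decomp e a r ha0 hab hre, hAr, he', opow_add, mul_add, mul_assoc]
  have he'ε : e' < epsOm := by
    have h1 := bigO_lt_epsOm hE e
    rw [he'] at h1
    exact le_add_self.trans_lt h1
  have hpow : ∀ y, Om ^ (s : Ordinal.{0}) * (Om ^ e' * y) = Om ^ bigO (ordInterp B) b e * y :=
    fun y => by rw [he', opow_add, mul_assoc]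
  have hΔ := hg.map_decomp ha0 hab hre
  have hUa := hg.lt a hab
  have hUa0 := hg.pos ha0 hab
  obtain ⟨f, hf⟩ : ∃ f, f = natBaseChange U b d e := ⟨_, rfl⟩
  have hGf : bigO (ordInterp C) d f = bigO (ordInterp B) b e := by rw [hf, hEG]
  have hdf : 0 < d ^ f := Nat.pow_pos (by omega)
  rw [hΔ, ← hf, hAeq]
  rcases Nat.eq_zero_or_pos r with hr | hr
  · have hAr0 : Ar = 0 := by
      rw [hr, hE.zero] at hAr
      rcases mul_eq_zero.1 hAr.symm with h1 | h1
      · exact absurd h1 hOmpos.ne'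
      · exact h1
    rw [hAr0, add_zero] at hAeq ⊢
    rw [hr, hg.map_zero, add_zero]
    have hsplit : d ^ f * U a - 1 = d ^ f * (U a - 1) + (d ^ f - 1) := by
      rw [Nat.mul_sub, mul_one]
      have := Nat.le_mul_of_pos_right (d ^ f) hUa0
      omega
    have hval : bigO (ordInterp C) d (d ^ f * U a - 1) =
        Om ^ bigO (ordInterp B) b e * ordInterp C (U a - 1) + bigO (ordInterp C) d (d ^ f - 1) := by
      rw [hsplit, hG.decomp_of_lt (by omega) (by omega), hGf]
    rw [hval]
    by_cases hqa : sInf B ∣ a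
    · have hl := isSuccLimit_ordInterp h.hB ha0 hqa
      rw [cofin_mul_limit hoaΩ hl]
      refine ⟨Or.inr ⟨a, hab, ha0, hqa, rfl⟩, fun x hx => ?_⟩
      rw [fsOm_mul_limit hoaΩ hl, hpow]
      exact (mul_le_mul_right (hx.2 a hab ha0 hqa rfl).le _).trans le_self_add
    · obtain ⟨a', rfl⟩ := Nat.exists_eq_succ_of_ne_zero ha0.ne'
      have hoa := ordInterp_succ h.hB hqa
      have hUa' := h.U_pred hq ha0.ne' hqa
      rw [Nat.succ_sub_one] at hUa'
      rw [Nat.succ_eq_add_one] at *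
      rw [hUa', Nat.add_sub_cancel, h.ordInterp_U hq]
      rw [hoa] at hoaΩ hAeq ⊢
      have hf1 : ∀ g, g + 1 = f → d ^ g * (d - 1) ≤ d ^ f - 1 := fun g hgf => by
        rw [← hgf, pow_succ, Nat.mul_sub, mul_one]
        have := Nat.pow_pos (n := g) (show 0 < d by omega)
        omega
      rcases eq_or_ne e' 0 with h0 | h0
      · rw [h0, opow_zero, one_mul] at hAeq
        rw [hAeq] at hAl
        exact absurd hAl (not_isSuccLimit_add_one _)
      have hkey : ∀ x, Om ^ (s : Ordinal.{0}) * fsOm (Om ^ e') x ≤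
          bigO (ordInterp C) d (d ^ f - 1) → Om ^ (s : Ordinal.{0}) *
            fsOm (Om ^ e' * (ordInterp B a' + 1)) x ≤ Om ^ bigO (ordInterp B) b e *
              ordInterp B a' + bigO (ordInterp C) d (d ^ f - 1) := fun x hx => by
        rw [fsOm_mul_add_one hoaΩ, mul_add, hpow]
        exact (add_le_add_iff_left _).2 hx
      by_cases hsucc : ∃ δ, e' = δ + 1
      · obtain ⟨δ, rfl⟩ := hsucc
        rw [cofin_mul_add_one_succ hoaΩ]
        refine ⟨Or.inl rfl, fun x hx => hkey x ?_⟩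
        have h1 : bigO (ordInterp C) d f = (s + δ) + 1 := by rw [hGf, he', add_assoc]
        obtain ⟨hf0, h2⟩ := bigO_pred h.hC hg.two_le' h1
        rw [fsOm_opow_add_one, ← mul_assoc, ← opow_add, ← h2]
        refine (mul_le_mul_right (hx.1 rfl) _).trans ?_
        have h3 := hG.decomp_of_lt (e := f - 1) (a := d - 1) (r := 0) (by omega)
          (Nat.pow_pos (by omega))
        rw [hG.zero, add_zero, add_zero] at h3
        rw [← h3]
        exact hGm (hf1 (f - 1) (by omega))
      -- For a limit exponent, (Ω^{e'})[x] = Ω^{e'[x]}. The induction hypothesis bounds e'[x] by O(f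
      -- - 1), and d^{f-1} ≤ d^f - 1.
      · have hl := isSuccLimit_of_not_exists h0 hsucc
        rw [cofin_mul_add_one_limit he'ε hoaΩ hl]
        have hω : ω ≤ e' := omega0_le_of_isSuccLimit hl
        have hee : e' = bigO (ordInterp B) b e := by
          rw [he']
          interval_cases s
          · rw [Nat.cast_zero, zero_add]
          · rw [Nat.cast_one, one_add_of_omega0_le hω]
        obtain ⟨h1, h2⟩ := ih e hem 0 (by omega) (by simp) e'
          (by rw [Nat.cast_zero, opow_zero, one_mul, hee]) hl
        refine ⟨h1, fun x hx => hkey x ?_⟩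
        have h3 := h2 x hx
        rw [Nat.cast_zero, opow_zero, one_mul, ← hf] at h3
        rw [fsOm_opow_limit he'ε hl, ← opow_add]
        have hf0 : f ≠ 0 := fun hf0 => by
          rw [hf0, hG.zero] at hGf
          rw [← hGf] at hee
          exact h0 hee
        have h4 : (s : Ordinal.{0}) + fsOm e' x ≤ bigO (ordInterp C) d (f - 1) := by
          interval_cases s
          · rwa [Nat.cast_zero, zero_add]
          · rw [Nat.cast_one]
            -- It remains to fit the 1 of 1 + e'[x]. If e is a digit, then e'[x] = x and the strict
            -- inequality in `Admissible` leaves room. Otherwise O(f - 1) is infinite and absorbs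
            -- the 1.
            rcases lt_or_ge e b with heb | heb
            · rw [hE.of_lt heb] at hee
              have h5 : sInf B ∣ e := by
                by_contra h5
                have h6 : e ≠ 0 := fun h6 => h5 (h6 ▸ dvd_zero _)
                obtain ⟨e₁, rfl⟩ := Nat.exists_eq_succ_of_ne_zero h6
                exact hsucc ⟨_, hee.trans (ordInterp_succ h.hB h5)⟩
              have h7 : 0 < e := Nat.pos_of_ne_zero fun h7 => by
                rw [h7, ordInterp_zero h.hB] at hee
                exact h0 hee
              have h8 : e' < Om := hee ▸ ordInterp_lt_Om h.hB e
              rw [fsOm_of_isSuccLimit h8 hl]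
              rw [cofin_of_isSuccLimit h8 hl] at hx
              rw [hf, hg.of_lt heb, hG.of_lt (by have := hg.lt e heb; omega)]
              exact one_add_le_of_lt (hx.2 e heb h7 h5 hee)
            · refine one_add_le_of_le ?_ h3
              have h5 : d ≤ f := by
                have := hg.strictMono.monotone heb
                rwa [natBaseChange_self hb h.U_zero h.U_one, ← hf] at this
              refine (omega0_le_ordInterp h.hC (n := d - 1) (by rw [h.sInf_eq]; omega)).trans ?_
              rw [← hG.of_lt (a := d - 1) (by omega)]
              exact hGm (by omega)
        refine (opow_le_opow_right Om_pos h4).trans ?_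
        have h5 := hG.decomp_of_lt (e := f - 1) (a := 1) (r := 0) (by omega)
          (Nat.pow_pos (by omega))
        rw [hG.zero, add_zero, add_zero, ordInterp_one h.hC, mul_one, mul_one] at h5
        rw [← h5]
        exact hGm ((Nat.le_mul_of_pos_right _ (by omega)).trans (hf1 (f - 1) (by omega)))
  · have hAr0 : Ar ≠ 0 := fun h0 => by
      rw [h0, mul_zero, ← hE.zero] at hAr
      exact hr.ne' (hE.strictMono.injective hAr)
    have hArl : IsSuccLimit Ar := by
      refine isSuccLimit_of_not_exists hAr0 fun hex => ?_
      have := not_exists_of_isSuccLimit hAl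
      rw [hAeq, add_eq_add_one hAr0] at this
      exact this hex
    rw [cofin_nf hoa0 hoaΩ hArlt hAr0]
    obtain ⟨h1, h2⟩ := ih r hrm s hs1 hsr Ar hAr.symm hArl
    refine ⟨h1, fun x hx => ?_⟩
    rw [fsOm_nf hoa0 hoaΩ hArlt hAr0, mul_add, hpow]
    have hr' := hg.strictMono hr
    rw [hg.map_zero] at hr'
    have h3 := hg.map_lt_pow hre
    rw [Nat.add_sub_assoc (by omega), hG.decomp_of_lt hUa (by rw [hf]; omega), hGf,
      h.ordInterp_U hq]
    exact (add_le_add_iff_left _).2 (h2 x hx)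

end Ouro

end

end Ouroboros

/-! ### Fundamental sequences of the values of ϑ that occur as interpretations -/

namespace Ouroboros

noncomputable section

theorem theta_natCast (n : ℕ) : theta n = ω ^ (n : Ordinal.{0}) := by
  induction n using Nat.strong_induction_on with
  | _ n ih =>
  refine le_antisymm (theta_le ⟨⟨n, rfl⟩, ?_, fun ζ hζ _ => ?_⟩) (opow_le_theta (natCast_lt_Om n))
  · rw [maxCoeff_of_lt_Om (natCast_lt_Om n)]
    rcases Nat.eq_zero_or_pos n with rfl | h0
    · rw [Nat.cast_zero, opow_zero]; exact one_pos
    · refine (natCast_lt_omega0 n).trans_le (Ordinal.left_le_opow ω ?_)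
      exact_mod_cast h0
  · obtain ⟨m, rfl⟩ := lt_omega0.1 (hζ.trans (natCast_lt_omega0 n))
    have hm : m < n := by exact_mod_cast hζ
    rw [ih m hm]
    exact (opow_lt_opow_iff_right one_lt_omega0).2 hζ

theorem fsTheta_omega0 (n : ℕ) : fsTheta ω n = n := by
  have h1 : BelowBH (ω ^ (0 : Ordinal.{0})) := by
    rw [opow_zero]; exact_mod_cast belowBH_natCast 1
  have := fsTheta_opow_add_one h1 n
  rwa [zero_add, opow_one, opow_zero, one_mul] at this

theorem isSuccLimit_Om_mul_add {α ρ : Ordinal.{0}} (h : IsSuccLimit ρ) :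
    IsSuccLimit (Om * α + ρ) := isSuccLimit_add _ h

/-- Fundamental sequences of values of `ϑ` at arguments with a countable limit part. -/
theorem fsTheta_theta_limit {α ρ : Ordinal.{0}} (hα : α < epsOm) (hρ : ρ < Om)
    (hl : IsSuccLimit ρ) (hf : ¬IsFix (Om * α + ρ)) (n : ℕ) :
    fsTheta (theta (Om * α + ρ)) n = theta (Om * α + fsTheta ρ n) := by
  have hζ := Om_mul_add_lt_epsOm hα hρ
  have hl' : IsSuccLimit (Om * α + ρ) := isSuccLimit_Om_mul_add hl
  have hst : thetaStar (Om * α + ρ) = 0 := by rw [thetaStar_limit hl', if_neg hf]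
  have hch : checkOrd (Om * α + ρ) = Om * α + ρ := by rw [checkOrd, hst, if_neg (lt_irrefl _)]
  have hj : ¬(Om * α + ρ < Om ∧ IsJump (Om * α + ρ)) := by
    rintro ⟨-, h1 | h1 | h1⟩
    · exact hf h1
    · exact not_exists_of_isSuccLimit hl' h1
    · exact hl'.ne_bot h1
  have hcof : cofin (Om * α + ρ) = ρ := by
    rw [cofin_Om_mul_add hα hρ hl.ne_bot, cofin_of_isSuccLimit hρ hl]
  have hlt : ρ < theta (Om * α + ρ) := by
    refine lt_of_le_of_lt ?_ (maxCoeff_lt_theta hζ)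
    rw [maxCoeff_Om_mul_add hα hρ]
    exact le_max_right _ _
  rw [fsTheta_theta hζ, if_neg hj, hch, hcof, if_neg hρ.ne, if_pos hlt, hst, add_zero,
    fsOm_Om_mul_add hα hρ hl.ne_bot, fsOm_of_isSuccLimit hρ hl]

theorem isSuccLimit_omega0_opow {δ : Ordinal.{0}} (h : δ ≠ 0) : IsSuccLimit (ω ^ δ) :=
  isSuccLimit_opow_left isSuccLimit_omega0 h

/-- In `Fix`, β + ω^δ would be some ϑ(γ) with γ above the whole argument. But then β < ϑ(γ), and δ ≤
p < ϑ(Ω·α + β) < ϑ(γ) gives ω^δ ≤ ϑ(δ) < ϑ(γ), contradicting that ϑ(γ) is additively principal. -/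
theorem not_isFix_minBeta_add_opow {α p δ : Ordinal.{0}} (hα : α < epsOm) (hp : p < Om)
    (hδ0 : δ ≠ 0) (hδ : δ ≤ p) : ¬IsFix (Om * α + (minBeta (Om * α) p + ω ^ δ)) := by
  have hβ := minBeta_le_self hα hp
  have hth := lt_theta_minBeta hα hp
  generalize minBeta (Om * α) p = β at *
  have hβΩ := hβ.trans_lt hp
  have hδΩ := hδ.trans_lt hp
  have hl : IsSuccLimit (β + ω ^ δ) := isSuccLimit_add _ (isSuccLimit_omega0_opow hδ0)
  have hρ : β + ω ^ δ < Om := add_lt_Om hβΩ (opow_lt_Om omega0_lt_Om hδΩ)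
  rintro ⟨-, h1, h2, γ, h3, h4, h5⟩
  rw [cofin_Om_mul_add hα hρ hl.ne_bot, cofin_of_isSuccLimit hρ hl] at h2 h5
  rw [h2, fsOm_Om_mul_add hα hρ hl.ne_bot, fsOm_of_isSuccLimit hρ hl,
    maxCoeff_Om_mul_add hα one_lt_Om] at h1
  have hβρ : β < β + ω ^ δ := lt_add_of_pos_right _ (opow_pos _ omega0_pos)
  rw [h5] at hβρ h1
  have h6 : theta (Om * α + β) < theta γ := by
    refine theta_lt_theta h4 (lt_trans ?_ h3) ?_
    · exact (add_lt_add_iff_left _).2 (h5 ▸ hβρ)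
    · rw [maxCoeff_Om_mul_add hα hβΩ]
      exact max_lt ((le_max_left _ _).trans_lt h1) hβρ
  have h7 : δ < theta γ := hδ.trans_lt (hth.trans h6)
  have h8 : theta δ < theta γ := by
    refine theta_lt_theta h4 (lt_of_lt_of_le h7 ?_) (by rwa [maxCoeff_of_lt_Om hδΩ])
    rw [← h5]
    exact le_add_self.trans h3.le
  exact absurd h5 (add_lt_theta h4 hβρ ((opow_le_theta hδΩ).trans_lt h8)).ne

/-- The case α = 0 is that of n = 2b. All ω-powers below the Bachmann-Howard ordinal have the next
ω-power as a value of ϑ at a countable argument, so the least such value above ω^θ·m is ω^{θ+1}. -/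
theorem fsTheta_theta_minBeta_zero {θ : Ordinal.{0}} {m : ℕ} (hm : 0 < m)
    (hp : BelowBH (ω ^ θ * m)) (n : ℕ) :
    fsTheta (theta (minBeta 0 (ω ^ θ * m))) n = ω ^ θ * n := by
  have hm' : (0 : Ordinal.{0}) < m := by exact_mod_cast hm
  have hle : ω ^ θ ≤ ω ^ θ * m := Ordinal.le_mul_left _ hm'
  have h1 := hp.mono hle
  obtain ⟨ζ, hζ, hζ1, -, -⟩ := exists_jump_theta_eq h1
  have hlt : ω ^ θ * m < ω ^ (θ + 1) := by
    rw [opow_add, opow_one]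
    exact (mul_lt_mul_iff_right₀ (opow_pos _ omega0_pos)).2 (natCast_lt_omega0 m)
  have hmin : minBeta 0 (ω ^ θ * m) ≤ ζ := minBeta_le (by rwa [zero_add, hζ1])
  have h2 : ω ^ θ * m < theta (minBeta 0 (ω ^ θ * m)) := by
    have := lt_theta_minBeta epsOm_pos hp.lt_Om
    rwa [mul_zero, zero_add] at this
  have h3 : theta (minBeta 0 (ω ^ θ * m)) ≤ ω ^ (θ + 1) := by
    rw [← hζ1]
    rcases hmin.eq_or_lt with h | h
    · rw [h]
    · exact (theta_lt_theta_of_lt_Om h hζ).le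
  obtain ⟨θ', hθ'⟩ := exists_theta_eq (lt_epsOm_of_lt_Om (hmin.trans_lt hζ))
  have h4 : theta (minBeta 0 (ω ^ θ * m)) = ω ^ (θ + 1) := by
    refine le_antisymm h3 ?_
    rw [hθ'] at h2 ⊢
    exact opow_add_one_le_of_lt (hle.trans_lt h2)
  rw [h4, fsTheta_opow_add_one h1]

/-- The structure of `o_C(d² t - d)`, whose coefficient of `d` is `d - 1`. -/
theorem ordInterp_sub_base {C : Set ℕ} (hC : IsBaseHierarchy C) {d t : ℕ} (hd : d ∈ C)
    (hq : sInf C < d) (ht : 0 < t) (hb : baseOf C (d ^ 2 * t - d) = d) : ∃ α < epsOm,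
    bigO (ordInterp C) d (d ^ 2 * t - 1) =
      Om * (Om * α + ordInterp C (d - 1)) + ordInterp C (d - 1) ∧
    ordInterp C (d ^ 2 * t - d) = theta (Om * α + (minBeta (Om * α) (ordInterp C d) +
      ω ^ ordInterp C (d - 1))) := by
  have h2 := hC.two_le_sInf
  have hd2 : 2 ≤ d := by omega
  obtain ⟨t, rfl⟩ := Nat.exists_eq_succ_of_ne_zero ht.ne'
  have hdd : d ^ 2 = d * (d - 1) + d := by
    rw [pow_two, Nat.mul_sub, mul_one, Nat.sub_add_cancel (Nat.le_mul_self d)]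
  have hdd' : d * 2 ≤ d * (d - 1) := Nat.mul_le_mul_left _ (by omega)
  have hy : d ^ 2 * (t + 1) - d = d ^ 2 * t + d * (d - 1) := by
    rw [mul_add, mul_one]
    omega
  have hy1 : d ^ 2 * (t + 1) - 1 = d ^ 2 * t + (d ^ 1 * (d - 1) + (d - 1)) := by
    rw [mul_add, mul_one, pow_one]
    omega
  obtain ⟨h3, h4, -⟩ := quotients (by omega) (dvd_mul_right (d ^ 2) t) (by omega) hy
  have hE := isEval_ordInterp hC hd2
  obtain ⟨α, hα, hα1, hα2⟩ := alphaWith_spec hE (d ^ 2 * (t + 1) - d)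
  rw [h3] at hα2
  refine ⟨α, hα, ?_, ?_⟩
  · rw [Nat.succ_eq_add_one, hy1, hE.add (dvd_mul_right _ _) (by rw [pow_one]; omega), hα2,
      hE.decomp_of_lt (by omega) (by rw [pow_one]; omega), bigO_one hC hd2, opow_one,
      hE.of_lt (by omega), mul_add, add_assoc]
  · have h5 : d ∣ d ^ 2 * (t + 1) - d := by
      rw [hy]
      exact dvd_add ((dvd_pow_self d two_ne_zero).mul_right t) (dvd_mul_right _ _)
    rw [Nat.succ_eq_add_one] at hb ⊢
    rw [ordInterp_theta hC hd hb (by omega) h5, hα1, h4, tilde, if_neg (by omega), tail,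
      if_neg (by omega)]

/-- An estimate of `ϑ(A[x] + s)`. -/
theorem theta_fsOm_add_le {α' α p x y s : Ordinal.{0}} (hα' : α' < epsOm) (hα : α < epsOm)
    (hp : p < Om) (hyp : y < p) (hx : x ≤ y) (hs : s ≤ y) (hys : y + s ≤ ω ^ y)
    (hc : maxCoeff (Om * α') ≤ y)
    (h : Om * fsOm (Om * α') x ≤ Om * (Om * α + y) + y) :
    theta (fsOm (Om * α') x + s) ≤ theta (Om * α + (minBeta (Om * α) p + ω ^ y)) := by
  have hyΩ := hyp.trans hp
  -- The hypothesis compares ordinals after multiplication by Ω; the summand y < Ω is too small to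
  -- matter when the factor is cancelled.
  have h1 : fsOm (Om * α') x ≤ Om * α + y := by
    by_contra! hlt
    have h2 : Om * (Om * α + y + 1) ≤ Om * fsOm (Om * α') x :=
      mul_le_mul_right (Order.add_one_le_of_lt hlt) _
    rw [mul_add, mul_one] at h2
    exact absurd (h2.trans h) (not_le.2 ((add_lt_add_iff_left _).2 hyΩ))
  have hρ : minBeta (Om * α) p + ω ^ y < Om :=
    add_lt_Om ((minBeta_le_self hα hp).trans_lt hp) (opow_lt_Om omega0_lt_Om hyΩ)
  have hζ := Om_mul_add_lt_epsOm hα hρ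
  have hpζ : p < theta (Om * α + (minBeta (Om * α) p + ω ^ y)) :=
    (lt_theta_minBeta hα hp).trans_le (theta_add_le_theta_add hα le_self_add hρ)
  have hyζ := hyp.trans hpζ
  refine theta_le_theta hζ ?_ ?_
  · calc fsOm (Om * α') x + s ≤ Om * α + y + s := by gcongr
      _ = Om * α + (y + s) := add_assoc _ _ _
      _ ≤ _ := (add_le_add_iff_left _).2 (hys.trans le_add_self)
  · have h2 : CoeffBelow (theta (Om * α + (minBeta (Om * α) p + ω ^ y)))
        (fsOm (Om * α') x + s) := by
      refine CoeffBelow.add (isPrincipal_theta hζ) (CoeffBelow.fsOm (isPrincipal_theta hζ)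
        ⟨Om_mul_lt_epsOm hα', hc.trans_lt hyζ⟩ (hx.trans_lt hyΩ) (hx.trans_lt hyζ))
        (coeffBelow_of_lt_Om (hs.trans_lt hyΩ) (hs.trans_lt hyζ))
    exact h2.2

end

end Ouroboros

/-! ### The comparison of o_B(n)[i] with o_C(U n - 1) -/

namespace Ouroboros

noncomputable section

namespace Ouro

variable {B C : Set ℕ} {k : ℕ} {U c : ℕ → ℕ}

theorem ordInterp_base_sub_lt (h : Ouro B C k U c) {n b : ℕ} (hc : Crit B n b) (j : ℕ) :
    ordInterp C (base U c b n (j + 1) - base U c b n j) <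
      ordInterp C (base U c b n (j + 1) - 1) := by
  have h4 := (h.good_base hc j).two_le'
  have h3 := h.base_lt_succ hc j
  exact ordInterp_strictMono h.hC (by omega)

theorem base_strictMono (h : Ouro B C k U c) {n b : ℕ} (hc : Crit B n b) :
    StrictMono (base U c b n) := strictMono_nat_of_lt_succ (h.base_lt_succ hc)

theorem ordInterp_le_base (h : Ouro B C k U c) (hq : 3 ≤ sInf B) {n b : ℕ} (hc : Crit B n b)
    (j : ℕ) : ordInterp B b ≤ ordInterp C (base U c b n j) :=
  (h.ordInterp_base_zero_le hc fun m _ => h.ordInterp_U hq m).1.trans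
    ((ordInterp_strictMono h.hC).monotone ((h.base_strictMono hc).monotone (Nat.zero_le j)))

/-- The fundamental sequence of `o(2 * b)`. -/
theorem fsTheta_le_of_eq_two (h : Ouro B C k U c) (hq : 3 ≤ sInf B) {n b : ℕ} (hc : Crit B n b)
    (hu : n / b ^ 2 = 0) (hv : n / b % b = 2) {j : ℕ} (hj : j ≤ k) :
    fsTheta (ordInterp B n) j ≤ ordInterp C (base U c b n (j + 1) - base U c b n j) := by
  have hbB := hc.mem h.hB
  obtain ⟨θ, m, hm, hob⟩ := exists_ordInterp_eq_opow_mul h.hB (hc.sInf_le h.hB)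
    (by rw [baseOf_self hbB])
  have hE := isEval_ordInterp h.hB (h.hB.two_le b hbB)
  have hα : alphaWith (ordInterp B) b n = 0 := by
    rw [alphaWith, hu, mul_zero, hE.zero, Ordinal.zero_div]
  have hp := belowBH_ordInterp h.hB b
  rw [(h.base_sub_eq hq hc j).2 ⟨hu, hv⟩, ordInterp_theta h.hB hbB hc.base hc.lt hc.dvd, hα, hu, hv,
    tilde, if_pos (by omega), tail, if_pos rfl, add_zero, zero_add]
  have hle := h.ordInterp_le_base hq hc
  -- Here d_{i+1} = 2·d_i, so o_C doubles at each link, which adds at least another o_B(b).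
  have hmul : ∀ i ≤ k, ordInterp B b * i ≤ ordInterp C (base U c b n i) := by
    intro i hi
    induction i with
    | zero => rw [Nat.cast_zero, mul_zero]; exact zero_le
    | succ i ih =>
      rw [h.ordInterp_base_succ hc (by omega), (h.base_sub_eq hq hc i).2 ⟨hu, hv⟩,
        ordinal_mul_two, Nat.cast_succ, mul_add, mul_one]
      exact add_le_add (ih (by omega)) (hle i)
  refine le_trans ?_ (hmul j hj)
  rw [hob] at hp ⊢
  rw [fsTheta_theta_minBeta_zero hm hp]
  have hm' : (0 : Ordinal.{0}) < m := by exact_mod_cast hm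
  gcongr
  exact Ordinal.le_mul_left _ hm'

/-- The fundamental sequence of the last term of `ζ`. -/
theorem fsTheta_opow_le (h : Ouro B C k U c) (hq : 3 ≤ sInf B) {u v i : ℕ} (huv : u ≠ 0 ∨ 2 ≤ v)
    (h0 : tilde (sInf B) u v ≠ 0) (hi : i + 2 ≤ sInf B)
    (hM : sInf B ∣ v → fsTheta (ordInterp B v) i < ordInterp C (U v - 1)) :
    fsTheta (ω ^ ordInterp B (tilde (sInf B) u v)) i ≤
      (tail (ordInterp C) (tilde (sInf C) u (U v - 1)) + 1) * i +
        tail (ordInterp C) (tilde (sInf C) u (U v - 1)) := by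
  have hv0 : v ≠ 0 := fun hv => h0 (Nat.le_zero.1 (hv ▸ tilde_le (sInf B) u v))
  by_cases hd : sInf B ∣ v
  · have hqv := Nat.le_of_dvd (Nat.pos_of_ne_zero hv0) hd
    have hw : tilde (sInf B) u v = v := by rw [tilde, if_neg (by omega)]
    rw [hw]
    refine le_trans ?_ le_add_self
    have hUv := h.strictMono.monotone hqv
    rw [h.U_sInf] at hUv
    -- This boundary case uses i ≤ min B - 2 in full. For u = 0 and v = min B, the digit U v - 1 =
    -- min B lies below min C and is shifted to min B - 2, so that only ω^{min B - 2} is available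
    -- to dominate ω^ω[i] = ω^i.
    by_cases hsp : u = 0 ∧ v = sInf B
    · obtain ⟨rfl, rfl⟩ := hsp
      rw [h.U_sInf, Nat.add_sub_cancel, tilde, h.sInf_eq, if_pos (by omega), tail,
        if_neg (by omega), ordInterp_sInf, ordInterp_of_lt (n := sInf B - 2)
        (by rw [h.sInf_eq]; omega)]
      rw [fsTheta_opow_of_lt_opow omega0_lt_Om isSuccLimit_omega0, fsTheta_omega0, theta_natCast]
      · refine opow_le_opow_right omega0_pos ?_
        exact_mod_cast (by omega : i ≤ sInf B - 2)
      · simpa using (opow_lt_opow_iff_right one_lt_omega0).2 one_lt_omega0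
    · have hw' : tilde (sInf C) u (U v - 1) = U v - 1 := by
        rw [tilde, h.sInf_eq, if_neg]
        rintro ⟨h1, -, h3⟩
        rcases hqv.eq_or_lt with h4 | h4
        · exact hsp ⟨h1, h4.symm⟩
        · have := h.strictMono h4
          rw [h.U_sInf] at this
          omega
      have hM := hM hd
      rw [hw', tail, if_neg (by omega)]
      refine (fsTheta_opow_limit_le (ordInterp_lt_Om h.hB v)
        (isSuccLimit_ordInterp h.hB (Nat.pos_of_ne_zero hv0) hd)
        (hM.trans (ordInterp_lt_Om h.hC _))).trans ?_
      exact opow_le_opow_right omega0_pos (Order.add_one_le_of_lt hM)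
  · have hw : tilde (sInf B) u (v - 1) + 1 = tilde (sInf B) u v := by
      rw [tilde] at h0
      rw [tilde, tilde]
      have : v ≠ sInf B := fun hv => hd (hv ▸ dvd_rfl)
      split_ifs at h0 ⊢ <;> omega
    have hdw : ¬sInf B ∣ tilde (sInf B) u (v - 1) + 1 := by
      rw [hw, tilde] at *
      split_ifs at h0 ⊢ with h1
      · exact fun h2 => by
          have := Nat.le_of_dvd (by omega) h2
          omega
      · exact hd
    have hUv := h.U_pred hq hv0 hd
    rw [hUv, Nat.add_sub_cancel, h.U_tilde, ← hw, ordInterp_succ h.hB hdw,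
      fsTheta_opow_add_one (belowBH_ordInterp h.hB _).omega0_opow]
    refine le_trans ?_ le_self_add
    gcongr
    generalize tilde (sInf B) u (v - 1) = s
    rw [tail]
    -- For digit 0 the tail is omitted, that is 0, whereas ω^{o(0)} = 1. The summand 1 in (t + 1)·i
    -- makes up for it.
    split_ifs with hs
    · have : s = 0 := h.strictMono.injective (hs.trans h.U_zero.symm)
      rw [this, ordInterp_zero h.hB, opow_zero, zero_add]
    · rw [h.ordInterp_U hq]
      exact le_self_add

/-- The fundamental sequence of `o(n)` for critical `n` with `ṽ > 0`. -/
theorem fsTheta_le_of_tilde_pos (h : Ouro B C k U c) (hq : 3 ≤ sInf B) {n b : ℕ}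
    (hc : Crit B n b) (h0 : tilde (sInf B) (n / b ^ 2) (n / b % b) ≠ 0) {i : ℕ} (hi : i ≤ k)
    (hi' : i + 2 ≤ sInf B)
    (hM : ∀ a < n, 0 < a → sInf B ∣ a → fsTheta (ordInterp B a) i < ordInterp C (U a - 1)) :
    fsTheta (ordInterp B n) i ≤ ordInterp C (base U c b n (i + 1) - base U c b n i) := by
  have hbB := hc.mem h.hB
  have hb2 := h.hB.two_le b hbB
  have hvb : n / b % b < b := Nat.mod_lt _ (by omega)
  have hv : 0 < n / b % b := by
    by_contra! hv
    have := tilde_le (sInf B) (n / b ^ 2) (n / b % b)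
    omega
  have huv : ¬(n / b ^ 2 = 0 ∧ n / b % b = 2) := by
    rintro ⟨h1, h2⟩
    rw [h1, h2, tilde, if_pos (by omega)] at h0
    omega
  obtain ⟨α, hα, hα1, -⟩ := ordInterp_crit_eq h.hB hc.base hc.lt hc.dvd (hc.sInf_le h.hB)
  have hbs := fun j hj => h.ordInterp_base_sub (j := j) hq hc (fun m _ => h.ordInterp_U hq m) hj
    hv huv
  have htail := h.fsTheta_opow_le hq hc.pos_or h0 hi'
    (fun hd => hM _ (hvb.trans hc.lt) hv hd)
  rw [ordInterp_theta h.hB hbB hc.base hc.lt hc.dvd]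
  rw [hα1] at hbs ⊢
  rw [tail, if_neg h0]
  have hwb : tilde (sInf B) (n / b ^ 2) (n / b % b) < b := (tilde_le _ _ _).trans_lt hvb
  generalize tilde (sInf B) (n / b ^ 2) (n / b % b) = w at *
  have htΩ : tail (ordInterp C) (tilde (sInf C) (n / b ^ 2) (U (n / b % b) - 1)) < Om :=
    (tail_le _ _).trans_lt (opow_lt_Om omega0_lt_Om (ordInterp_lt_Om h.hC _))
  generalize tail (ordInterp C) (tilde (sInf C) (n / b ^ 2) (U (n / b % b) - 1)) = t at *
  have hδ0 : ordInterp B w ≠ 0 := fun hw => by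
    rw [← ordInterp_zero h.hB] at hw
    exact h0 ((ordInterp_strictMono h.hB).injective hw)
  have hβΩ : ∀ j, minBeta (Om * α) (ordInterp C (base U c b n j)) < Om := fun j =>
    (minBeta_le_self hα (ordInterp_lt_Om h.hC _)).trans_lt (ordInterp_lt_Om h.hC _)
  -- As o_C(d_{j+1}) is at least ϑ(α + β_j + t), the next minimal value β_{j+1} must exceed β_j + t.
  have hgrow : ∀ j ≤ k, minBeta (Om * α) (ordInterp B b) + (t + 1) * j ≤
      minBeta (Om * α) (ordInterp C (base U c b n j)) := by
    intro j hj
    induction j with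
    | zero =>
      rw [Nat.cast_zero, mul_zero, add_zero]
      exact minBeta_mono hα (h.ordInterp_le_base hq hc 0) (ordInterp_lt_Om h.hC _)
    | succ j ih =>
      have h1 : theta (Om * α + (minBeta (Om * α) (ordInterp C (base U c b n j)) + t)) ≤
          ordInterp C (base U c b n (j + 1)) := by
        rw [← hbs j (by omega)]
        exact (ordInterp_strictMono h.hC).monotone (Nat.sub_le _ _)
      have h2 := lt_minBeta_of_theta_le hα (ordInterp_lt_Om h.hC _) (add_lt_Om (hβΩ j) htΩ) h1
      rw [Nat.cast_succ, mul_add, mul_one, ← add_assoc]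
      refine le_trans ?_ (Order.add_one_le_of_lt h2)
      rw [add_assoc _ t]
      exact add_le_add_left (ih (by omega)) _
  have hob := ordInterp_lt_Om h.hB b
  have hβ := minBeta_le_self hα hob
  have hδ : ordInterp B w ≤ ordInterp B b := (ordInterp_strictMono h.hB).monotone hwb.le
  rw [fsTheta_theta_limit hα (add_lt_Om (hβ.trans_lt hob)
    (opow_lt_Om omega0_lt_Om (ordInterp_lt_Om h.hB _)))
    (isSuccLimit_add _ (isSuccLimit_omega0_opow hδ0)) (not_isFix_minBeta_add_opow hα hob hδ0 hδ),
    hbs i hi]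
  refine theta_add_le_theta_add hα ?_ (add_lt_Om (hβΩ i) htΩ)
  refine (fsTheta_add_opow_le _ _ _).trans ?_
  calc _ ≤ minBeta (Om * α) (ordInterp B b) + ((t + 1) * i + t) := by gcongr
    _ = minBeta (Om * α) (ordInterp B b) + (t + 1) * i + t := (add_assoc _ _ _).symm
    _ ≤ _ := add_le_add_left (hgrow i hi) _

/-- The estimate for the case `v = 0`. -/
theorem theta_fsOm_le_of_eq_zero (h : Ouro B C k U c) (hq : 3 ≤ sInf B) {n b : ℕ}
    (hc : Crit B n b) (hv : n / b % b = 0) {α : Ordinal.{0}} (hα : α < epsOm) (hα0 : α ≠ 0)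
    (hα2 : bigO (ordInterp B) b (b ^ 2 * (n / b ^ 2)) = Om * (Om * α))
    (hα3 : maxCoeff (Om * α) ≤ ordInterp B b) :
    (cofin (Om * α) = Om ∨
      ∃ a < b, 0 < a ∧ sInf B ∣ a ∧ cofin (Om * α) = ordInterp B a) ∧
    ∀ j, 0 < j → j ≤ k → ∀ x s, x ≤ ordInterp C (base U c b n j - 1) →
      Admissible B C U b (base U c b n j) (cofin (Om * α)) x →
      s ≤ ordInterp C (base U c b n j - 1) →
      theta (fsOm (Om * α) x + s) ≤
        ordInterp C (base U c b n (j + 1) - base U c b n j) := by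
  have hbB := hc.mem h.hB
  have hb2 := h.hB.two_le b hbB
  have hn : b ^ 2 * (n / b ^ 2) = n := by
    have := hc.eq_add
    rw [hv, mul_zero, add_zero] at this
    exact this.symm
  rw [hn] at hα2
  have hl : IsSuccLimit (Om * α) := isSuccLimit_mul_left isSuccLimit_Om (pos_iff_ne_zero.2 hα0)
  have hA : Om ^ ((1 : ℕ) : Ordinal.{0}) * (Om * α) = bigO (ordInterp B) b n := by
    rw [Nat.cast_one, opow_one, hα2]
  -- The base d_0 may be min C itself. From d_1 on, the digit d_j - 1 is at least min C, so it has
  -- an infinite value and is not shifted.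
  have hbase : ∀ j, 0 < j → sInf B + 1 < base U c b n j := fun j hj => by
    rw [← h.sInf_eq]
    exact (Nat.sInf_le (h.base_mem hc (Nat.zero_le k))).trans_lt (h.base_strictMono hc hj)
  have hkey := fun j hj => h.fsOm_bigO_le hq (h.good_base hc j) (hbase j hj) n 1 le_rfl
    (by rw [pow_one]; exact hc.dvd) (Om * α) hA hl
  refine ⟨(hkey 1 one_pos).1, fun j hj hjk x s hx hadm hs => ?_⟩
  have h1 := (hkey j hj).2 x hadm
  rw [Nat.cast_one, opow_one, ← base_succ] at h1
  have hd := hbase j hj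
  obtain ⟨h2, ⟨t, h3⟩, -, h4⟩ := h.base_digits hc j
  obtain ⟨-, -, h5⟩ := h.base_sub hc hjk
  rw [hv, h.U_zero, mul_zero, add_zero, h3] at h2
  have ht : 0 < t := Nat.pos_of_ne_zero fun ht => by
    have := h.base_lt_succ hc j
    rw [h2, ht, mul_zero] at this
    omega
  rw [h2] at h1 h5 ⊢
  obtain ⟨α', hα', hval, hth⟩ := ordInterp_sub_base h.hC (h.base_mem hc hjk)
    (by rw [h.sInf_eq]; exact hd) ht h5
  rw [hval] at h1
  rw [hth]
  have hm := ordInterp_strictMono h.hC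
  refine theta_fsOm_add_le hα hα' (ordInterp_lt_Om h.hC _) (hm (by omega)) hx hs ?_ ?_ h1
  -- The value y of d_j - 1 is a successor, as min C divides d_j. It is therefore not an epsilon
  -- number, and y < ω^y yields y + s ≤ ω^y.
  · have hnd : ¬sInf C ∣ base U c b n j - 1 := fun hdd => by
      have h6 := h.hC.sInf_dvd (h.base_mem hc hjk)
      have h7 := (Nat.dvd_sub_iff_right (show 1 ≤ base U c b n j by omega) h6).1 hdd
      have h8 := Nat.le_of_dvd one_pos h7
      rw [h.sInf_eq] at h8
      omega
    obtain ⟨y, hy⟩ : ∃ y, ordInterp C (base U c b n j - 1) = y + 1 := by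
      obtain ⟨m, hm⟩ : ∃ m, base U c b n j - 1 = m + 1 := ⟨base U c b n j - 2, by omega⟩
      rw [hm] at hnd ⊢
      exact ⟨_, ordInterp_succ h.hC hnd⟩
    refine (add_le_add_right hs _).trans ?_
    rw [hy]
    have h6 : y + 1 < ω ^ (y + 1) := by
      refine lt_of_le_of_ne (right_le_opow _ one_lt_omega0) fun he => ?_
      have h7 := isSuccLimit_omega0_opow (ordinal_add_one_ne_zero y)
      rw [← he] at h7
      exact not_isSuccLimit_add_one y h7
    exact (isPrincipal_add_omega0_opow _ h6 h6).le
  · refine hα3.trans ((h.ordInterp_le_base hq hc 0).trans (hm.monotone ?_))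
    have := h.base_strictMono hc hj
    omega

/-- The fundamental sequence of `o(n)` for critical `n` with `v = 0`. -/
theorem fsTheta_le_of_eq_zero (h : Ouro B C k U c) (hq : 3 ≤ sInf B) {n b : ℕ}
    (hc : Crit B n b) (hv : n / b % b = 0) {i : ℕ} (h0 : 0 < i) (hi : i ≤ k)
    (hM : ∀ a < n, 0 < a → sInf B ∣ a → fsTheta (ordInterp B a) i < ordInterp C (U a - 1)) :
    fsTheta (ordInterp B n) i ≤ ordInterp C (base U c b n (i + 1) - base U c b n i) := by
  have hbB := hc.mem h.hB
  have hb2 := h.hB.two_le b hbB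
  have hmB := ordInterp_strictMono h.hB
  have hmC := ordInterp_strictMono h.hC
  obtain ⟨α, hα, hα1, hα2, hα3, -, -⟩ :=
    ordInterp_crit_eq h.hB hc.base hc.lt hc.dvd (hc.sInf_le h.hB)
  have hα3 := hα3.trans (hmB.monotone (Nat.sub_le b 1))
  have hα0 : α ≠ 0 := fun hα0 => by
    have hE := isEval_ordInterp h.hB hb2
    rw [hα0, mul_zero, mul_zero, ← hE.zero] at hα2
    have h1 := hE.strictMono.injective hα2
    have h2 := hc.eq_add
    have := hc.lt
    rw [h1, hv] at h2
    omega
  have hob := ordInterp_lt_Om h.hB b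
  have hΩ : ¬Om * α + minBeta (Om * α) (ordInterp B b) < Om :=
    not_lt.2 ((Om_le_Om_mul hα0).trans le_self_add)
  obtain ⟨hcof, hstep⟩ := h.theta_fsOm_le_of_eq_zero hq hc hv hα hα0 hα2 hα3
  have hζ := Om_mul_add_lt_epsOm hα ((minBeta_le_self hα hob).trans_lt hob)
  have hstar := thetaStar_minBeta_le hα hob hα3
  have hpred : ∀ j, 0 < j → ordInterp B b ≤ ordInterp C (base U c b n j - 1) := fun j hj =>
    (h.ordInterp_le_base hq hc 0).trans (hmC.monotone (by
      have := h.base_strictMono hc hj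
      omega))
  rw [ordInterp_theta h.hB hbB hc.base hc.lt hc.dvd, hv, tilde, if_neg (by omega), tail, if_pos rfl,
    add_zero, hα1, fsTheta_theta hζ, if_neg fun hh => hΩ hh.1,
    checkOrd_minBeta hα (belowBH_ordInterp h.hB b)]
  rcases hcof with hcof | ⟨a, hab, ha0, hqa, hcof⟩
  · rw [if_pos hcof]
    -- One link per iteration: the starting value ϑ* is at most o_B(b) ≤ o_C(d_1 - 1), and if x_j ≤
    -- o_C(d_{j+1} - 1), then x_{j+1} = ϑ(A[x_j]) ≤ o_C(d_{j+2} - d_{j+1}). The second conjunct,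
    -- available for j > 0, is the sharper bound that is wanted at the end.
    have hit : ∀ j, j ≤ k → (Nat.rec (thetaStar (Om * α + minBeta (Om * α) (ordInterp B b)))
        (fun _ x => theta (fsOm (Om * α) x)) j : Ordinal.{0}) ≤
        ordInterp C (base U c b n (j + 1) - 1) ∧
        (0 < j → (Nat.rec (thetaStar (Om * α + minBeta (Om * α) (ordInterp B b)))
        (fun _ x => theta (fsOm (Om * α) x)) j : Ordinal.{0}) ≤
        ordInterp C (base U c b n (j + 1) - base U c b n j)) := by
      intro j hj
      induction j with
      | zero => exact ⟨hstar.trans (hpred 1 one_pos), fun hh => absurd hh (lt_irrefl 0)⟩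
      | succ j ih =>
        obtain ⟨h1, -⟩ := ih (by omega)
        have h2 := hstep (j + 1) (Nat.succ_pos j) hj _ 0 h1
          ⟨fun _ => h1, fun a _ _ _ he => absurd (hcof.symm.trans he)
            (ordInterp_lt_Om h.hB a).ne'⟩ zero_le
        rw [add_zero] at h2
        exact ⟨h2.trans (h.ordInterp_base_sub_lt hc _).le, fun _ => h2⟩
    exact (hit i hi).2 h0
  -- A countable cofinality is o_B(a) for a digit a < b. The inner argument is then o_B(a)[i], which
  -- the induction hypothesis places below o_C(U a - 1), as `Admissible` demands.
  · have hoa := ordInterp_lt_Om h.hB a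
    have hlt : cofin (Om * α) < theta (Om * α + minBeta (Om * α) (ordInterp B b)) := by
      rw [hcof]
      exact (hmB hab).trans (lt_theta_minBeta hα hob)
    have hx := hM a (hab.trans hc.lt) ha0 hqa
    have hUa := (h.good_base hc i).lt a hab
    have hxd : fsTheta (ordInterp B a) i ≤ ordInterp C (base U c b n i - 1) :=
      hx.le.trans (hmC.monotone (by omega))
    rw [if_neg (by rw [hcof]; exact hoa.ne), if_pos hlt, hcof]
    refine hstep i h0 hi _ _ hxd ⟨fun _ => hxd, fun a' _ _ _ he => ?_⟩ (hstar.trans (hpred i h0))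
    rw [hcof] at he
    rwa [← hmB.injective he]

/-- With k = i + 1 the base c n is d_{i+1}, so the bound o_C(d_{i+1} - d_i) of all three cases is
strictly below o_C(c n - 1). -/
theorem fsTheta_lt_of_crit {i : ℕ} (h : Ouro B C (i + 1) U c) (h0 : 0 < i)
    (hi : i + 2 ≤ sInf B) {n b : ℕ} (hc : Crit B n b)
    (hM : ∀ a < n, 0 < a → sInf B ∣ a → fsTheta (ordInterp B a) i < ordInterp C (U a - 1)) :
    fsTheta (ordInterp B n) i < ordInterp C (c n - 1) := by
  rw [(h.c_eq_base hc).1]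
  refine lt_of_le_of_lt ?_ (h.ordInterp_base_sub_lt hc i)
  have hq : 3 ≤ sInf B := by omega
  by_cases ht : tilde (sInf B) (n / b ^ 2) (n / b % b) = 0
  · rcases tilde_pos_cases hc ht hq with ⟨hv, -⟩ | ⟨hu, hv⟩
    · exact h.fsTheta_le_of_eq_zero hq hc hv h0 (Nat.le_succ i) hM
    · exact h.fsTheta_le_of_eq_two hq hc hu hv (Nat.le_succ i)
  · exact h.fsTheta_le_of_tilde_pos hq hc ht (Nat.le_succ i) hi hM

/-- The stronger bound by c n at critical numbers is needed for bases: if d precedes n in B, then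
o(n) = o(n - d)·2 and U n = U(n - d) + c(n - d), so the last summand must be estimated by c(n - d) -
1 rather than by U(n - d) - 1. -/
theorem fsTheta_lt {i : ℕ} (h : Ouro B C (i + 1) U c) (h0 : 0 < i) (hi : i + 2 ≤ sInf B) (n : ℕ)
    (hn : 0 < n) (hd : sInf B ∣ n) : fsTheta (ordInterp B n) i < ordInterp C (U n - 1) ∧
      (baseOf B n ∣ n → fsTheta (ordInterp B n) i < ordInterp C (c n - 1)) := by
  induction n using Nat.strong_induction_on with
  | _ n ih =>
  have hq : 3 ≤ sInf B := by omega
  have hmB := ordInterp_strictMono h.hB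
  have hmC := ordInterp_strictMono h.hC
  have hqn := Nat.le_of_dvd hn hd
  have hcU : ordInterp C (c n - 1) ≤ ordInterp C (U n - 1) :=
    hmC.monotone (Nat.sub_le_sub_right (h.base_le n hqn) 1)
  rcases hqn.eq_or_lt with hqn' | hqn'
  · have h1 : fsTheta (ordInterp B n) i < ordInterp C (c n - 1) := by
      rw [← hqn', h.c_initial, ordInterp_sInf, fsTheta_omega0, Nat.add_sub_cancel,
        ordInterp_of_lt (by rw [h.sInf_eq]; omega)]
      exact_mod_cast (by omega : i < sInf B)
    exact ⟨h1.trans_le hcU, fun _ => h1⟩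
  by_cases hnB : n ∈ B
  · obtain ⟨d, hcon, hbd, hdn, h2d⟩ := exists_consec h.hB hnB hqn'
    have hdlt := hcon.2.2.1
    have hnd : d ∣ n - d := Nat.dvd_sub hdn dvd_rfl
    have hdd : d ≤ n - d := Nat.le_of_dvd (by omega) hnd
    have hqd : sInf B ≤ d := Nat.sInf_le hcon.1
    have h7 : baseOf B (n - d) = d :=
      Ouroboros.baseOf_eq hcon.1 hdd fun y hy hyx => hcon.2.2.2 y hy (by omega)
    obtain ⟨θ, m, hm, hθ⟩ := exists_ordInterp_eq_opow_mul h.hB (show sInf B ≤ n - d by omega)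
      (by rwa [h7])
    have ih1 := (ih (n - d) (by omega) (by omega)
      (Nat.dvd_sub hd (h.hB.sInf_dvd hcon.1))).2 (by rwa [h7])
    have hUn : U n = c n := h.U_base hnB
    have hm' : (0 : Ordinal.{0}) < m := by exact_mod_cast hm
    have hpos : 0 < ordInterp B (n - d) := by
      rw [← ordInterp_zero h.hB]; exact hmB (by omega)
    have hval : fsTheta (ordInterp B n) i =
        ordInterp B (n - d) + fsTheta (ordInterp B (n - d)) i := by
      rw [ordInterp_base h.hB hcon, ordinal_mul_two]
      refine fsTheta_add (θ := θ) (hθ ▸ dvd_mul_right _ _) hpos.ne' ?_ i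
      rw [hθ, opow_add, opow_one]
      exact (mul_lt_mul_iff_right₀ (opow_pos _ omega0_pos)).2 (natCast_lt_omega0 m)
    have hCval : ordInterp C (U n - 1) =
        ordInterp B (n - d) + ordInterp C (c (n - d) - 1) := by
      obtain ⟨h8, h9, h10⟩ := h.U_sub_pred hcon
      have h11 : sInf C ≤ U (n - d) := by
        rw [h.sInf_eq, ← h.U_sInf]
        exact h.strictMono.monotone (by omega)
      have hcp : 0 < c (n - d) := by
        have := h.hC.two_le _ (h.c_mem (n - d) (by omega))
        omega
      have h12 : U n - 1 = U (n - d) + (c (n - d) - 1) := by omega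
      rw [h12, ordInterp_add h.hC (by omega) h9 (h10.baseOf_eq (by
        have := h.base_le (n - d) (by omega)
        omega) (by omega)) h11, h.ordInterp_U hq]
    rw [← hUn, hval, hCval]
    have := (add_lt_add_iff_left (ordInterp B (n - d))).2 ih1
    exact ⟨this, fun _ => this⟩
  obtain ⟨hb1, hb2, hb3⟩ := baseOf_spec h.hB.nonempty hqn
  obtain ⟨b, hb⟩ : ∃ b, baseOf B n = b := ⟨_, rfl⟩
  rw [hb] at hb1 hb2 hb3 ⊢
  have hbn : b < n := hb2.lt_of_ne fun he => hnB (he ▸ hb1)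
  have h2b := h.hB.two_le b hb1
  have hqb : sInf B ≤ b := Nat.sInf_le hb1
  by_cases hdb : b ∣ n
  · have h1 := h.fsTheta_lt_of_crit h0 hi ⟨hb, hbn, hdb⟩ fun a ha ha0 hqa => (ih a ha ha0 hqa).1
    exact ⟨h1.trans_le hcU, fun _ => h1⟩
  refine ⟨?_, fun hh => absurd hh hdb⟩
  have h3 := Nat.div_add_mod n b
  have h4 := Nat.mod_lt n (show 0 < b by omega)
  have h5 : n % b ≠ 0 := fun hh => hdb (Nat.dvd_of_mod_eq_zero hh)
  have hx : b ∣ b * (n / b) := dvd_mul_right _ _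
  have hbx : b ≤ b * (n / b) := Nat.le_mul_of_pos_right _ (Nat.div_pos hbn.le (by omega))
  have hqr : sInf B ∣ n % b := (Nat.dvd_mod_iff (h.hB.sInf_dvd hb1)).2 hd
  generalize b * (n / b) = x at *
  generalize n % b = r at *
  subst h3
  obtain ⟨h6, h7, h8, h9⟩ := h.U_add hb hx h4 (by omega) hbx
  have hbx' : baseOf B x = b := (h.c_noncrit_add hb hx h4 (by omega) hbx).1
  have h10 : sInf C ≤ U x := by
    rw [h.sInf_eq, ← h.U_sInf]
    exact h.strictMono.monotone (by omega)
  have hr0 : 0 < r := Nat.pos_of_ne_zero h5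
  have hUr : 0 < U r := by
    have := h.strictMono hr0
    omega
  have hcx : c x ≤ U x := h.base_le x (by omega)
  have h11 : baseOf C (U x + (U r - 1)) = c x := by
    have h12 := h.c_noncrit_add hb hx h4 (by omega) hbx
    have h13 := h.baseOf_eq (x + r) (by omega) (U x + (U r - 1)) (by omega) (by omega)
    rw [h13, h12.2]
  obtain ⟨θ, m, hm, hθ⟩ := exists_ordInterp_eq_opow_mul h.hB (show sInf B ≤ x by omega)
    (by rwa [hbx'])
  have hpos : ordInterp B r ≠ 0 := by
    have := hmB hr0
    rw [ordInterp_zero h.hB] at this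
    exact this.ne'
  have hval : fsTheta (ordInterp B (x + r)) i = ordInterp B x + fsTheta (ordInterp B r) i := by
    rw [ordInterp_add h.hB h4 hx hb (by omega)]
    refine fsTheta_add (θ := θ) (hθ ▸ dvd_mul_right _ _) hpos ?_ i
    refine (hmB (show r < x by omega)).trans ?_
    rw [hθ, opow_add, opow_one]
    exact (mul_lt_mul_iff_right₀ (opow_pos _ omega0_pos)).2 (natCast_lt_omega0 m)
  rw [hval, h6, Nat.add_sub_assoc hUr, ordInterp_add h.hC (by omega) h7 h11 h10,
    h.ordInterp_U hq]
  exact (add_lt_add_iff_left _).2 (ih r (by omega) hr0 hqr).1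

theorem fsTheta_le {i : ℕ} (h : Ouro B C (i + 1) U c) (h0 : 0 < i) (hi : i + 2 ≤ sInf B) {n : ℕ}
    (hn : 0 < n) : fsTheta (ordInterp B n) i ≤ ordInterp C (U n - 1) := by
  by_cases hd : sInf B ∣ n
  · exact (h.fsTheta_lt h0 hi n hn hd).1.le
  · have hq : 3 ≤ sInf B := by omega
    rw [h.U_pred hq hn.ne' hd, Nat.add_sub_cancel, h.ordInterp_U hq]
    obtain ⟨m, rfl⟩ := Nat.exists_eq_succ_of_ne_zero hn.ne'
    rw [Nat.succ_sub_one, ordInterp_succ h.hB hd, fsTheta_add_one]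

end Ouro

end

end Ouroboros
theorem mainTheorem4 (B : Set ℕ) (hB : Ouroboros.IsBaseHierarchy B) (i : ℕ) (hi : 0 < i)
    (hi' : i < sInf B - 1) (n : ℕ) (hn : 0 < n) :
    ∃ k : ℕ, Ouroboros.upgrade B (Ouroboros.ouroboros B (i + 1)) n = ((k + 1 : ℕ) : ℕ∞) ∧
      Ouroboros.fsTheta (Ouroboros.ordInterp B n) i ≤
        Ouroboros.ordInterp (Ouroboros.ouroboros B (i + 1)) k := by
  obtain ⟨U, c, h⟩ := Ouroboros.exists_ouro hB (Nat.le_add_left 1 i)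
  have h0 := h.strictMono hn
  refine ⟨U n - 1, ?_, h.fsTheta_le hi (by omega) hn⟩
  rw [h.up, Nat.sub_add_cancel (by omega)]
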